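/- Let $c_1,c_2\in\mathbb R$ with $c_2^2>0$ and $c_1^2-\tfrac43c_2^2>0$, and for $u=(u^1,u^2,u^3)$ let $$Lu=\partial_t^2u-c_2^2\Delta u-(c_1^2-c_2^2)\nabla(\nabla\cdot u),\qquad (L_\gamma u)^I=(Lu)^I+\gamma^{IJ,jk}\partial_j\partial_ku^J$$ (summation over $J,j,k\in\{1,2,3\}$). Let $\mathcal K\subset\mathbb R^3$ be a compact obstacle with smooth boundary, $0\in\mathcal K\subset\{|x|<1\}$, and let $\eta\in C^\infty(\mathbb R^3)$ with $\eta\equiv0$ on $\mathcal K$ and $\eta\equiv1$ for $|x|>1$. Put $$S=t\partial_t+r\partial_r-1,\qquad \tilde S=t\partial_t+\eta(x)\,r\partial_r-1,\qquad v'=\partial v=(\partial_tv,\partial_1v,\partial_2v,\partial_3v).$$ Here $\partial^\alpha$ denotes space-time derivatives, $\alpha\in\mathbb N^4$; $\|\cdot\|_2$ and $\|\cdot\|_\infty$ are the $L^2$ and $L^\infty$ norms over $\mathbb R^3\setminus\mathcal K$, and $L^2(|x|<1)$ refers to $\{x\in\mathbb R^3\setminus\mathcal K:|x|<1\}$. Set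 $$e_0[v]=\tfrac12|\partial_tv|^2+\tfrac{c_2^2}2|\nabla v|^2+\tfrac{c_1^2-c_2^2}2(\nabla\cdot v)^2-\tfrac12\gamma^{IJ,ij}\partial_iv^I\partial_jv^J,\qquad X_{\mu,j}(t)=\int_{\mathbb R^3\setminus\mathcal K}e_0[\tilde S^\mu\partial_t^ju](t,x)\,dx,$$ and, for an operator $P$ on scalar functions, $[P,\gamma^{kl}\partial_k\partial_l]u=\sum_{I,J,k,l=1}^3\bigl|[P,\gamma^{IJ,kl}\partial_k\partial_l]u^J\bigr|$. There is $\delta_0>0$ depending only on $c_1,c_2$ such that for all $\mathcal K,\eta$ as above and all integers $N,\nu\ge0$ there are constants $A>0$ and $C\ge0$ with the following property. Let $0<\delta\le\delta_0$, let $\gamma^{IJ,jk}$ be smooth on $[0,\infty)\times\overline{\mathbb R^3\setminus\mathcal K}$ with $\gamma^{IJ,jk}=\gamma^{JI,kj}$ and, for all $t\ge0$, $$\sum_{I,J,j,k=1}^3\|\gamma^{IJ,jk}(t,\cdot)\|_\infty\le\frac{\delta}{1+t},\qquad \sum_{I,J,j,k=1}^3\sum_{\beta=0}^3\|\partial_\beta\gamma^{IJ,jk}(t,\cdot)\|_\infty\le\frac\delta{1+t}.$$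 Let $u$ be smooth on $[0,\infty)\times\overline{\mathbb R^3\setminus\mathcal K}$ and solve $L_\gamma u=F$ in $(0,\infty)\times(\mathbb R^3\setminus\mathcal K)$, $u|_{\partial\mathcal K}=0$, $u(0,\cdot)=f$, $\partial_tu(0,\cdot)=g$. Suppose that for every $T\ge 0$, $u$ vanishes on $[0,T]\times(\mathbb R^3\setminus\mathcal K)$ for $|x|$ large, and that $H:\mathbb R\to[0,\infty]$ satisfies, for all $t\ge0$, $$\sum_{j+\mu\le N+\nu,\ \mu\le\nu}\Bigl(\|\tilde S^\mu\partial_t^jL_\gamma u(t,\cdot)\|_2+\|[\tilde S^\mu\partial_t^j,\gamma^{kl}\partial_k\partial_l]u(t,\cdot)\|_2\Bigr)\le\frac\delta{1+t}\sum_{j+\mu\le N+\nu,\ \mu\le\nu}\|\tilde S^\mu\partial_t^ju'(t,\cdot)\|_2+H(t).$$ Then for every $t\ge0$ $$\begin{aligned}\sum_{|\alpha|+\mu\le N+\nu,\ \mu\le\nu}\|S^\mu\partial^\alpha u'(t,\cdot)\|_2\le C\Bigl[&\sum_{|\alpha|+\mu\le N+\nu-1,\ \mu\le\nu}\|S^\mu\partial^\alpha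 Lu(t,\cdot)\|_2+(1+t)^{A\delta}\sum_{j+\mu\le N+\nu,\ \mu\le\nu}X_{\mu,j}^{1/2}(0)\\&+(1+t)^{A\delta}\Bigl(\int_0^t\sum_{|\alpha|+\mu\le N+\nu-1,\ \mu\le\nu-1}\|S^\mu\partial^\alpha Lu(s,\cdot)\|_2\,ds+\int_0^tH(s)\,ds\Bigr)\\&+(1+t)^{A\delta}\int_0^t\sum_{|\alpha|+\mu\le N+\nu,\ \mu\le\nu-1}\|S^\mu\partial^\alpha u'(s,\cdot)\|_{L^2(|x|<1)}\,ds\Bigr],\end{aligned}$$ where empty sums are $0$ (and $\int_0^tH$ is the lower integral if $H$ is not measurable). -/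

import Mathlib

open scoped ContDiff ENNReal NNReal Topology

namespace ExteriorElastic

noncomputable section

/-- Three-dimensional Euclidean space, used both for positions and for displacement vectors. -/
abbrev E3 : Type := EuclideanSpace ℝ (Fin 3)

/-- Space-time points `(t, x)`. -/
abbrev SpaceTime : Type := ℝ × E3

/-- A bounded obstacle with smooth boundary, normalized by `0 ∈ K ⊆ {|x| < 1}`: near each of its
boundary points, `K` is the sublevel set `{φ ≤ 0}` of a smooth function with nonzero differential. -/
structure IsSmoothObstacle (K : Set E3) : Prop where
  isCompact : IsCompact K
  zero_mem : (0 : E3) ∈ K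
  subset_ball : K ⊆ Metric.ball 0 1
  smooth_boundary : ∀ x ∈ frontier K, ∃ φ : E3 → ℝ, ContDiff ℝ ∞ φ ∧ fderiv ℝ φ x ≠ 0 ∧
    ∀ᶠ y in 𝓝 x, (y ∈ K ↔ φ y ≤ 0)

section Operators

variable {F : Type*} [NormedAddCommGroup F] [NormedSpace ℝ F]

/-- The coordinate directions of space-time: index `0` is time, index `k + 1` is the `k`-th
spatial direction. -/
def dir : Fin 4 → SpaceTime :=
  Fin.cons ((1 : ℝ), (0 : E3)) fun k : Fin 3 => ((0 : ℝ), EuclideanSpace.single k (1 : ℝ))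

/-- The partial derivative `∂_β`, `β = 0, 1, 2, 3`, with `∂_0 = ∂_t`. -/
def pd (β : Fin 4) (f : SpaceTime → F) : SpaceTime → F :=
  fun p => fderiv ℝ f p (dir β)

/-- The space-time derivative `∂^α = ∂_t^{α 0} ∂_1^{α 1} ∂_2^{α 2} ∂_3^{α 3}`. -/
def pdMulti (α : Fin 4 → ℕ) (f : SpaceTime → F) : SpaceTime → F :=
  (pd 0)^[α 0] ((pd 1)^[α 1] ((pd 2)^[α 2] ((pd 3)^[α 3] f)))

/-- The full space-time gradient `f' = (∂_0 f, ∂_1 f, ∂_2 f, ∂_3 f)`, with its Euclidean norm. -/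
def grad (f : SpaceTime → F) : SpaceTime → PiLp 2 (fun _ : Fin 4 => F) :=
  fun p => WithLp.toLp 2 fun β => pd β f p

/-- The scaling operator `S = t ∂_t + r ∂_r - 1`; here `r ∂_r = x · ∇`. -/
def scal (f : SpaceTime → F) : SpaceTime → F :=
  fun p => p.1 • pd 0 f p + fderiv ℝ f p (0, p.2) - f p

/-- The modified scaling operator `t ∂_t + η(x) r ∂_r - 1`. -/
def scalMod (η : E3 → ℝ) (f : SpaceTime → F) : SpaceTime → F :=
  fun p => p.1 • pd 0 f p + η p.2 • fderiv ℝ f p (0, p.2) - f p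

/-- The `L²` norm over the set `D` of `f(t, ·)`. -/
def l2Norm (D : Set E3) (f : SpaceTime → F) (t : ℝ) : ℝ≥0∞ :=
  MeasureTheory.eLpNorm (fun x => f (t, x)) 2 (MeasureTheory.volume.restrict D)

/-- The `L^∞` norm over the set `D` of `f(t, ·)`. -/
def supNorm (D : Set E3) (f : SpaceTime → F) (t : ℝ) : ℝ≥0∞ :=
  MeasureTheory.eLpNorm (fun x => f (t, x)) ∞ (MeasureTheory.volume.restrict D)

end Operators

/-- The `J`-th component of a vector field. -/
def comp (u : SpaceTime → E3) (J : Fin 3) : SpaceTime → ℝ := fun p => u p J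

/-- The spatial divergence `∇ · u`. -/
def divergence (u : SpaceTime → E3) : SpaceTime → ℝ :=
  fun p => ∑ k : Fin 3, pd k.succ (comp u k) p

/-- The operator of linear elasticity
`L u = ∂_t² u - c₂² Δ u - (c₁² - c₂²) ∇ (∇ · u)`. -/
def elastic (c₁ c₂ : ℝ) (u : SpaceTime → E3) : SpaceTime → E3 := fun p =>
  pd 0 (pd 0 u) p - c₂ ^ 2 • ∑ k : Fin 3, pd k.succ (pd k.succ u) p
    - (c₁ ^ 2 - c₂ ^ 2) • WithLp.toLp 2 fun I : Fin 3 => pd I.succ (divergence u) p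

/-- Variable coefficients: `γ I J j k` is `γ^{IJ,jk}`, a function on space-time. -/
abbrev Coeff : Type := Fin 3 → Fin 3 → Fin 3 → Fin 3 → SpaceTime → ℝ

/-- The perturbed operator `(L_γ u)^I = (L u)^I + γ^{IJ,jk} ∂_j ∂_k u^J`. -/
def elasticPert (c₁ c₂ : ℝ) (γ : Coeff) (u : SpaceTime → E3) : SpaceTime → E3 := fun p =>
  elastic c₁ c₂ u p + WithLp.toLp 2 fun I : Fin 3 =>
    ∑ J : Fin 3, ∑ j : Fin 3, ∑ k : Fin 3, γ I J j k p * pd j.succ (pd k.succ (comp u J)) p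

/-- The energy density
`e₀[u] = ½ |∂_t u|² + ½ c₂² |∇ u|² + ½ (c₁² - c₂²) (∇ · u)² - ½ γ^{IJ,ij} ∂_i u^I ∂_j u^J`. -/
def energyDensity (c₁ c₂ : ℝ) (γ : Coeff) (u : SpaceTime → E3) : SpaceTime → ℝ := fun p =>
  1 / 2 * ‖pd 0 u p‖ ^ 2 + c₂ ^ 2 / 2 * ∑ k : Fin 3, ‖pd k.succ u p‖ ^ 2
    + (c₁ ^ 2 - c₂ ^ 2) / 2 * divergence u p ^ 2
    - 1 / 2 * ∑ I : Fin 3, ∑ J : Fin 3, ∑ i : Fin 3, ∑ j : Fin 3,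
        γ I J i j p * pd i.succ (comp u I) p * pd j.succ (comp u J) p

/-- `X_{μ,j}(t)`, the integral over the exterior of `K` of the energy density of
`S̃^μ ∂_t^j u`, where `S̃` is the modified scaling operator with cutoff `η`. -/
def energyX (c₁ c₂ : ℝ) (K : Set E3) (η : E3 → ℝ) (γ : Coeff) (u : SpaceTime → E3)
    (μ j : ℕ) (t : ℝ) : ℝ :=
  ∫ x in Kᶜ, energyDensity c₁ c₂ γ ((scalMod η)^[μ] ((pd 0)^[j] u)) (t, x)

/-- For an operator `P` on scalar functions, the function
`∑_{I,J,k,l} |[P, γ^{IJ,kl} ∂_k ∂_l] u^J|`. -/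
def commSum (P : (SpaceTime → ℝ) → SpaceTime → ℝ) (γ : Coeff) (u : SpaceTime → E3) :
    SpaceTime → ℝ := fun p =>
  ∑ I : Fin 3, ∑ J : Fin 3, ∑ k : Fin 3, ∑ l : Fin 3,
    |P (fun q => γ I J k l q * pd k.succ (pd l.succ (comp u J)) q) p
      - γ I J k l p * pd k.succ (pd l.succ (P (comp u J))) p|

/-- `u` is a smooth solution of `L_γ u = F` in `ℝ₊ × (ℝ³ \ K)` with `u = 0` on `∂K` and Cauchy data
`(f, g)` at `t = 0`. Smooth means smooth up to the boundary of `[0,∞) × (ℝ³ \ K)`; as usual this is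
expressed by `u` being the restriction of a smooth function on space-time (denoted by the same
letter), whose values and derivatives enter only on `[0,∞) × (ℝ³ \ K)` and its boundary. -/
structure IsSmoothSolution (c₁ c₂ : ℝ) (K : Set E3) (γ : Coeff) (F : SpaceTime → E3)
    (f g : E3 → E3) (u : SpaceTime → E3) : Prop where
  smooth : ContDiff ℝ ∞ u
  equation : ∀ t : ℝ, 0 < t → ∀ x ∈ Kᶜ, elasticPert c₁ c₂ γ u (t, x) = F (t, x)
  boundary : ∀ t : ℝ, 0 ≤ t → ∀ x ∈ frontier K, u (t, x) = 0
  init : ∀ x ∈ Kᶜ, u (0, x) = f x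
  init_dt : ∀ x ∈ Kᶜ, pd 0 u (0, x) = g x

/-- The pairs `(μ, j)` with `μ < a` and `j + μ < b`. -/
def timeIdx (a b : ℕ) : Finset (ℕ × ℕ) :=
  (Finset.range a ×ˢ Finset.range b).filter fun q => q.2 + q.1 < b

/-- The pairs `(μ, α)`, with `α` a space-time multi-index, such that `μ < a` and `|α| + μ < b`. -/
def fullIdx (a b : ℕ) : Finset (ℕ × (Fin 4 → ℕ)) :=
  (Finset.range a ×ˢ Fintype.piFinset fun _ : Fin 4 => Finset.range b).filter
    fun q => (∑ i, q.2 i) + q.1 < b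

end

end ExteriorElastic

open ExteriorElastic

/-! The proof is an energy estimate for the functions `v = S̃^μ ∂_t^j u`, followed by elliptic
regularity, which turns control of these `v'` into control of all `S^μ ∂^α u'`.

Energy. Since `η = 0` on `K`, both `∂_t` and `S̃` preserve the Dirichlet condition (`Adm.pd_zero`,
`Adm.scalMod`). Integrating the pointwise identity `pd_energyDensity` over the exterior therefore
leaves no boundary term, and the energy of `v` grows at most at the rate `‖∂_t v‖ ‖L_γ v‖ +
O(δ/(1+t)) ‖v'‖²` (`energy_deriv_le`). Because `c₂² ≤ c₁²`, the density `e₀` dominates `|v'|²` as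
soon as `δ ≤ c₂²/2`, which fixes the threshold `δ₀`. With `P = S̃^μ ∂_t^j` one has `L_γ P u = P L_γ
u - [P, γ∂∂]u + [L, P]u`. The first two terms are bounded by hypothesis. The last is split at `|x| =
1` (`l2Norm_comm_le`): outside, `S̃ = S` and `[L, S] = 2L`, so only `Lu` appears; inside, there
remain local norms of `u'`. Both parts contain at least one `S` less. The terms of size `δ/(1+t)`
times the energy produce the factor `(1+t)^{Aδ}` through a Gronwall inequality for the square root
of the energy (`sqrt_le_of_deriv_le`, `exists_totalEnergy_le`).

Regularity (`gnorm_le_main`). Write `L = ∂_t² - A`. The functions `∂_t v` and `S̃ v` again satisfy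
the Dirichlet condition, and `S - S̃` is a first order operator with bounded static coefficients, so
induction reduces everything to bounding second spatial derivatives by `A v` and first derivatives
(`elliptic_estimate`). This is done without flattening the boundary. For a field `Z` tangential to
`∂K`, `Zv` vanishes on `∂K`, and testing `A Z v = Z A v + [A, Z] v` against `Zv` bounds `‖∇ Z v‖`
(`tangential_estimate`). Near `∂K = {φ = 0}` the rotations `∂_jφ ∂_l - ∂_lφ ∂_j` are tangential
(`isTangential_rotField`); they determine the Hessian of `v` up to its normal-normal part, which
ellipticity recovers from `A v` (`frame_algebra`). All integrations by parts rest on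
`integral_fderiv_compl_eq_zero`, a divergence theorem for functions vanishing on `∂K` that avoids
surface measure. -/

namespace ExteriorElastic

noncomputable section

/-! ### Calculus of the operators `pd`, `scal`, `scalMod` on smooth functions -/

section Calculus

variable {F : Type*} [NormedAddCommGroup F] [NormedSpace ℝ F]
variable {G : Type*} [NormedAddCommGroup G] [NormedSpace ℝ G]

/-- Smooth functions on space-time. -/
abbrev Smooth (f : SpaceTime → F) : Prop := ContDiff ℝ ∞ f

theorem Smooth.diff {f : SpaceTime → F} (hf : Smooth f) : Differentiable ℝ f :=
  hf.differentiable (by simp)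

theorem Smooth.fderiv {f : SpaceTime → F} (hf : Smooth f) : ContDiff ℝ ∞ (fderiv ℝ f) :=
  hf.fderiv_right (by simp)

theorem Smooth.pd {f : SpaceTime → F} (hf : Smooth f) (β : Fin 4) : Smooth (pd β f) :=
  hf.fderiv.clm_apply contDiff_const

theorem pd_iterate_smooth {f : SpaceTime → F} (hf : Smooth f) (β : Fin 4) (n : ℕ) :
    Smooth ((pd β)^[n] f) := by
  induction n with
  | zero => exact hf
  | succ n ih => rw [Function.iterate_succ_apply']; exact ih.pd β

theorem Smooth.clm {f : SpaceTime → F} (hf : Smooth f) (L : F →L[ℝ] G) :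
    Smooth (fun p => L (f p)) := L.contDiff.comp hf

theorem pd_clm {f : SpaceTime → F} (hf : Smooth f) (L : F →L[ℝ] G) (β : Fin 4) :
    pd β (fun p => L (f p)) = fun p => L (pd β f p) := by
  funext p
  have : HasFDerivAt (fun p => L (f p)) (L.comp (fderiv ℝ f p)) p :=
    L.hasFDerivAt.comp p (hf.diff p).hasFDerivAt
  simp [pd, this.fderiv]

theorem pd_add {f g : SpaceTime → F} (hf : Smooth f) (hg : Smooth g) (β : Fin 4) :
    pd β (f + g) = pd β f + pd β g := by
  funext p
  simp [pd, fderiv_add (hf.diff p) (hg.diff p)]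

theorem pd_sub {f g : SpaceTime → F} (hf : Smooth f) (hg : Smooth g) (β : Fin 4) :
    pd β (f - g) = pd β f - pd β g := by
  funext p
  simp [pd, fderiv_sub (hf.diff p) (hg.diff p)]

theorem pd_const_smul {f : SpaceTime → F} (hf : Smooth f) (c : ℝ) (β : Fin 4) :
    pd β (c • f) = c • pd β f := by
  funext p
  simp [pd, fderiv_const_smul (hf.diff p) c]

theorem pd_sum {ι : Type*} {s : Finset ι} {f : ι → SpaceTime → F} (hf : ∀ i ∈ s, Smooth (f i))
    (β : Fin 4) : pd β (∑ i ∈ s, f i) = ∑ i ∈ s, pd β (f i) := by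
  funext p
  simp [pd, fderiv_sum (fun i hi => (hf i hi).diff p)]

theorem pd_smul {b : SpaceTime → ℝ} {f : SpaceTime → F} (hb : Smooth b) (hf : Smooth f)
    (β : Fin 4) : pd β (b • f) = pd β b • f + b • pd β f := by
  funext p
  simp [pd, fderiv_smul (hb.diff p) (hf.diff p), add_comm]

theorem Smooth.isSymm {f : SpaceTime → F} (hf : Smooth f) (p : SpaceTime) :
    IsSymmSndFDerivAt ℝ f p := by
  apply (hf.contDiffAt).isSymmSndFDerivAt
  simp only [minSmoothness_of_isRCLikeNormedField]
  exact WithTop.coe_le_coe.2 le_top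

theorem fderiv_pd {f : SpaceTime → F} (hf : Smooth f) (β : Fin 4) (p : SpaceTime) :
    fderiv ℝ (pd β f) p = (fderiv ℝ (fderiv ℝ f) p).flip (dir β) := by
  have hd : HasFDerivAt (fderiv ℝ f) (fderiv ℝ (fderiv ℝ f) p) p :=
    ((hf.fderiv.differentiable (by simp)) p).hasFDerivAt
  have := hd.clm_apply (hasFDerivAt_const (dir β) p)
  rw [show pd β f = fun q => fderiv ℝ f q (dir β) from rfl, this.fderiv]
  simp

theorem pd_comm {f : SpaceTime → F} (hf : Smooth f) (α β : Fin 4) :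
    pd α (pd β f) = pd β (pd α f) := by
  funext p
  change fderiv ℝ (pd β f) p (dir α) = fderiv ℝ (pd α f) p (dir β)
  rw [fderiv_pd hf, fderiv_pd hf]
  exact hf.isSymm p _ _

theorem Smooth.euler {f : SpaceTime → F} (hf : Smooth f) :
    Smooth (fun p => _root_.fderiv ℝ f p p) :=
  hf.fderiv.clm_apply contDiff_id

theorem spatial_eq_sum (x : E3) :
    ((0 : ℝ), x) = ∑ k : Fin 3, x k • dir k.succ := by
  have hx : x = ∑ k : Fin 3, x k • EuclideanSpace.single k (1 : ℝ) := by
    ext i; simp [Fin.sum_univ_three]; fin_cases i <;> simp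
  have : ∀ k : Fin 3, x k • dir k.succ = ((0 : ℝ), x k • EuclideanSpace.single k (1 : ℝ)) := by
    intro k; simp [dir]
  simp only [this]
  ext1
  · simp [Prod.fst_sum]
  · simpa [Prod.snd_sum] using hx

theorem point_eq_sum (p : SpaceTime) :
    p = p.1 • dir 0 + ∑ k : Fin 3, p.2 k • dir k.succ := by
  rw [← spatial_eq_sum]
  ext1 <;> simp [dir]

theorem fderiv_spatial (f : SpaceTime → F) (p : SpaceTime) (x : E3) :
    fderiv ℝ f p (0, x) = ∑ k : Fin 3, x k • pd k.succ f p := by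
  rw [spatial_eq_sum, map_sum]; simp [pd]

theorem scal_apply (f : SpaceTime → F) (p : SpaceTime) :
    scal f p = fderiv ℝ f p p - f p := by
  have : fderiv ℝ f p p = p.1 • pd 0 f p + fderiv ℝ f p (0, p.2) := by
    have h : fderiv ℝ f p (p.1 • dir 0 + (0, p.2)) = p.1 • pd 0 f p + fderiv ℝ f p (0, p.2) := by
      simp [pd]
    rw [← h, spatial_eq_sum, ← point_eq_sum p]
  rw [scal, this]

theorem Smooth.scal {f : SpaceTime → F} (hf : Smooth f) : Smooth (scal f) := by
  have : ExteriorElastic.scal f = fun p => _root_.fderiv ℝ f p p - f p := funext (scal_apply f)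
  rw [this]; exact hf.euler.sub hf

theorem scal_iterate_smooth {f : SpaceTime → F} (hf : Smooth f) (n : ℕ) :
    Smooth (scal^[n] f) := by
  induction n with
  | zero => exact hf
  | succ n ih => rw [Function.iterate_succ_apply']; exact ih.scal

theorem scal_clm {f : SpaceTime → F} (hf : Smooth f) (L : F →L[ℝ] G) :
    scal (fun p => L (f p)) = fun p => L (scal f p) := by
  funext p
  have : HasFDerivAt (fun p => L (f p)) (L.comp (fderiv ℝ f p)) p :=
    L.hasFDerivAt.comp p (hf.diff p).hasFDerivAt
  simp [scal_apply, this.fderiv]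

theorem scal_add {f g : SpaceTime → F} (hf : Smooth f) (hg : Smooth g) :
    scal (f + g) = scal f + scal g := by
  funext p
  simp [scal_apply, fderiv_add (hf.diff p) (hg.diff p)]; abel

theorem scal_sub {f g : SpaceTime → F} (hf : Smooth f) (hg : Smooth g) :
    scal (f - g) = scal f - scal g := by
  funext p
  simp [scal_apply, fderiv_sub (hf.diff p) (hg.diff p)]; abel

theorem scal_const_smul {f : SpaceTime → F} (hf : Smooth f) (c : ℝ) :
    scal (c • f) = c • scal f := by
  funext p
  simp [scal_apply, fderiv_const_smul (hf.diff p) c, smul_sub]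

/-- The commutation relation `∂_β S = (S + 1) ∂_β`. -/
theorem pd_scal {f : SpaceTime → F} (hf : Smooth f) (β : Fin 4) :
    pd β (scal f) = scal (pd β f) + pd β f := by
  funext p
  have hd : HasFDerivAt (fderiv ℝ f) (fderiv ℝ (fderiv ℝ f) p) p :=
    ((hf.fderiv.differentiable (by simp)) p).hasFDerivAt
  have h2 : HasFDerivAt (scal f) (((fderiv ℝ f p).comp (ContinuousLinearMap.id ℝ SpaceTime)
      + (fderiv ℝ (fderiv ℝ f) p).flip p) - fderiv ℝ f p) p := by
    have : scal f = fun p => fderiv ℝ f p p - f p := funext (scal_apply f)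
    rw [this]
    exact (hd.clm_apply (hasFDerivAt_id p)).sub (hf.diff p).hasFDerivAt
  have h3 := hf.isSymm p p (dir β)
  simp only [Pi.add_apply, scal_apply, fderiv_pd hf]
  simp only [pd, h2.fderiv]
  simp [h3]

end Calculus

/-! ### Time-independent coefficients -/

/-- Smooth time-independent functions which are constant for large `|x|`. -/
structure IsCoef (b : SpaceTime → ℝ) : Prop where
  smooth : Smooth b
  static : ∀ t x, b (t, x) = b (0, x)
  const : ∃ R c : ℝ, ∀ t : ℝ, ∀ x : E3, R < ‖x‖ → b (t, x) = c

section Coef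

variable {F : Type*} [NormedAddCommGroup F] [NormedSpace ℝ F]

theorem IsCoef.bounded {b : SpaceTime → ℝ} (hb : IsCoef b) : ∃ C : ℝ≥0, ∀ p, ‖b p‖ ≤ C := by
  obtain ⟨R, c, h⟩ := hb.const
  have hc : Continuous fun x : E3 => b (0, x) := hb.smooth.continuous.comp (by fun_prop)
  obtain ⟨C, hC⟩ := (isCompact_closedBall (0 : E3) R).exists_bound_of_continuousOn hc.continuousOn
  refine ⟨Real.toNNReal (max C ‖c‖), fun p => ?_⟩
  refine le_trans ?_ (Real.le_coe_toNNReal _)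
  by_cases hp : R < ‖p.2‖
  · rw [← Prod.mk.eta (p := p), h p.1 p.2 hp]; exact le_max_right _ _
  · rw [← Prod.mk.eta (p := p), hb.static]
    exact (hC _ (by simpa using hp)).trans (le_max_left _ _)

theorem IsCoef.pd_zero {b : SpaceTime → ℝ} (hb : IsCoef b) : pd 0 b = 0 := by
  funext p
  have h1 : HasDerivAt (fun s : ℝ => b (p.1 + s, p.2)) (pd 0 b p) 0 := by
    have h2 : HasFDerivAt b (fderiv ℝ b p) ((fun s : ℝ => (p.1 + s, p.2)) 0) := by
      simpa using (hb.smooth.diff p).hasFDerivAt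
    have h3 : HasDerivAt (fun s : ℝ => (p.1 + s, p.2)) ((1 : ℝ), (0 : E3)) 0 :=
      ((hasDerivAt_id (0 : ℝ)).const_add p.1).prodMk (hasDerivAt_const _ _)
    exact h2.comp_hasDerivAt 0 h3
  have h4 : (fun s : ℝ => b (p.1 + s, p.2)) = fun _ => b (0, p.2) := by
    funext s; exact hb.static _ _
  rw [h4] at h1
  exact h1.unique (hasDerivAt_const _ _)

theorem fderiv_eq_zero_of_const_far {b : SpaceTime → F} {R : ℝ} {c : F}
    (h : ∀ t : ℝ, ∀ x : E3, R < ‖x‖ → b (t, x) = c) (t : ℝ) (x : E3) (hx : R < ‖x‖) :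
    fderiv ℝ b (t, x) = 0 := by
  have : b =ᶠ[𝓝 (t, x)] fun _ => c := by
    have ho : IsOpen {p : SpaceTime | R < ‖p.2‖} := isOpen_lt (by fun_prop) (by fun_prop)
    filter_upwards [ho.mem_nhds (show (t, x) ∈ {p : SpaceTime | R < ‖p.2‖} from hx)] with p hp
    exact h p.1 p.2 hp
  rw [this.fderiv_eq]; simp

theorem fderiv_static {b : SpaceTime → ℝ} (hb : IsCoef b) (t : ℝ) (x : E3) :
    fderiv ℝ b (t, x) = fderiv ℝ b (0, x) := by
  have : b = fun p => b (p + (-t, 0)) := by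
    funext p
    rw [← Prod.mk.eta (p := p), Prod.mk_add_mk, add_zero, hb.static (p.1 + -t), hb.static p.1]
  conv_lhs => rw [this]
  rw [fderiv_comp_add_right]; simp

theorem IsCoef.pd {b : SpaceTime → ℝ} (hb : IsCoef b) (β : Fin 4) : IsCoef (pd β b) := by
  refine ⟨hb.smooth.pd β, fun t x => ?_, ?_⟩
  · simp [ExteriorElastic.pd, fderiv_static hb t x]
  · obtain ⟨R, c, h⟩ := hb.const
    exact ⟨R, 0, fun t x hx => by
      simp [ExteriorElastic.pd, fderiv_eq_zero_of_const_far h t x hx]⟩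

theorem IsCoef.mul {b d : SpaceTime → ℝ} (hb : IsCoef b) (hd : IsCoef d) : IsCoef (b * d) := by
  refine ⟨hb.smooth.mul hd.smooth, fun t x => ?_, ?_⟩
  · simp [hb.static t x, hd.static t x]
  · obtain ⟨R, c, h⟩ := hb.const
    obtain ⟨R', c', h'⟩ := hd.const
    exact ⟨max R R', c * c', fun t x hx => by
      simp [h t x (lt_of_le_of_lt (le_max_left _ _) hx),
        h' t x (lt_of_le_of_lt (le_max_right _ _) hx)]⟩

theorem IsCoef.add {b d : SpaceTime → ℝ} (hb : IsCoef b) (hd : IsCoef d) : IsCoef (b + d) := by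
  refine ⟨hb.smooth.add hd.smooth, fun t x => ?_, ?_⟩
  · simp [hb.static t x, hd.static t x]
  · obtain ⟨R, c, h⟩ := hb.const
    obtain ⟨R', c', h'⟩ := hd.const
    exact ⟨max R R', c + c', fun t x hx => by
      simp [h t x (lt_of_le_of_lt (le_max_left _ _) hx),
        h' t x (lt_of_le_of_lt (le_max_right _ _) hx)]⟩

theorem isCoef_const (c : ℝ) : IsCoef (fun _ => c) :=
  ⟨contDiff_const, fun _ _ => rfl, ⟨0, c, fun _ _ _ => rfl⟩⟩

/-- The radial derivative `x · ∇ b` of a coefficient. -/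
def radial (b : SpaceTime → ℝ) : SpaceTime → ℝ := fun p => _root_.fderiv ℝ b p p

theorem IsCoef.radial {b : SpaceTime → ℝ} (hb : IsCoef b) : IsCoef (radial b) := by
  refine ⟨hb.smooth.euler, fun t x => ?_, ?_⟩
  · have h0 : ∀ t, ExteriorElastic.radial b (t, x) = fderiv ℝ b (0, x) (0, x) := by
      intro t
      have : ((t, x) : SpaceTime) = t • dir 0 + (0, x) := by simp [dir]
      have h1 := congrFun hb.pd_zero (0, x)
      simp only [ExteriorElastic.pd, Pi.zero_apply] at h1
      simp only [ExteriorElastic.radial]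
      rw [fderiv_static hb, this, map_add, map_smul, h1]; simp
    rw [h0, h0]
  · obtain ⟨R, c, h⟩ := hb.const
    exact ⟨R, 0, fun t x hx => by
      simp [ExteriorElastic.radial, fderiv_eq_zero_of_const_far h t x hx]⟩

theorem scal_smul {b : SpaceTime → ℝ} {f : SpaceTime → F} (hb : IsCoef b) (hf : Smooth f) :
    scal (b • f) = radial b • f + b • scal f := by
  funext p
  simp [scal_apply, fderiv_smul (hb.smooth.diff p) (hf.diff p), radial, smul_sub]
  abel

/-- A smooth function on space which is constant for large `|x|`, as a coefficient. -/
theorem isCoef_of_spatial {b : E3 → ℝ} (hb : ContDiff ℝ ∞ b) {R c : ℝ}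
    (h : ∀ x : E3, R < ‖x‖ → b x = c) : IsCoef (fun p => b p.2) :=
  ⟨hb.comp contDiff_snd, fun _ _ => rfl, ⟨R, c, fun _ x hx => h x hx⟩⟩

/-- The hypotheses on the cutoff function of the modified scaling operator. -/
structure IsCutoff (K : Set E3) (η : E3 → ℝ) : Prop where
  smooth : ContDiff ℝ ∞ η
  zero : ∀ x ∈ K, η x = 0
  one : ∀ x : E3, 1 < ‖x‖ → η x = 1

/-- The coefficients `(1 - η(x)) x_l` of `S - S̃`. -/
def defect (η : E3 → ℝ) (l : Fin 3) : SpaceTime → ℝ := fun p => (1 - η p.2) * p.2 l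

variable {K : Set E3} {η : E3 → ℝ}

theorem IsCutoff.isCoef_defect (hη : IsCutoff K η) (l : Fin 3) : IsCoef (defect η l) := by
  refine isCoef_of_spatial (b := fun x => (1 - η x) * x l) (R := 1) (c := 0) ?_ ?_
  · have := hη.smooth
    fun_prop
  · intro x hx; simp [hη.one x hx]

theorem IsCutoff.isCoef_self (hη : IsCutoff K η) : IsCoef (fun p => η p.2) :=
  isCoef_of_spatial hη.smooth hη.one

/-- For a cutoff `η` the coefficients of `S - S̃` vanish when `|x| > 1`. Commutation rules for `S̃`
are thus those of `S` corrected by first order terms living near the obstacle. -/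
theorem scalMod_eq (η : E3 → ℝ) (f : SpaceTime → F) :
    scalMod η f = scal f - ∑ l : Fin 3, defect η l • pd l.succ f := by
  funext p
  simp only [scalMod, scal, fderiv_spatial, Pi.sub_apply, Pi.add_apply, Pi.smul_apply',
    defect, mul_smul, Fin.sum_univ_three]
  module

theorem IsCoef.smul {b : SpaceTime → ℝ} {f : SpaceTime → F} (hb : IsCoef b) (hf : Smooth f) :
    Smooth (b • f) := hb.smooth.smul hf

theorem Smooth.sum {ι : Type*} {s : Finset ι} {f : ι → SpaceTime → F}
    (hf : ∀ i ∈ s, Smooth (f i)) : Smooth (∑ i ∈ s, f i) := by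
  have : (∑ i ∈ s, f i) = fun p => ∑ i ∈ s, f i p := by funext p; simp
  rw [this]; exact ContDiff.sum hf

theorem Smooth.scalMod (hη : IsCutoff K η) {f : SpaceTime → F} (hf : Smooth f) :
    Smooth (scalMod η f) := by
  rw [scalMod_eq]
  exact hf.scal.sub (Smooth.sum fun l _ => (hη.isCoef_defect l).smul (hf.pd _))

theorem scalMod_iterate_smooth (hη : IsCutoff K η) {f : SpaceTime → F} (hf : Smooth f) (n : ℕ) :
    Smooth ((scalMod η)^[n] f) := by
  induction n with
  | zero => exact hf
  | succ n ih => rw [Function.iterate_succ_apply']; exact ih.scalMod hη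

theorem scalMod_clm {G : Type*} [NormedAddCommGroup G] [NormedSpace ℝ G]
    {f : SpaceTime → F} (hf : Smooth f) (L : F →L[ℝ] G) :
    scalMod η (fun p => L (f p)) = fun p => L (scalMod η f p) := by
  funext p
  have h := congrFun (scal_clm hf L) p
  simp [scalMod_eq, scal_clm hf, pd_clm hf]

theorem scalMod_add {f g : SpaceTime → F} (hf : Smooth f) (hg : Smooth g) :
    scalMod η (f + g) = scalMod η f + scalMod η g := by
  simp only [scalMod_eq, scal_add hf hg, pd_add hf hg, smul_add, Finset.sum_add_distrib]
  abel

theorem scalMod_const_smul {f : SpaceTime → F} (hf : Smooth f) (c : ℝ) :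
    scalMod η (c • f) = c • scalMod η f := by
  funext p
  simp [scalMod_eq, scal_const_smul hf, pd_const_smul hf, smul_sub, Finset.smul_sum,
    smul_comm c]

theorem scalMod_smul (hη : IsCutoff K η) {b : SpaceTime → ℝ} (hb : IsCoef b) : ∃ b' : SpaceTime → ℝ, IsCoef b' ∧
      ∀ f : SpaceTime → F, Smooth f → scalMod η (b • f) = b' • f + b • scalMod η f := by
  -- This coefficient is `η(x) x·∇b`: the full radial derivative of `b` minus the part belonging to
  -- `S - S̃`.
  refine ⟨radial b + ∑ l : Fin 3, (fun _ => (-1 : ℝ)) * (defect η l * pd l.succ b), ?_, ?_⟩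
  · simp only [Fin.sum_univ_three]
    have h := fun l => (isCoef_const (-1)).mul ((hη.isCoef_defect l).mul (hb.pd l.succ))
    exact hb.radial.add (((h 0).add (h 1)).add (h 2))
  · intro f hf
    funext p
    simp only [scalMod_eq, scal_smul hb hf, pd_smul hb.smooth hf, Fin.sum_univ_three, Pi.add_apply,
      Pi.smul_apply', Pi.sub_apply, Pi.mul_apply]
    module

/-- `∂_β S̃ = S̃ ∂_β + ∂_β - ∑ (∂_β e_l) ∂_l` with `e_l` the defect coefficients. -/
theorem pd_scalMod (hη : IsCutoff K η) {f : SpaceTime → F} (hf : Smooth f) (β : Fin 4) :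
    pd β (scalMod η f) = scalMod η (pd β f) + pd β f
      - ∑ l : Fin 3, pd β (defect η l) • pd l.succ f := by
  have hs : ∀ l ∈ (Finset.univ : Finset (Fin 3)), Smooth (defect η l • pd l.succ f) :=
    fun l _ => (hη.isCoef_defect l).smul (hf.pd _)
  simp only [scalMod_eq]
  rw [pd_sub hf.scal (Smooth.sum hs), pd_sum hs, pd_scal hf]
  simp only [pd_smul (hη.isCoef_defect _).smooth (hf.pd _), pd_comm hf β, Finset.sum_add_distrib]
  abel

theorem IsCutoff.pd_zero_defect (hη : IsCutoff K η) (l : Fin 3) : pd 0 (defect η l) = 0 :=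
  (hη.isCoef_defect l).pd_zero

/-- `∂_t S̃ = (S̃ + 1) ∂_t`. -/
theorem pd_zero_scalMod (hη : IsCutoff K η) {f : SpaceTime → F} (hf : Smooth f) :
    pd 0 (scalMod η f) = scalMod η (pd 0 f) + pd 0 f := by
  rw [pd_scalMod hη hf]; simp [hη.pd_zero_defect]

end Coef

end

end ExteriorElastic

namespace ExteriorElastic

noncomputable section

/-! ### Bounds up to a constant -/

/-- `Φ ≤ C Ψ` on `P`, at all times `t ≥ 0`, for some constant `C`. -/
def Dom {X : Type*} (P : X → Prop) (Φ Ψ : X → ℝ → ℝ≥0∞) : Prop :=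
  ∃ C : ℝ≥0, ∀ f, P f → ∀ t, 0 ≤ t → Φ f t ≤ C * Ψ f t

namespace Dom

variable {X Y : Type*} {P : X → Prop} {Φ Φ' Ψ Θ : X → ℝ → ℝ≥0∞}

theorem of_le (h : ∀ f, P f → ∀ t, 0 ≤ t → Φ f t ≤ Ψ f t) : Dom P Φ Ψ :=
  ⟨1, fun f hf t ht => by simpa using h f hf t ht⟩

theorem refl : Dom P Φ Φ := of_le fun _ _ _ _ => le_rfl

theorem trans (h₁ : Dom P Φ Ψ) (h₂ : Dom P Ψ Θ) : Dom P Φ Θ := by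
  obtain ⟨C, hC⟩ := h₁
  obtain ⟨D, hD⟩ := h₂
  refine ⟨C * D, fun f hf t ht => (hC f hf t ht).trans ?_⟩
  rw [ENNReal.coe_mul, mul_assoc]
  gcongr
  exact hD f hf t ht

theorem le_trans (h₁ : ∀ f, P f → ∀ t, 0 ≤ t → Φ f t ≤ Ψ f t) (h₂ : Dom P Ψ Θ) : Dom P Φ Θ :=
  (of_le h₁).trans h₂

theorem trans_le (h₁ : Dom P Φ Ψ) (h₂ : ∀ f, P f → ∀ t, 0 ≤ t → Ψ f t ≤ Θ f t) : Dom P Φ Θ :=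
  h₁.trans (of_le h₂)

theorem zero : Dom P (fun _ _ => 0) Ψ := of_le fun _ _ _ _ => zero_le

theorem add (h₁ : Dom P Φ Ψ) (h₂ : Dom P Φ' Ψ) : Dom P (fun f t => Φ f t + Φ' f t) Ψ := by
  obtain ⟨C, hC⟩ := h₁
  obtain ⟨D, hD⟩ := h₂
  refine ⟨C + D, fun f hf t ht => ?_⟩
  rw [ENNReal.coe_add, add_mul]
  exact add_le_add (hC f hf t ht) (hD f hf t ht)

theorem sum {ι : Type*} {s : Finset ι} {Φ : ι → X → ℝ → ℝ≥0∞} (h : ∀ i ∈ s, Dom P (Φ i) Ψ) :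
    Dom P (fun f t => ∑ i ∈ s, Φ i f t) Ψ := by
  classical
  induction s using Finset.induction_on with
  | empty => simpa using zero
  | insert a s ha ih =>
    simp only [Finset.sum_insert ha]
    exact (h a (by simp)).add (ih fun i hi => h i (by simp [hi]))

theorem of_eq_zero (h : ∀ f t, Φ f t = 0) : Dom P Φ Ψ := of_le fun f _ t _ => by simp [h]

theorem const_mul (C : ℝ≥0) (h : Dom P Φ Ψ) : Dom P (fun f t => C * Φ f t) Ψ := by
  obtain ⟨D, hD⟩ := h
  refine ⟨C * D, fun f hf t ht => ?_⟩
  rw [ENNReal.coe_mul, mul_assoc]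
  beta_reduce
  gcongr
  exact hD f hf t ht

theorem comp {Q : Y → Prop} (h : Dom P Φ Ψ) (g : Y → X) (hg : ∀ f, Q f → P (g f)) :
    Dom Q (fun f => Φ (g f)) (fun f => Ψ (g f)) := by
  obtain ⟨C, hC⟩ := h
  exact ⟨C, fun f hf => hC (g f) (hg f hf)⟩

theorem mono {Q : X → Prop} (h : Dom P Φ Ψ) (hg : ∀ f, Q f → P f) : Dom Q Φ Ψ :=
  h.comp id hg

theorem add_right (h : Dom P Φ Ψ) : Dom P Φ (fun f t => Ψ f t + Θ f t) :=
  h.trans_le fun _ _ _ _ => le_self_add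

theorem add_left (h : Dom P Φ Ψ) : Dom P Φ (fun f t => Θ f t + Ψ f t) :=
  h.trans_le fun _ _ _ _ => le_add_self

theorem add_add {Ψ' : X → ℝ → ℝ≥0∞} (h₁ : Dom P Φ Ψ) (h₂ : Dom P Φ' Ψ') :
    Dom P (fun f t => Φ f t + Φ' f t) (fun f t => Ψ f t + Ψ' f t) :=
  h₁.add_right.add h₂.add_left

end Dom

/-! ### The `L²` norm and the norms `wnorm` counting `S` and derivatives -/

section L2

variable {F : Type*} [NormedAddCommGroup F] [NormedSpace ℝ F]
variable {G : Type*} [NormedAddCommGroup G] [NormedSpace ℝ G]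
variable {D : Set E3} {t : ℝ}

theorem Smooth.csmul {f : SpaceTime → F} (hf : Smooth f) (c : ℝ) : Smooth (c • f) :=
  contDiff_const.smul hf

theorem Smooth.plus {f g : SpaceTime → F} (hf : Smooth f) (hg : Smooth g) : Smooth (f + g) :=
  ContDiff.add hf hg

theorem Smooth.minus {f g : SpaceTime → F} (hf : Smooth f) (hg : Smooth g) : Smooth (f - g) :=
  ContDiff.sub hf hg

theorem single_le_sum_ennreal {ι : Type*} {s : Finset ι} {g : ι → ℝ≥0∞} {i : ι} (hi : i ∈ s) :
    g i ≤ ∑ j ∈ s, g j :=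
  Finset.single_le_sum (fun _ _ => zero_le) hi

theorem Smooth.slice {f : SpaceTime → F} (hf : Smooth f) (t : ℝ) :
    Continuous fun x : E3 => f (t, x) := hf.continuous.comp (by fun_prop)

theorem Smooth.aesm {f : SpaceTime → F} (hf : Smooth f) (t : ℝ) (μ : MeasureTheory.Measure E3) :
    MeasureTheory.AEStronglyMeasurable (fun x : E3 => f (t, x)) μ :=
  (hf.slice t).aestronglyMeasurable

theorem l2Norm_add_le {f g : SpaceTime → F} (hf : Smooth f) (hg : Smooth g) :
    l2Norm D (f + g) t ≤ l2Norm D f t + l2Norm D g t :=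
  MeasureTheory.eLpNorm_add_le (hf.aesm t _) (hg.aesm t _) (by norm_num)

theorem l2Norm_neg (f : SpaceTime → F) : l2Norm D (-f) t = l2Norm D f t :=
  MeasureTheory.eLpNorm_neg (fun x => f (t, x)) _ _

theorem l2Norm_sum_le {ι : Type*} {s : Finset ι} {f : ι → SpaceTime → F}
    (hf : ∀ i ∈ s, Smooth (f i)) : l2Norm D (∑ i ∈ s, f i) t ≤ ∑ i ∈ s, l2Norm D (f i) t := by
  have := MeasureTheory.eLpNorm_sum_le (μ := MeasureTheory.volume.restrict D) (p := 2)
    (f := fun i x => f i (t, x)) (s := s) (fun i hi => (hf i hi).aesm t _) (by norm_num)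
  refine le_trans (le_of_eq ?_) this
  rw [l2Norm]; congr 1; funext x; simp

theorem l2Norm_le_mul {f : SpaceTime → F} {g : SpaceTime → G} (hD : MeasurableSet D) {C : ℝ≥0}
    (h : ∀ x ∈ D, ‖f (t, x)‖ ≤ C * ‖g (t, x)‖) : l2Norm D f t ≤ C * l2Norm D g t := by
  have := MeasureTheory.eLpNorm_le_nnreal_smul_eLpNorm_of_ae_le_mul (c := C) (p := 2)
    (μ := MeasureTheory.volume.restrict D) (f := fun x => f (t, x)) (g := fun x => g (t, x))
    ((MeasureTheory.ae_restrict_iff' hD).2 (Filter.Eventually.of_forall h))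
  simpa [l2Norm, ENNReal.smul_def] using this

theorem l2Norm_mono {f : SpaceTime → F} {g : SpaceTime → G} (hD : MeasurableSet D)
    (h : ∀ x ∈ D, ‖f (t, x)‖ ≤ ‖g (t, x)‖) : l2Norm D f t ≤ l2Norm D g t := by
  simpa using l2Norm_le_mul (C := 1) hD (f := f) (g := g) (by simpa using h)

theorem l2Norm_congr {f g : SpaceTime → F} (hD : MeasurableSet D)
    (h : ∀ x ∈ D, f (t, x) = g (t, x)) : l2Norm D f t = l2Norm D g t :=
  le_antisymm (l2Norm_mono hD fun x hx => by rw [h x hx])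
    (l2Norm_mono hD fun x hx => by rw [h x hx])

/-- A pointwise bound by a sum of smooth functions gives the corresponding bound for `L²` norms. -/
theorem l2Norm_le_sum {ι : Type*} {s : Finset ι} {f : SpaceTime → F} {g : ι → SpaceTime → G}
    (hD : MeasurableSet D) (hg : ∀ i ∈ s, Smooth (g i)) {C : ℝ≥0}
    (h : ∀ x ∈ D, ‖f (t, x)‖ ≤ C * ∑ i ∈ s, ‖g i (t, x)‖) :
    l2Norm D f t ≤ C * ∑ i ∈ s, l2Norm D (g i) t := by
  have h1 : l2Norm D f t ≤ C * l2Norm D (fun p => ∑ i ∈ s, ‖g i p‖) t := by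
    refine l2Norm_le_mul hD fun x hx => (h x hx).trans ?_
    gcongr
    exact le_abs_self _
  refine h1.trans ?_
  gcongr
  have := MeasureTheory.eLpNorm_sum_le (μ := MeasureTheory.volume.restrict D) (p := 2)
    (f := fun i x => ‖g i (t, x)‖) (s := s) (fun i hi => ((hg i hi).aesm t _).norm) (by norm_num)
  refine le_trans (le_of_eq ?_) (this.trans (le_of_eq ?_))
  · rw [l2Norm]; congr 1; funext x; simp
  · simp [l2Norm, MeasureTheory.eLpNorm_norm]

theorem l2Norm_mono_set {D' : Set E3} (h : D ⊆ D') (f : SpaceTime → F) :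
    l2Norm D f t ≤ l2Norm D' f t :=
  MeasureTheory.eLpNorm_mono_measure _ (MeasureTheory.Measure.restrict_mono h le_rfl)

/-- The sum of the `L²(D)` norms of all words in `S` and `∂_β` of length less than `n` with fewer
than `a` factors `S`, applied to `f`. -/
def wnorm (D : Set E3) : ℕ → ℕ → (SpaceTime → F) → ℝ → ℝ≥0∞
  | _, 0, _, _ => 0
  | 0, _ + 1, _, _ => 0
  | a + 1, n + 1, f, t =>
    l2Norm D f t + ∑ β : Fin 4, wnorm D (a + 1) n (pd β f) t + wnorm D a n (scal f) t

@[simp] theorem wnorm_zero_right (a : ℕ) (f : SpaceTime → F) : wnorm D a 0 f t = 0 := by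
  simp [wnorm]

@[simp] theorem wnorm_zero_left (n : ℕ) (f : SpaceTime → F) : wnorm D 0 n f t = 0 := by
  cases n <;> simp [wnorm]

theorem wnorm_succ (a n : ℕ) (f : SpaceTime → F) :
    wnorm D (a + 1) (n + 1) f t =
      l2Norm D f t + ∑ β : Fin 4, wnorm D (a + 1) n (pd β f) t + wnorm D a n (scal f) t := by
  simp [wnorm]

theorem wnorm_one_one (f : SpaceTime → F) : wnorm D 1 1 f t = l2Norm D f t := by
  simp [wnorm_succ]

theorem wnorm_mono {a a' n n' : ℕ} (ha : a ≤ a') (hn : n ≤ n') (f : SpaceTime → F) :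
    wnorm D a n f t ≤ wnorm D a' n' f t := by
  induction n' generalizing a a' n f with
  | zero => simp [Nat.le_zero.1 hn]
  | succ n' ih =>
    rcases n with _ | n
    · simp
    rcases a with _ | a
    · simp
    obtain ⟨a', rfl⟩ : ∃ b, a' = b + 1 := ⟨a' - 1, by omega⟩
    rw [wnorm_succ, wnorm_succ]
    gcongr with β
    · exact ih ha (by omega) _
    · exact ih (by omega) (by omega) _

theorem l2Norm_le_wnorm (a n : ℕ) (f : SpaceTime → F) :
    l2Norm D f t ≤ wnorm D (a + 1) (n + 1) f t := by
  rw [← wnorm_one_one]; exact wnorm_mono (by omega) (by omega) f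

theorem wnorm_pd_le (a n : ℕ) (β : Fin 4) (f : SpaceTime → F) :
    wnorm D a n (pd β f) t ≤ wnorm D a (n + 1) f t := by
  rcases a with _ | a
  · simp
  rw [wnorm_succ]
  refine le_add_right (le_add_left ?_)
  exact Finset.single_le_sum (f := fun β => wnorm D (a + 1) n (pd β f) t)
    (fun _ _ => zero_le) (Finset.mem_univ β)

theorem wnorm_scal_le (a n : ℕ) (f : SpaceTime → F) :
    wnorm D a n (scal f) t ≤ wnorm D (a + 1) (n + 1) f t := by
  rw [wnorm_succ]; exact le_add_self

theorem wnorm_mono_set {D' : Set E3} (h : D ⊆ D') (a n : ℕ) (f : SpaceTime → F) :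
    wnorm D a n f t ≤ wnorm D' a n f t := by
  induction n generalizing a f with
  | zero => simp
  | succ n ih =>
    rcases a with _ | a
    · simp
    rw [wnorm_succ, wnorm_succ]
    gcongr with β
    · exact l2Norm_mono_set h f
    · exact ih _ _
    · exact ih _ _

theorem wnorm_add_le {f g : SpaceTime → F} (hf : Smooth f) (hg : Smooth g) (a n : ℕ) :
    wnorm D a n (f + g) t ≤ wnorm D a n f t + wnorm D a n g t := by
  induction n generalizing a f g with
  | zero => simp
  | succ n ih =>
    rcases a with _ | a
    · simp
    simp only [wnorm_succ, pd_add hf hg, scal_add hf hg]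
    have h1 := l2Norm_add_le (D := D) (t := t) hf hg
    have h2 : ∑ β : Fin 4, wnorm D (a + 1) n (pd β f + pd β g) t
        ≤ ∑ β : Fin 4, wnorm D (a + 1) n (pd β f) t + ∑ β : Fin 4, wnorm D (a + 1) n (pd β g) t := by
      rw [← Finset.sum_add_distrib]
      exact Finset.sum_le_sum fun β _ => ih (hf.pd β) (hg.pd β) _
    have h3 := ih hf.scal hg.scal a
    refine (add_le_add (add_le_add h1 h2) h3).trans (le_of_eq ?_)
    abel

theorem l2Norm_zero : l2Norm D (0 : SpaceTime → F) t = 0 := by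
  simp only [l2Norm, Pi.zero_apply]
  exact MeasureTheory.eLpNorm_zero

theorem l2Norm_clm_le (hD : MeasurableSet D) (f : SpaceTime → F) (L : F →L[ℝ] G) :
    l2Norm D (fun p => L (f p)) t ≤ ‖L‖₊ * l2Norm D f t :=
  l2Norm_le_mul hD fun _ _ => L.le_opNorm _

theorem wnorm_clm_le (hD : MeasurableSet D) {f : SpaceTime → F} (hf : Smooth f) (L : F →L[ℝ] G)
    (a n : ℕ) : wnorm D a n (fun p => L (f p)) t ≤ ‖L‖₊ * wnorm D a n f t := by
  induction n generalizing a f with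
  | zero => simp
  | succ n ih =>
    rcases a with _ | a
    · simp
    simp only [wnorm_succ, pd_clm hf, scal_clm hf, mul_add, Finset.mul_sum]
    gcongr with β
    · exact l2Norm_clm_le hD f L
    · exact ih (hf.pd β) _
    · exact ih hf.scal _

theorem wnorm_const_smul_le (hD : MeasurableSet D) {f : SpaceTime → F} (hf : Smooth f) (c : ℝ)
    (a n : ℕ) : wnorm D a n (c • f) t ≤ ‖c‖₊ * wnorm D a n f t := by
  refine (wnorm_clm_le hD hf (c • ContinuousLinearMap.id ℝ F) a n).trans ?_
  gcongr
  rw [nnnorm_smul]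
  refine mul_le_of_le_one_right' ?_
  exact ContinuousLinearMap.norm_id_le

theorem wnorm_neg_le (hD : MeasurableSet D) {f : SpaceTime → F} (hf : Smooth f)
    (a n : ℕ) : wnorm D a n (-f) t ≤ wnorm D a n f t := by
  simpa using wnorm_const_smul_le (t := t) hD hf (-1) a n

theorem wnorm_sub_le (hD : MeasurableSet D) {f g : SpaceTime → F} (hf : Smooth f) (hg : Smooth g)
    (a n : ℕ) : wnorm D a n (f - g) t ≤ wnorm D a n f t + wnorm D a n g t := by
  rw [sub_eq_add_neg]
  refine (wnorm_add_le hf hg.neg a n).trans ?_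
  gcongr
  exact wnorm_neg_le hD hg a n

theorem wnorm_zero_fun (hD : MeasurableSet D) (a n : ℕ) :
    wnorm D a n (0 : SpaceTime → F) t = 0 := by
  have := wnorm_const_smul_le (t := t) hD (f := (0 : SpaceTime → F)) contDiff_const 0 a n
  simpa using this

theorem wnorm_sum_le (hD : MeasurableSet D) {ι : Type*} {s : Finset ι} {f : ι → SpaceTime → F}
    (hf : ∀ i ∈ s, Smooth (f i)) (a n : ℕ) :
    wnorm D a n (∑ i ∈ s, f i) t ≤ ∑ i ∈ s, wnorm D a n (f i) t := by
  classical
  induction s using Finset.induction_on with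
  | empty => simp [wnorm_zero_fun hD]
  | insert i s hi ih =>
    rw [Finset.sum_insert hi, Finset.sum_insert hi]
    refine (wnorm_add_le (hf i (by simp)) (Smooth.sum fun j hj => hf j (by simp [hj])) a n).trans ?_
    gcongr
    exact ih fun j hj => hf j (by simp [hj])

theorem l2Norm_coef_le {b : SpaceTime → ℝ} (hb : IsCoef b) (hD : MeasurableSet D) :
    Dom (fun _ : SpaceTime → F => True) (fun f => l2Norm D (b • f)) (fun f => l2Norm D f) := by
  obtain ⟨C, hC⟩ := hb.bounded
  refine ⟨C, fun f _ t _ => l2Norm_le_mul hD fun x _ => ?_⟩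
  rw [Pi.smul_apply', norm_smul]
  gcongr
  exact hC _

theorem wnorm_coef_le {b : SpaceTime → ℝ} (hb : IsCoef b) (hD : MeasurableSet D) (a n : ℕ) :
    Dom (fun f : SpaceTime → F => Smooth f) (fun f => wnorm D a n (b • f))
      (fun f => wnorm D a n f) := by
  -- A derivative or an `S` falling on `b` replaces it by another coefficient, so `b` must vary in
  -- the induction.
  induction n generalizing a b with
  | zero => exact Dom.of_eq_zero fun f t => by simp
  | succ n ih =>
    rcases a with _ | a
    · exact Dom.of_eq_zero fun f t => by simp
    have h1 : Dom (fun f : SpaceTime → F => Smooth f) (fun f => l2Norm D (b • f))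
        (fun f => wnorm D (a + 1) (n + 1) f) :=
      ((l2Norm_coef_le hb hD).mono fun _ _ => trivial).trans_le fun f _ t _ => l2Norm_le_wnorm a n f
    have h2 : ∀ β : Fin 4, Dom (fun f : SpaceTime → F => Smooth f)
        (fun f => wnorm D (a + 1) n (pd β (b • f))) (fun f => wnorm D (a + 1) (n + 1) f) := by
      intro β
      refine Dom.le_trans (Ψ := fun f t => wnorm D (a + 1) n (pd β b • f) t
        + wnorm D (a + 1) n (b • pd β f) t) (fun f hf t _ => ?_) (Dom.add ?_ ?_)
      · rw [pd_smul hb.smooth hf]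
        exact wnorm_add_le ((hb.pd β).smul hf) (hb.smul (hf.pd β)) _ _
      · exact (ih (hb.pd β) _).trans_le fun f _ t _ => wnorm_mono le_rfl (by omega) f
      · exact ((ih hb (a + 1)).comp (fun f => pd β f) fun f hf => hf.pd β).trans_le
          fun f _ t _ => wnorm_pd_le _ _ _ f
    have h3 : Dom (fun f : SpaceTime → F => Smooth f)
        (fun f => wnorm D a n (scal (b • f))) (fun f => wnorm D (a + 1) (n + 1) f) := by
      refine Dom.le_trans (Ψ := fun f t => wnorm D a n (radial b • f) t
        + wnorm D a n (b • scal f) t) (fun f hf t _ => ?_) (Dom.add ?_ ?_)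
      · rw [scal_smul hb hf]
        exact wnorm_add_le (hb.radial.smul hf) (hb.smul hf.scal) _ _
      · exact (ih hb.radial _).trans_le fun f _ t _ => wnorm_mono (by omega) (by omega) f
      · exact ((ih hb a).comp (fun f => scal f) fun f hf => hf.scal).trans_le
          fun f _ t _ => wnorm_scal_le _ _ f
    refine Dom.le_trans (fun f _ t _ => (wnorm_succ _ _ _).le) ?_
    exact (h1.add (Dom.sum fun β _ => h2 β)).add h3

variable {K : Set E3} {η : E3 → ℝ}

theorem wnorm_scalMod_le (hη : IsCutoff K η) (hD : MeasurableSet D) (a n : ℕ) :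
    Dom (fun f : SpaceTime → F => Smooth f) (fun f => wnorm D a n (scalMod η f))
      (fun f => wnorm D (a + 1) (n + 1) f) := by
  refine Dom.le_trans (Ψ := fun f t => wnorm D a n (scal f) t
    + ∑ l : Fin 3, wnorm D a n (defect η l • pd l.succ f) t) (fun f hf t _ => ?_)
    (Dom.add ?_ (Dom.sum fun l _ => ?_))
  · have hs : ∀ l ∈ (Finset.univ : Finset (Fin 3)), Smooth (defect η l • pd l.succ f) :=
      fun l _ => (hη.isCoef_defect l).smul (hf.pd _)
    rw [scalMod_eq]
    refine (wnorm_sub_le hD hf.scal (Smooth.sum hs) a n).trans ?_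
    gcongr
    exact wnorm_sum_le hD hs a n
  · exact Dom.of_le fun f _ t _ => wnorm_scal_le _ _ f
  · exact ((wnorm_coef_le (hη.isCoef_defect l) hD a n).comp (fun f => pd l.succ f)
      fun f hf => hf.pd _).trans_le fun f _ t _ => (wnorm_pd_le _ _ _ f).trans
        (wnorm_mono (by omega) le_rfl f)

theorem wnorm_scalMod_iterate_le (hη : IsCutoff K η) (hD : MeasurableSet D) (a n μ : ℕ) :
    Dom (fun f : SpaceTime → F => Smooth f) (fun f => wnorm D a n ((scalMod η)^[μ] f))
      (fun f => wnorm D (a + μ) (n + μ) f) := by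
  induction μ with
  | zero => exact Dom.refl
  | succ μ ih =>
    simp only [Function.iterate_succ_apply]
    exact (ih.comp (fun f => scalMod η f) fun f hf => hf.scalMod hη).trans
      (wnorm_scalMod_le hη hD _ _)

theorem wnorm_pd_iterate_le (a n j : ℕ) (β : Fin 4) (f : SpaceTime → F) :
    wnorm D a n ((pd β)^[j] f) t ≤ wnorm D a (n + j) f t := by
  induction j generalizing f with
  | zero => exact le_rfl
  | succ j ih =>
    rw [Function.iterate_succ_apply]
    exact (ih _).trans (wnorm_pd_le _ _ _ _)

theorem wnorm_scal_iterate_le (a n μ : ℕ) (f : SpaceTime → F) :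
    wnorm D a n (scal^[μ] f) t ≤ wnorm D (a + μ) (n + μ) f t := by
  induction μ generalizing f with
  | zero => exact le_rfl
  | succ j ih =>
    rw [Function.iterate_succ_apply]
    exact (ih _).trans (wnorm_scal_le _ _ _)

theorem wnorm_pdMulti_le (a n : ℕ) (α : Fin 4 → ℕ) (f : SpaceTime → F) :
    wnorm D a n (pdMulti α f) t ≤ wnorm D a (n + ∑ i, α i) f t := by
  rw [pdMulti]
  refine (wnorm_pd_iterate_le _ _ _ _ _).trans ((wnorm_pd_iterate_le _ _ _ _ _).trans
    ((wnorm_pd_iterate_le _ _ _ _ _).trans ((wnorm_pd_iterate_le _ _ _ _ _).trans ?_)))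
  rw [Fin.sum_univ_four]
  exact wnorm_mono le_rfl (by omega) f

theorem mem_fullIdx {a b : ℕ} {q : ℕ × (Fin 4 → ℕ)} :
    q ∈ fullIdx a b ↔ q.1 < a ∧ (∑ i, q.2 i) + q.1 < b := by
  simp only [fullIdx, Finset.mem_filter, Finset.mem_product, Finset.mem_range,
    Fintype.mem_piFinset]
  refine ⟨fun h => ⟨h.1.1, h.2⟩, fun h => ⟨⟨h.1, fun i => ?_⟩, h.2⟩⟩
  have := Finset.single_le_sum (f := q.2) (fun _ _ => Nat.zero_le _) (Finset.mem_univ i)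
  omega

theorem mem_timeIdx {a b : ℕ} {q : ℕ × ℕ} :
    q ∈ timeIdx a b ↔ q.1 < a ∧ q.2 + q.1 < b := by
  simp only [timeIdx, Finset.mem_filter, Finset.mem_product, Finset.mem_range]
  omega

/-- The sum over `fullIdx` of the `L²` norms of `S^μ ∂^α f`. -/
def fnorm (D : Set E3) (a n : ℕ) (f : SpaceTime → F) (t : ℝ) : ℝ≥0∞ :=
  ∑ q ∈ fullIdx a n, l2Norm D (scal^[q.1] (pdMulti q.2 f)) t

/-- Together with `wnorm_le_fnorm` this makes the two norms interchangeable. The recursive `wnorm`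
suits inductions, since an operator can be peeled off on the inside without reordering; `fnorm` is
the ordered sum of the final estimate. -/
theorem fnorm_le_wnorm (a n : ℕ) :
    Dom (fun _ : SpaceTime → F => True) (fun f => fnorm D a n f) (fun f => wnorm D a n f) := by
  unfold fnorm
  refine Dom.sum fun q hq => Dom.of_le fun f _ t _ => ?_
  rw [mem_fullIdx] at hq
  rw [← wnorm_one_one]
  refine (wnorm_scal_iterate_le _ _ _ _).trans ((wnorm_pdMulti_le _ _ _ _).trans ?_)
  exact wnorm_mono (by omega) (by omega) f

theorem pdMulti_smooth {f : SpaceTime → F} (hf : Smooth f) (α : Fin 4 → ℕ) :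
    Smooth (pdMulti α f) :=
  pd_iterate_smooth (pd_iterate_smooth (pd_iterate_smooth (pd_iterate_smooth hf _ _) _ _) _ _) _ _

theorem pd_iterate_comm {f : SpaceTime → F} (hf : Smooth f) (α β : Fin 4) (n : ℕ) :
    (pd α)^[n] (pd β f) = pd β ((pd α)^[n] f) := by
  induction n with
  | zero => rfl
  | succ n ih =>
    rw [Function.iterate_succ_apply', Function.iterate_succ_apply', ih,
      pd_comm (pd_iterate_smooth hf _ _)]

theorem pdMulti_pd {f : SpaceTime → F} (hf : Smooth f) (α : Fin 4 → ℕ) (β : Fin 4) :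
    pdMulti α (pd β f) = pdMulti (α + Pi.single β 1) f := by
  have h1 := fun n => pd_iterate_smooth hf 3 n
  have h2 := fun n m => pd_iterate_smooth (h1 n) 2 m
  have h3 := fun n m k => pd_iterate_smooth (h2 n m) 1 k
  simp only [pdMulti]
  fin_cases β
  · simp only [Fin.zero_eta, Pi.add_apply, Pi.single_apply]
    simp [pd_iterate_comm hf, pd_iterate_comm (h1 _), pd_iterate_comm (h2 _ _),
      Function.iterate_succ_apply]
  · simp only [Fin.mk_one, Pi.add_apply, Pi.single_apply]
    simp [pd_iterate_comm hf, pd_iterate_comm (h1 _), Function.iterate_succ_apply]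
  · simp only [Fin.reduceFinMk, Pi.add_apply, Pi.single_apply]
    simp [pd_iterate_comm hf, Function.iterate_succ_apply]
  · simp only [Fin.reduceFinMk, Pi.add_apply, Pi.single_apply]
    simp [Function.iterate_succ_apply]

theorem pd_iterate_scal {f : SpaceTime → F} (hf : Smooth f) (β : Fin 4) (n : ℕ) :
    (pd β)^[n] (scal f) = scal ((pd β)^[n] f) + (n : ℝ) • (pd β)^[n] f := by
  induction n with
  | zero => simp
  | succ n ih =>
    have h := pd_iterate_smooth hf β n
    rw [Function.iterate_succ_apply', Function.iterate_succ_apply', ih,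
      pd_add h.scal (h.csmul _), pd_scal h, pd_const_smul h]
    push_cast
    module

theorem pd_iterate_add {f g : SpaceTime → F} (hf : Smooth f) (hg : Smooth g) (β : Fin 4) (n : ℕ) :
    (pd β)^[n] (f + g) = (pd β)^[n] f + (pd β)^[n] g := by
  induction n with
  | zero => rfl
  | succ n ih =>
    simp only [Function.iterate_succ_apply', ih]
    rw [pd_add (pd_iterate_smooth hf _ _) (pd_iterate_smooth hg _ _)]

theorem pd_iterate_const_smul {f : SpaceTime → F} (hf : Smooth f) (c : ℝ) (β : Fin 4) (n : ℕ) :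
    (pd β)^[n] (c • f) = c • (pd β)^[n] f := by
  induction n with
  | zero => rfl
  | succ n ih =>
    simp only [Function.iterate_succ_apply', ih]
    rw [pd_const_smul (pd_iterate_smooth hf _ _)]

/-- Each of the `|α|` derivatives contributes one copy of the identity when it passes `S`. -/
theorem pdMulti_scal {f : SpaceTime → F} (hf : Smooth f) (α : Fin 4 → ℕ) :
    pdMulti α (scal f) = scal (pdMulti α f) + ((∑ i, α i : ℕ) : ℝ) • pdMulti α f := by
  have h0 := pd_iterate_smooth hf 3 (α 3)
  have h1 := pd_iterate_smooth h0 2 (α 2)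
  have h2 := pd_iterate_smooth h1 1 (α 1)
  simp only [pdMulti]
  rw [pd_iterate_scal hf, pd_iterate_add h0.scal (h0.csmul _), pd_iterate_scal h0,
    pd_iterate_const_smul h0, pd_iterate_add (h1.scal.plus (h1.csmul _)) (h1.csmul _),
    pd_iterate_add h1.scal (h1.csmul _), pd_iterate_scal h1,
    pd_iterate_const_smul h1, pd_iterate_const_smul h1,
    pd_iterate_add ((h2.scal.plus (h2.csmul _)).plus (h2.csmul _)) (h2.csmul _),
    pd_iterate_add (h2.scal.plus (h2.csmul _)) (h2.csmul _),
    pd_iterate_add h2.scal (h2.csmul _), pd_iterate_scal h2,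
    pd_iterate_const_smul h2, pd_iterate_const_smul h2, pd_iterate_const_smul h2,
    Fin.sum_univ_four]
  push_cast
  module

theorem scal_iterate_add {f g : SpaceTime → F} (hf : Smooth f) (hg : Smooth g) (n : ℕ) :
    scal^[n] (f + g) = scal^[n] f + scal^[n] g := by
  induction n with
  | zero => rfl
  | succ n ih =>
    simp only [Function.iterate_succ_apply', ih]
    rw [scal_add (scal_iterate_smooth hf _) (scal_iterate_smooth hg _)]

theorem scal_iterate_const_smul {f : SpaceTime → F} (hf : Smooth f) (c : ℝ) (n : ℕ) :
    scal^[n] (c • f) = c • scal^[n] f := by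
  induction n with
  | zero => rfl
  | succ n ih =>
    simp only [Function.iterate_succ_apply', ih]
    rw [scal_const_smul (scal_iterate_smooth hf _)]

theorem l2Norm_const_smul_le (hD : MeasurableSet D) (f : SpaceTime → F) (c : ℝ) :
    l2Norm D (c • f) t ≤ ‖c‖₊ * l2Norm D f t :=
  l2Norm_le_mul hD fun x _ => by simp [norm_smul]

theorem l2Norm_le_fnorm {a n : ℕ} {q : ℕ × (Fin 4 → ℕ)} (hq : q ∈ fullIdx a n)
    (f : SpaceTime → F) : l2Norm D (scal^[q.1] (pdMulti q.2 f)) t ≤ fnorm D a n f t := by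
  have h := single_le_sum_ennreal (g := fun q => l2Norm D (scal^[q.1] (pdMulti q.2 f)) t) hq
  beta_reduce at h
  rw [fnorm]
  generalize fullIdx a n = s at h
  exact h

/-- An arbitrary word is brought to the order `S^μ ∂^α` by moving its innermost letter: a derivative
slides freely into the multi-index, and an `S` passes `∂^α` at the cost of a multiple of `∂^α` with
one `S` less. -/
theorem wnorm_le_fnorm (hD : MeasurableSet D) (a n : ℕ) :
    Dom (fun f : SpaceTime → F => Smooth f) (fun f => wnorm D a n f) (fun f => fnorm D a n f) := by
  induction n generalizing a with
  | zero => exact Dom.of_eq_zero fun f t => by simp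
  | succ n ih =>
    rcases a with _ | a
    · exact Dom.of_eq_zero fun f t => by simp
    refine Dom.le_trans (fun f _ t _ => (wnorm_succ _ _ _).le) ?_
    refine (Dom.add (Dom.of_le fun f _ t _ => ?_) (Dom.sum fun β _ => ?_)).add ?_
    · exact l2Norm_le_fnorm (q := (0, 0)) (by simp [mem_fullIdx]) f
    · refine ((ih (a + 1)).comp (fun f => pd β f) fun f hf => hf.pd β).trans ?_
      unfold fnorm
      refine Dom.sum fun q hq => Dom.of_le fun f hf t _ => ?_
      rw [mem_fullIdx] at hq
      rw [pdMulti_pd hf]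
      refine l2Norm_le_fnorm (q := (q.1, q.2 + Pi.single β 1)) ?_ f
      rw [mem_fullIdx]
      simp only [Pi.add_apply, Finset.sum_add_distrib, Finset.sum_pi_single', Finset.mem_univ,
        if_true]
      omega
    · refine ((ih a).comp (fun f => scal f) fun f hf => hf.scal).trans ?_
      unfold fnorm
      refine Dom.sum fun q hq => ?_
      rw [mem_fullIdx] at hq
      refine Dom.le_trans (Ψ := fun f t => l2Norm D (scal^[q.1 + 1] (pdMulti q.2 f)) t
        + ‖((∑ i, q.2 i : ℕ) : ℝ)‖₊ * l2Norm D (scal^[q.1] (pdMulti q.2 f)) t)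
        (fun f hf t _ => ?_) (Dom.add (Dom.of_le fun f _ t _ => ?_)
          (Dom.const_mul _ (Dom.of_le fun f _ t _ => ?_)))
      · have h := pdMulti_smooth hf q.2
        rw [pdMulti_scal hf, scal_iterate_add h.scal (h.csmul _),
          ← Function.iterate_succ_apply, scal_iterate_const_smul h]
        refine (l2Norm_add_le (scal_iterate_smooth h _)
          ((scal_iterate_smooth h _).csmul _)).trans ?_
        gcongr
        exact l2Norm_const_smul_le hD _ _
      · exact l2Norm_le_fnorm (q := (q.1 + 1, q.2)) (by rw [mem_fullIdx]; simp only; omega) f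
      · exact l2Norm_le_fnorm (q := q) (by rw [mem_fullIdx]; omega) f

end L2

end

end ExteriorElastic

namespace ExteriorElastic

noncomputable section

/-! ### The boundary of the obstacle and integration by parts -/

/-- Choose `v` with `dφ(v) > 0` at `x`, hence on a ball. By the mean value theorem two points of the
level set inside the ball cannot differ by a nonzero multiple of `v`, so the translates of this
piece by `v/(n+1)` are pairwise disjoint. Infinitely many disjoint translates by bounded vectors
force measure zero. -/
theorem exists_nhds_null_level_set {φ : E3 → ℝ} (hφ : ContDiff ℝ ∞ φ) {x : E3}
    (hx : fderiv ℝ φ x ≠ 0) : ∃ U ∈ 𝓝 x, MeasureTheory.volume (U ∩ {y | φ y = 0}) = 0 := by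
  obtain ⟨v, hv⟩ : ∃ v, 0 < fderiv ℝ φ x v := by
    by_contra! h
    refine hx (ContinuousLinearMap.ext fun v => ?_)
    have h1 := h v
    have h2 := h (-v)
    rw [map_neg] at h2
    simp only [zero_apply]
    linarith
  have hc : Continuous fun y => fderiv ℝ φ y v :=
    (hφ.continuous_fderiv (by simp)).clm_apply continuous_const
  obtain ⟨r, hr, hball⟩ := Metric.mem_nhds_iff.1 ((isOpen_Ioi.preimage hc).mem_nhds hv)
  refine ⟨Metric.ball x r, Metric.ball_mem_nhds x hr, ?_⟩
  refine MeasureTheory.Measure.addHaar_eq_zero_of_disjoint_translates _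
    (fun n : ℕ => (1 / ((n : ℝ) + 1)) • v) ?_ ?_ ?_
  · refine isBounded_iff_forall_norm_le.2 ⟨‖v‖, ?_⟩
    rintro _ ⟨n, rfl⟩
    rw [norm_smul, Real.norm_of_nonneg (by positivity)]
    refine mul_le_of_le_one_left (norm_nonneg v) ?_
    rw [div_le_one (by positivity)]
    linarith [Nat.cast_nonneg (α := ℝ) n]
  · intro n m hnm
    simp only [Function.onFun, Set.singleton_add, Set.image_add_left]
    rw [Set.disjoint_left]
    intro w hw hw'
    simp only [Set.mem_preimage] at hw hw'
    obtain ⟨hy, hy0⟩ := hw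
    obtain ⟨hz, hz0⟩ := hw'
    set y := -((1 / ((n : ℝ) + 1)) • v) + w with hydef
    set z := -((1 / ((m : ℝ) + 1)) • v) + w with hzdef
    obtain ⟨c, hc, hmv⟩ := domain_mvt (f := φ) (s := Metric.ball x r) (x := y) (y := z)
      (f' := fderiv ℝ φ) (fun p _ => ((hφ.differentiable (by simp)) p).hasFDerivAt.hasFDerivWithinAt)
      (convex_ball x r) hy hz
    have hcb : c ∈ Metric.ball x r := (convex_ball x r).segment_subset hy hz hc
    have hzy : z - y = (1 / ((n : ℝ) + 1) - 1 / ((m : ℝ) + 1)) • v := by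
      rw [hydef, hzdef]; module
    simp only [Set.mem_ofPred_eq] at hy0 hz0
    rw [hy0, hz0, hzy, map_smul, sub_zero, smul_eq_mul, eq_comm, mul_eq_zero] at hmv
    rcases hmv with h | h
    · apply hnm
      have h1 : (0 : ℝ) < n + 1 := by positivity
      have h2 : (0 : ℝ) < m + 1 := by positivity
      field_simp at h
      have : (n : ℝ) = m := by linarith
      exact_mod_cast this
    · exact absurd (hball hcb) (by simp [h])
  · exact Metric.isOpen_ball.measurableSet.inter
      (isClosed_eq hφ.continuous continuous_const).measurableSet

section Obstacle

variable {K : Set E3} (hK : IsSmoothObstacle K)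
include hK

theorem IsSmoothObstacle.isClosed : IsClosed K := hK.isCompact.isClosed

theorem IsSmoothObstacle.isOpen_compl : IsOpen Kᶜ := hK.isClosed.isOpen_compl

theorem IsSmoothObstacle.measurableSet_compl : MeasurableSet Kᶜ := hK.isOpen_compl.measurableSet

theorem IsSmoothObstacle.frontier_subset : frontier K ⊆ K := hK.isClosed.frontier_subset

/-- Near a boundary point, the boundary is the zero set of the defining function. -/
theorem IsSmoothObstacle.exists_defining {x : E3} (hx : x ∈ frontier K) :
    ∃ φ : E3 → ℝ, ContDiff ℝ ∞ φ ∧ fderiv ℝ φ x ≠ 0 ∧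
      ∀ᶠ y in 𝓝 x, fderiv ℝ φ y ≠ 0 ∧ (y ∈ frontier K ↔ φ y = 0) := by
  obtain ⟨φ, hφ, hd, hiff⟩ := hK.smooth_boundary x hx
  refine ⟨φ, hφ, hd, ?_⟩
  have hc : Continuous (fderiv ℝ φ) := hφ.continuous_fderiv (by simp)
  have hd' : ∀ᶠ y in 𝓝 x, fderiv ℝ φ y ≠ 0 := hc.continuousAt.eventually_ne hd
  filter_upwards [hd', hiff.eventually_nhds] with y hy hiff'
  refine ⟨hy, fun hyf => ?_, fun h0 => ?_⟩
  · by_contra h0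
    -- Where `φ < 0` the point is interior to `K`; where `φ > 0` it is not in `K`.
    rcases lt_or_gt_of_ne h0 with h | h
    · have : y ∈ interior K := by
        rw [mem_interior_iff_mem_nhds]
        filter_upwards [hiff', (isOpen_Iio.preimage hφ.continuous).mem_nhds h] with z hz hz'
        exact hz.2 (le_of_lt hz')
      exact hyf.2 this
    · have h1 : y ∈ K := hK.frontier_subset hyf
      exact absurd (hiff'.self_of_nhds.1 h1) (not_le.2 h)
  -- An interior point of `K` with `φ = 0` would be a local maximum of `φ`, contradicting `dφ ≠ 0`.
  · refine ⟨subset_closure (hiff'.self_of_nhds.2 h0.le), fun hint => hy ?_⟩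
    have : IsLocalMax φ y := by
      filter_upwards [hiff', mem_interior_iff_mem_nhds.1 hint] with z hz hz'
      rw [h0]; exact hz.1 hz'
    exact this.fderiv_eq_zero

theorem IsSmoothObstacle.volume_frontier : MeasureTheory.volume (frontier K) = 0 := by
  refine MeasureTheory.measure_null_of_locally_null _ fun x hx => ?_
  obtain ⟨φ, hφ, hd, hev⟩ := hK.exists_defining hx
  obtain ⟨U, hU, h0⟩ := exists_nhds_null_level_set hφ hd
  refine ⟨frontier K ∩ (U ∩ {y | y ∈ frontier K ↔ φ y = 0}), ?_, ?_⟩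
  · refine inter_mem_nhdsWithin _ (Filter.inter_mem hU ?_)
    filter_upwards [hev] with y hy using hy.2
  · refine MeasureTheory.measure_mono_null ?_ h0
    rintro y ⟨h1, h2, h3⟩
    exact ⟨h2, h3.1 h1⟩

omit hK in
theorem pd_succ_eq_fderiv {F : Type*} [NormedAddCommGroup F] [NormedSpace ℝ F]
    {f : SpaceTime → F} (hf : Smooth f) (k : Fin 3) (t : ℝ) (x : E3) :
    pd k.succ f (t, x) = fderiv ℝ (fun y => f (t, y)) x (EuclideanSpace.single k 1) := by
  have h1 : HasFDerivAt (fun y : E3 => ((t, y) : SpaceTime)) (ContinuousLinearMap.inr ℝ ℝ E3) x :=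
    hasFDerivAt_prodMk_right t x
  have h2 := ((hf.diff (t, x)).hasFDerivAt).comp x h1
  have h3 : (fun y => f (t, y)) = f ∘ fun y : E3 => ((t, y) : SpaceTime) := rfl
  rw [h3, h2.fderiv]
  simp [pd, dir]

/-- A segment leaving the exterior region crosses its boundary, where `g = 0`. The mean value bound
between the starting point and the crossing point controls the jump of the zero extension, with no
regularity of the boundary needed. -/
theorem lipschitz_indicator {g : E3 → ℝ} (hg : ContDiff ℝ ∞ g) (hb : ∀ x ∈ frontier K, g x = 0)
    {R : ℝ} (hR : ∀ x ∈ Kᶜ, R < ‖x‖ → g x = 0) :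
    ∃ L : ℝ≥0, LipschitzWith L (Kᶜ.indicator g) := by
  -- Cutting at radius `R + 1` does not change the zero extension, makes the derivative of `g`
  -- bounded, and adds only boundary points at which `g` already vanishes.
  set O : Set E3 := Kᶜ ∩ Metric.ball 0 (R + 1) with hO
  have hOo : IsOpen O := hK.isOpen_compl.inter Metric.isOpen_ball
  have hfr : ∀ z ∈ frontier O, g z = 0 := by
    intro z hz
    rw [hOo.frontier_eq] at hz
    by_cases hzK : z ∈ K
    · refine hb z ?_
      rw [hK.isClosed.frontier_eq]
      refine ⟨hzK, fun hint => ?_⟩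
      have : z ∈ closure Kᶜ := closure_mono Set.inter_subset_left hz.1
      rw [closure_compl] at this
      exact this hint
    · refine hR z hzK ?_
      by_contra! hlt
      exact hz.2 ⟨hzK, by simp; linarith⟩
  have hind : Kᶜ.indicator g = O.indicator g := by
    funext x
    by_cases hx : x ∈ Kᶜ
    · by_cases hx' : x ∈ O
      · simp only [Set.indicator_of_mem hx, Set.indicator_of_mem hx']
      · rw [Set.indicator_of_mem hx, Set.indicator_of_notMem hx']
        refine hR x hx ?_
        by_contra! hlt
        exact hx' ⟨hx, by simp; linarith⟩
    · rw [Set.indicator_of_notMem hx, Set.indicator_of_notMem fun h => hx h.1]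
  obtain ⟨L, hL⟩ := (isCompact_closedBall (0 : E3) (R + 1)).exists_bound_of_continuousOn
    (hg.continuous_fderiv (by simp)).continuousOn
  have hmv : ∀ x ∈ Metric.closedBall (0 : E3) (R + 1), ∀ y ∈ Metric.closedBall (0 : E3) (R + 1),
      ‖g y - g x‖ ≤ L.toNNReal * ‖y - x‖ := fun x hx y hy =>
    (convex_closedBall (0 : E3) (R + 1)).norm_image_sub_le_of_norm_fderiv_le
      (fun z _ => (hg.differentiable (by simp)) z)
      (fun z hz => (hL z hz).trans (Real.le_coe_toNNReal L)) hx hy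
  have key : ∀ x ∈ O, ∀ y ∉ O, ‖g x‖ ≤ L.toNNReal * ‖x - y‖ := by
    intro x hx y hy
    -- Otherwise `O` and the complement of its closure would disconnect the segment.
    obtain ⟨z, hz, hzf⟩ : ∃ z ∈ segment ℝ x y, z ∈ frontier O := by
      by_contra! hno
      have hsub : segment ℝ x y ⊆ O ∪ (closure O)ᶜ := by
        intro z hz
        by_cases hzO : z ∈ O
        · exact Or.inl hzO
        · refine Or.inr fun hzc => hno z hz ?_
          rw [hOo.frontier_eq]; exact ⟨hzc, hzO⟩
      obtain ⟨z, -, hz1, hz2⟩ := (convex_segment x y).isPreconnected O (closure O)ᶜ hOo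
        isClosed_closure.isOpen_compl hsub ⟨x, left_mem_segment ℝ x y, hx⟩
        ⟨y, right_mem_segment ℝ x y, (hsub (right_mem_segment ℝ x y)).resolve_left hy⟩
      exact hz2 (subset_closure hz1)
    have hzc : z ∈ Metric.closedBall (0 : E3) (R + 1) :=
      (closure_mono Set.inter_subset_right |>.trans Metric.closure_ball_subset_closedBall)
        (frontier_subset_closure hzf)
    have h1 := hmv z hzc x (Metric.ball_subset_closedBall hx.2)
    rw [hfr z hzf, sub_zero] at h1
    refine h1.trans ?_
    gcongr
    obtain ⟨s, hs, rfl⟩ := (segment_eq_image ℝ x y ▸ hz : z ∈ _)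
    have : x - ((1 - s) • x + s • y) = s • (x - y) := by module
    beta_reduce
    rw [this, norm_smul, Real.norm_of_nonneg hs.1]
    exact mul_le_of_le_one_left (norm_nonneg _) hs.2
  refine ⟨L.toNNReal, LipschitzWith.of_dist_le_mul fun x y => ?_⟩
  rw [hind, dist_eq_norm, dist_eq_norm]
  by_cases hx : x ∈ O <;> by_cases hy : y ∈ O
  · rw [Set.indicator_of_mem hx, Set.indicator_of_mem hy]
    exact hmv y (Metric.ball_subset_closedBall hy.2) x (Metric.ball_subset_closedBall hx.2)
  · rw [Set.indicator_of_mem hx, Set.indicator_of_notMem hy, sub_zero]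
    exact key x hx y hy
  · rw [Set.indicator_of_notMem hx, Set.indicator_of_mem hy, zero_sub, norm_neg, norm_sub_rev]
    exact key y hy x hx
  · rw [Set.indicator_of_notMem hx, Set.indicator_of_notMem hy]
    simp; positivity

/-- The zero extension `G` of `g` is Lipschitz, so it can be integrated by parts against a bump `χ`
that equals `1` wherever `G ≠ 0`. The right side vanishes because `∂χ` and `G` are never both
nonzero. On the left, the derivative of `G` is `∂g` outside `K` and `0` inside, and the frontier is
a null set. -/
theorem integral_fderiv_compl_eq_zero {g : E3 → ℝ} (hg : ContDiff ℝ ∞ g)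
    (hb : ∀ x ∈ frontier K, g x = 0) {R : ℝ} (hR : ∀ x ∈ Kᶜ, R < ‖x‖ → g x = 0) (v : E3) :
    ∫ x in Kᶜ, fderiv ℝ g x v = 0 := by
  obtain ⟨L, hL⟩ := lipschitz_indicator hK hg hb hR
  set G := Kᶜ.indicator g with hG
  -- `G` vanishes from radius `max R 1 + 1` on, and `χ = 1` up to that radius; the maximum keeps the
  -- radii positive.
  let χ : ContDiffBump (0 : E3) := ⟨max R 1 + 1, max R 1 + 2, by positivity, by linarith⟩
  have hχs : ContDiff ℝ 1 χ := χ.contDiff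
  obtain ⟨M, hM⟩ := hχs.lipschitzWith_of_hasCompactSupport χ.hasCompactSupport (by simp)
  have hibp := LipschitzWith.integral_lineDeriv_mul_eq (μ := MeasureTheory.volume) hL hM
    χ.hasCompactSupport v
  have hχ1 : ∀ x : E3, ‖x‖ < max R 1 + 1 → (χ : E3 → ℝ) =ᶠ[𝓝 x] fun _ => 1 := fun x hx =>
    χ.eventuallyEq_one_of_mem_ball (by simpa using hx)
  have hR' : ∀ x ∈ Kᶜ, max R 1 + 1 ≤ ‖x‖ → g =ᶠ[𝓝 x] fun _ => 0 := by
    intro x hx hxn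
    have ho : IsOpen (Kᶜ ∩ {y : E3 | R < ‖y‖}) :=
      hK.isOpen_compl.inter (isOpen_lt continuous_const continuous_norm)
    filter_upwards [ho.mem_nhds ⟨hx, by
      have := le_max_left R 1
      simp only [Set.mem_ofPred_eq]; linarith⟩] with y hy
    exact hR y hy.1 hy.2
  have hrhs : ∀ x, lineDeriv ℝ χ x (-v) * G x = 0 := by
    intro x
    by_cases hxn : ‖x‖ < max R 1 + 1
    · have : lineDeriv ℝ χ x (-v) = 0 := by
        rw [Filter.EventuallyEq.lineDeriv_eq (hχ1 x hxn)]
        simp [lineDeriv]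
      rw [this, zero_mul]
    · have : G x = 0 := by
        by_cases hx : x ∈ Kᶜ
        · rw [hG, Set.indicator_of_mem hx]
          exact (hR' x hx (not_lt.1 hxn)).self_of_nhds
        · rw [hG, Set.indicator_of_notMem hx]
      rw [this, mul_zero]
  simp only [hrhs, MeasureTheory.integral_zero] at hibp
  rw [← MeasureTheory.integral_indicator hK.measurableSet_compl, ← hibp]
  refine MeasureTheory.integral_congr_ae ?_
  have hae : ∀ᵐ x : E3, x ∉ frontier K :=
    MeasureTheory.measure_eq_zero_iff_ae_notMem.1 hK.volume_frontier
  filter_upwards [hae] with x hx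
  by_cases hxK : x ∈ Kᶜ
  · have h1 : G =ᶠ[𝓝 x] g := by
      filter_upwards [hK.isOpen_compl.mem_nhds hxK] with y hy
      rw [hG, Set.indicator_of_mem hy]
    rw [Set.indicator_of_mem hxK, Filter.EventuallyEq.lineDeriv_eq h1,
      ((hg.differentiable (by simp)) x).lineDeriv_eq_fderiv]
    by_cases hxn : ‖x‖ < max R 1 + 1
    · rw [(hχ1 x hxn).self_of_nhds, mul_one]
    · rw [(hR' x hxK (not_lt.1 hxn)).fderiv_eq]; simp
  · have hint : x ∈ interior K := by
      by_contra h
      exact hx (by rw [hK.isClosed.frontier_eq]; exact ⟨by simpa using hxK, h⟩)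
    have h1 : G =ᶠ[𝓝 x] fun _ => 0 := by
      filter_upwards [mem_interior_iff_mem_nhds.1 hint] with y hy
      rw [hG, Set.indicator_of_notMem (by simpa using hy)]
    rw [Set.indicator_of_notMem hxK, Filter.EventuallyEq.lineDeriv_eq h1]
    simp [lineDeriv]

theorem integral_pd_succ_eq_zero {h : SpaceTime → ℝ} (hh : Smooth h) {t : ℝ}
    (hb : ∀ x ∈ frontier K, h (t, x) = 0) {R : ℝ} (hR : ∀ x ∈ Kᶜ, R < ‖x‖ → h (t, x) = 0)
    (k : Fin 3) : ∫ x in Kᶜ, pd k.succ h (t, x) = 0 := by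
  simp only [pd_succ_eq_fderiv hh]
  exact integral_fderiv_compl_eq_zero hK (hh.comp (by fun_prop)) hb hR _

end Obstacle

end

end ExteriorElastic

namespace ExteriorElastic

noncomputable section

/-! ### Functions with bounded support in space, and their `L²` pairings -/

section Tame

variable {F : Type*} [NormedAddCommGroup F] [NormedSpace ℝ F]
variable {G : Type*} [NormedAddCommGroup G] [NormedSpace ℝ G]
variable {K : Set E3} {t : ℝ}

/-- Smooth functions vanishing for large `|x|` on every time strip. -/
structure Tame (K : Set E3) (f : SpaceTime → F) : Prop where
  smooth : Smooth f
  supp : ∀ T : ℝ, 0 ≤ T → ∃ R : ℝ, ∀ t ∈ Set.Icc 0 T, ∀ x ∈ Kᶜ, R < ‖x‖ → f (t, x) = 0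

/-- Smooth functions vanishing for large `|x|` on every time strip and on the boundary of `K`. -/
structure Adm (K : Set E3) (f : SpaceTime → F) : Prop extends Tame K f where
  bdry : ∀ t : ℝ, 0 ≤ t → ∀ x ∈ frontier K, f (t, x) = 0

theorem Tame.of_zero {f : SpaceTime → F} {g : SpaceTime → G} (hf : Tame K f) (hg : Smooth g)
    (h : ∀ p, f p = 0 → g p = 0) : Tame K g := by
  refine ⟨hg, fun T hT => ?_⟩
  obtain ⟨R, hR⟩ := hf.supp T hT
  exact ⟨R, fun t ht x hx hxR => h _ (hR t ht x hx hxR)⟩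

theorem Tame.add {f g : SpaceTime → F} (hf : Tame K f) (hg : Tame K g) : Tame K (f + g) := by
  refine ⟨hf.smooth.add hg.smooth, fun T hT => ?_⟩
  obtain ⟨R, hR⟩ := hf.supp T hT
  obtain ⟨R', hR'⟩ := hg.supp T hT
  exact ⟨max R R', fun t ht x hx hxR => by
    simp [hR t ht x hx (lt_of_le_of_lt (le_max_left _ _) hxR),
      hR' t ht x hx (lt_of_le_of_lt (le_max_right _ _) hxR)]⟩

theorem Tame.clm {f : SpaceTime → F} (hf : Tame K f) (L : F →L[ℝ] G) :
    Tame K (fun p => L (f p)) := hf.of_zero (hf.smooth.clm L) fun p hp => by simp [hp]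

theorem Tame.csmul {f : SpaceTime → F} (hf : Tame K f) (c : ℝ) : Tame K (c • f) :=
  hf.of_zero (hf.smooth.csmul c) fun p hp => by simp [hp]

theorem Tame.sub {f g : SpaceTime → F} (hf : Tame K f) (hg : Tame K g) : Tame K (f - g) := by
  have := hf.add (hg.csmul (-1))
  simpa [sub_eq_add_neg] using this

theorem tame_zero : Tame K (0 : SpaceTime → F) :=
  ⟨contDiff_const, fun _ _ => ⟨0, fun _ _ _ _ _ => rfl⟩⟩

theorem Tame.sum {ι : Type*} {s : Finset ι} {f : ι → SpaceTime → F}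
    (hf : ∀ i ∈ s, Tame K (f i)) : Tame K (∑ i ∈ s, f i) := by
  classical
  induction s using Finset.induction_on with
  | empty => simpa using tame_zero
  | insert i s hi ih =>
    rw [Finset.sum_insert hi]
    exact (hf i (by simp)).add (ih fun j hj => hf j (by simp [hj]))

theorem Tame.smul {b : SpaceTime → ℝ} {f : SpaceTime → F} (hf : Tame K f) (hb : Smooth b) :
    Tame K (b • f) :=
  hf.of_zero (ContDiff.smul hb hf.smooth) fun p hp => by simp [hp]

/-- At the end points of the time interval vanishing is known on one side only; uniqueness of
derivatives within a nondegenerate interval still identifies the two-sided derivative of the smooth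
function. -/
theorem pd_zero_eq_zero {f : SpaceTime → F} (hf : Smooth f) {T : ℝ} {x : E3}
    (h : ∀ s ∈ Set.Icc 0 T, f (s, x) = 0) {s : ℝ} (hs : s ∈ Set.Icc 0 T) (hT : 0 < T) :
    pd 0 f (s, x) = 0 := by
  have h1 : HasDerivAt (fun r : ℝ => f (r, x)) (pd 0 f (s, x)) s := by
    have h3 : HasDerivAt (fun r : ℝ => (r, x)) ((1 : ℝ), (0 : E3)) s :=
      (hasDerivAt_id s).prodMk (hasDerivAt_const _ _)
    exact (hf.diff (s, x)).hasFDerivAt.comp_hasDerivAt s h3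
  have h2 : HasDerivWithinAt (fun r : ℝ => f (r, x)) 0 (Set.Icc 0 T) s :=
    (hasDerivWithinAt_const s _ (0 : F)).congr (fun r hr => h r hr) (h s hs)
  exact (uniqueDiffOn_Icc hT s hs).eq_deriv _ h1.hasDerivWithinAt h2

theorem fderiv_spatial_eq_zero {f : SpaceTime → F} (hf : Smooth f) {s : ℝ} {x : E3}
    (h : ∀ᶠ y in 𝓝 x, f (s, y) = 0) (k : Fin 3) : pd k.succ f (s, x) = 0 := by
  rw [pd_succ_eq_fderiv hf]
  have : (fun y => f (s, y)) =ᶠ[𝓝 x] fun _ => 0 := h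
  rw [this.fderiv_eq]; simp

theorem Tame.pd (hK : IsSmoothObstacle K) {f : SpaceTime → F} (hf : Tame K f) (β : Fin 4) :
    Tame K (pd β f) := by
  refine ⟨hf.smooth.pd β, fun T hT => ?_⟩
  -- The longer strip guarantees an interval of positive length even when `T = 0`.
  obtain ⟨R, hR⟩ := hf.supp (T + 1) (by linarith)
  refine ⟨R, fun t ht x hx hxR => ?_⟩
  have hT1 : Set.Icc 0 T ⊆ Set.Icc 0 (T + 1) := Set.Icc_subset_Icc_right (by linarith)
  refine Fin.cases ?_ (fun k => ?_) β
  · exact pd_zero_eq_zero hf.smooth (fun s hs => hR s hs x hx hxR) (hT1 ht) (by linarith)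
  · refine fderiv_spatial_eq_zero hf.smooth ?_ k
    have ho : IsOpen (Kᶜ ∩ {y : E3 | R < ‖y‖}) :=
      hK.isOpen_compl.inter (isOpen_lt continuous_const continuous_norm)
    filter_upwards [ho.mem_nhds ⟨hx, hxR⟩] with y hy
    exact hR t (hT1 ht) y hy.1 hy.2

theorem Tame.scalMod (hK : IsSmoothObstacle K) {η : E3 → ℝ} (hη : IsCutoff K η)
    {f : SpaceTime → F} (hf : Tame K f) : Tame K (scalMod η f) := by
  have h0 := hf.pd hK 0
  have h : ExteriorElastic.scalMod η f = (fun p : SpaceTime => p.1) • ExteriorElastic.pd 0 f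
      + ∑ k : Fin 3, (fun p : SpaceTime => η p.2 * p.2 k) • ExteriorElastic.pd k.succ f - f := by
    funext p
    simp only [ExteriorElastic.scalMod, fderiv_spatial, Pi.add_apply, Pi.sub_apply,
      Pi.smul_apply', Finset.sum_apply, Finset.smul_sum, smul_smul]
  rw [h]
  refine ((h0.smul contDiff_fst).add (Tame.sum fun k _ => (hf.pd hK _).smul ?_)).sub hf
  have := hη.smooth
  unfold Smooth; fun_prop

theorem Adm.pd_zero (hK : IsSmoothObstacle K) {f : SpaceTime → F} (hf : Adm K f) :
    Adm K (pd 0 f) :=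
  ⟨hf.toTame.pd hK 0, fun t ht x hx => pd_zero_eq_zero (T := t + 1) hf.smooth
    (fun s hs => hf.bdry s hs.1 x hx) ⟨ht, by linarith⟩ (by linarith)⟩

/-- This is the purpose of the cutoff. On `∂K` the radial part of `S̃` is killed by `η = 0`, while
`∂_t f` and `f` vanish there, so the Dirichlet condition survives. The unmodified `S` does not in
general have this property. -/
theorem Adm.scalMod (hK : IsSmoothObstacle K) {η : E3 → ℝ} (hη : IsCutoff K η)
    {f : SpaceTime → F} (hf : Adm K f) : Adm K (scalMod η f) := by
  refine ⟨hf.toTame.scalMod hK hη, fun t ht x hx => ?_⟩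
  simp [ExteriorElastic.scalMod, (hf.pd_zero hK).bdry t ht x hx, hf.bdry t ht x hx,
    hη.zero x (hK.frontier_subset hx)]

theorem Adm.pd_zero_iterate (hK : IsSmoothObstacle K) {f : SpaceTime → F} (hf : Adm K f)
    (n : ℕ) : Adm K ((ExteriorElastic.pd 0)^[n] f) := by
  induction n with
  | zero => exact hf
  | succ n ih => rw [Function.iterate_succ_apply']; exact ih.pd_zero hK

theorem Adm.scalMod_iterate (hK : IsSmoothObstacle K) {η : E3 → ℝ} (hη : IsCutoff K η)
    {f : SpaceTime → F} (hf : Adm K f) (n : ℕ) : Adm K ((ExteriorElastic.scalMod η)^[n] f) := by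
  induction n with
  | zero => exact hf
  | succ n ih => rw [Function.iterate_succ_apply']; exact ih.scalMod hK hη

theorem Tame.integrable {h : SpaceTime → F} (hh : Tame K h) (hK : IsSmoothObstacle K)
    (ht : 0 ≤ t) : MeasureTheory.IntegrableOn (fun x => h (t, x)) Kᶜ := by
  obtain ⟨R, hR⟩ := hh.supp t ht
  have h1 : MeasureTheory.IntegrableOn (fun x => h (t, x)) (Kᶜ ∩ Metric.closedBall 0 R) :=
    ((hh.smooth.slice t).continuousOn.integrableOn_compact
      (isCompact_closedBall (0 : E3) R)).mono_set Set.inter_subset_right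
  refine h1.of_forall_sdiff_eq_zero hK.measurableSet_compl fun x hx => ?_
  refine hR t ⟨ht, le_rfl⟩ x hx.1 ?_
  by_contra! hlt
  exact hx.2 ⟨hx.1, by simpa using hlt⟩

end Tame

section Pairing

variable {F : Type*} [NormedAddCommGroup F] [InnerProductSpace ℝ F]
variable {K : Set E3} {t : ℝ}

/-- The `L²` norm over the exterior of `K`, as a real number. -/
def nrm (K : Set E3) (f : SpaceTime → F) (t : ℝ) : ℝ := √(∫ x in Kᶜ, ‖f (t, x)‖ ^ 2)

theorem nrm_nonneg (f : SpaceTime → F) : 0 ≤ nrm K f t := Real.sqrt_nonneg _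

theorem sq_nrm (f : SpaceTime → F) : nrm K f t ^ 2 = ∫ x in Kᶜ, ‖f (t, x)‖ ^ 2 :=
  Real.sq_sqrt (MeasureTheory.integral_nonneg fun _ => by positivity)

theorem Smooth.inner {f g : SpaceTime → F} (hf : Smooth f) (hg : Smooth g) :
    Smooth (fun p => inner ℝ (f p) (g p)) := ContDiff.inner ℝ hf hg

theorem Tame.inner {f g : SpaceTime → F} (hf : Tame K f) (hg : Smooth g) :
    Tame K (fun p => inner ℝ (f p) (g p)) :=
  hf.of_zero (hf.smooth.inner hg) fun p hp => by simp [hp]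

theorem Tame.norm_sq {f : SpaceTime → F} (hf : Tame K f) : Tame K (fun p => ‖f p‖ ^ 2) :=
  hf.of_zero (ContDiff.norm_sq ℝ hf.smooth) fun p hp => by simp [hp]

theorem pd_inner {f g : SpaceTime → F} (hf : Smooth f) (hg : Smooth g) (β : Fin 4)
    (p : SpaceTime) : pd β (fun p => inner ℝ (f p) (g p)) p
      = inner ℝ (pd β f p) (g p) + inner ℝ (f p) (pd β g p) := by
  simp only [pd]
  rw [fderiv_inner_apply ℝ (hf.diff p) (hg.diff p), add_comm]

variable (hK : IsSmoothObstacle K)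
include hK

theorem Tame.memLp {f : SpaceTime → F} (hf : Tame K f) (ht : 0 ≤ t) :
    MeasureTheory.MemLp (fun x => f (t, x)) 2 (MeasureTheory.volume.restrict Kᶜ) := by
  rw [MeasureTheory.memLp_two_iff_integrable_sq_norm (hf.smooth.aesm t _)]
  exact hf.norm_sq.integrable hK ht

theorem Tame.l2Norm_eq {f : SpaceTime → F} (hf : Tame K f) (ht : 0 ≤ t) :
    l2Norm Kᶜ f t = ENNReal.ofReal (nrm K f t) := by
  rw [l2Norm, (hf.memLp hK ht).eLpNorm_eq_integral_rpow_norm (by norm_num) (by norm_num), nrm,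
    Real.sqrt_eq_rpow]
  norm_num

theorem abs_integral_inner_le {f g : SpaceTime → F} (hf : Tame K f) (hg : Tame K g)
    (ht : 0 ≤ t) : |∫ x in Kᶜ, inner ℝ (f (t, x)) (g (t, x))| ≤ nrm K f t * nrm K g t := by
  have h1 : |∫ x in Kᶜ, inner ℝ (f (t, x)) (g (t, x))|
      ≤ ∫ x in Kᶜ, ‖f (t, x)‖ * ‖g (t, x)‖ := by
    rw [← Real.norm_eq_abs]
    refine MeasureTheory.norm_integral_le_of_norm_le
      ((hf.memLp hK ht).norm.integrable_mul (hg.memLp hK ht).norm)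
      (Filter.Eventually.of_forall fun x => ?_)
    exact norm_inner_le_norm _ _
  refine h1.trans ?_
  have h2 := MeasureTheory.integral_mul_le_Lp_mul_Lq_of_nonneg
    (μ := MeasureTheory.volume.restrict Kᶜ) (p := 2) (q := 2)
    (f := fun x => ‖f (t, x)‖) (g := fun x => ‖g (t, x)‖)
    Real.HolderConjugate.two_two (Filter.Eventually.of_forall fun _ => norm_nonneg _)
    (Filter.Eventually.of_forall fun _ => norm_nonneg _)
    (by simpa using (hf.memLp hK ht).norm) (by simpa using (hg.memLp hK ht).norm)
  simpa [nrm, Real.sqrt_eq_rpow] using h2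

theorem nrm_le_sum {ι : Type*} {s : Finset ι} {f : SpaceTime → F} {g : ι → SpaceTime → F}
    (hf : Tame K f) (hg : ∀ i ∈ s, Tame K (g i)) (ht : 0 ≤ t) {C : ℝ≥0}
    (h : ∀ x ∈ Kᶜ, ‖f (t, x)‖ ≤ C * ∑ i ∈ s, ‖g i (t, x)‖) :
    nrm K f t ≤ C * ∑ i ∈ s, nrm K (g i) t := by
  have h1 := l2Norm_le_sum hK.measurableSet_compl (fun i hi => (hg i hi).smooth) h
  rw [hf.l2Norm_eq hK ht, Finset.sum_congr rfl fun i hi => (hg i hi).l2Norm_eq hK ht,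
    ← ENNReal.ofReal_sum_of_nonneg fun i _ => nrm_nonneg _, ← ENNReal.ofReal_coe_nnreal,
    ← ENNReal.ofReal_mul (by positivity)] at h1
  exact (ENNReal.ofReal_le_ofReal_iff
    (mul_nonneg C.2 (Finset.sum_nonneg fun i _ => nrm_nonneg _))).1 h1

theorem integral_inner_pd {f g : SpaceTime → F} (hf : Tame K f) (hg : Adm K g) (ht : 0 ≤ t)
    (k : Fin 3) : ∫ x in Kᶜ, inner ℝ (pd k.succ f (t, x)) (g (t, x))
      = -∫ x in Kᶜ, inner ℝ (f (t, x)) (pd k.succ g (t, x)) := by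
  obtain ⟨R, hR⟩ := hf.supp t ht
  have h0 := integral_pd_succ_eq_zero hK (hf.smooth.inner hg.smooth) (t := t) (R := R)
    (fun x hx => by simp [hg.bdry t ht x hx])
    (fun x hx hxR => by simp [hR t ⟨ht, le_rfl⟩ x hx hxR]) k
  simp only [pd_inner hf.smooth hg.smooth] at h0
  rw [MeasureTheory.integral_add (((hf.pd hK _).inner hg.smooth).integrable hK ht)
    ((hf.inner (hg.smooth.pd _)).integrable hK ht)] at h0
  linarith

end Pairing

end

end ExteriorElastic

namespace ExteriorElastic

noncomputable section

/-! ### The spatial part of the elastic operator -/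

section Lame

variable {K : Set E3} {t : ℝ} {c₁ c₂ : ℝ}

/-- The matrix coefficients of `c₂² Δ + (c₁² - c₂²) ∇ ∇·`. -/
def lameM (c₁ c₂ : ℝ) (i j : Fin 3) : E3 →L[ℝ] E3 :=
  (if i = j then c₂ ^ 2 else 0) • ContinuousLinearMap.id ℝ E3
    + (c₁ ^ 2 - c₂ ^ 2) • (EuclideanSpace.proj j : E3 →L[ℝ] ℝ).smulRight
        (EuclideanSpace.single i (1 : ℝ))

theorem lameM_apply (i j I : Fin 3) (v : E3) :
    lameM c₁ c₂ i j v I = (if i = j then c₂ ^ 2 else 0) * v I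
      + (c₁ ^ 2 - c₂ ^ 2) * (v j * if I = i then 1 else 0) := by
  simp only [lameM]
  split_ifs <;> simp_all

/-- The spatial part `c₂² Δ f + (c₁² - c₂²) ∇ (∇ · f)` of the elastic operator. -/
def lame (c₁ c₂ : ℝ) (f : SpaceTime → E3) : SpaceTime → E3 :=
  ∑ i : Fin 3, ∑ j : Fin 3, fun p => lameM c₁ c₂ i j (pd i.succ (pd j.succ f) p)

theorem Smooth.lame {f : SpaceTime → E3} (hf : Smooth f) : Smooth (lame c₁ c₂ f) :=
  Smooth.sum fun _ _ => Smooth.sum fun _ _ => ((hf.pd _).pd _).clm _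

theorem Tame.lame (hK : IsSmoothObstacle K) {f : SpaceTime → E3} (hf : Tame K f) :
    Tame K (lame c₁ c₂ f) :=
  Tame.sum fun _ _ => Tame.sum fun _ _ => ((hf.pd hK _).pd hK _).clm _

theorem elastic_eq {f : SpaceTime → E3} (hf : Smooth f) :
    elastic c₁ c₂ f = pd 0 (pd 0 f) - lame c₁ c₂ f := by
  have hdiv : divergence f = ∑ k : Fin 3, fun p => EuclideanSpace.proj (𝕜 := ℝ) k
      (pd k.succ f p) := by
    funext p
    rw [divergence, Finset.sum_apply]
    refine Finset.sum_congr rfl fun k _ => ?_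
    exact congrFun (pd_clm hf (EuclideanSpace.proj (𝕜 := ℝ) k : E3 →L[ℝ] ℝ) k.succ) p
  have hpd : ∀ I : Fin 3, pd I.succ (divergence f) = ∑ k : Fin 3, fun p =>
      EuclideanSpace.proj (𝕜 := ℝ) k (pd I.succ (pd k.succ f) p) := by
    intro I
    rw [hdiv, pd_sum fun k _ => (hf.pd _).clm _]
    exact Finset.sum_congr rfl fun k _ => pd_clm (hf.pd _) _ _
  funext p
  ext I
  simp only [elastic, hpd, lame, Pi.sub_apply, Finset.sum_apply, PiLp.sub_apply, PiLp.smul_apply,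
    Fin.sum_univ_three, PiLp.add_apply]
  fin_cases I <;> simp [lameM_apply] <;> ring

theorem lame_add {f g : SpaceTime → E3} (hf : Smooth f) (hg : Smooth g) :
    lame c₁ c₂ (f + g) = lame c₁ c₂ f + lame c₁ c₂ g := by
  simp only [lame, pd_add hf hg, pd_add (hf.pd _) (hg.pd _), ← Finset.sum_add_distrib]
  refine Finset.sum_congr rfl fun i _ => Finset.sum_congr rfl fun j _ => ?_
  funext p; simp

theorem lame_const_smul {f : SpaceTime → E3} (hf : Smooth f) (c : ℝ) :
    lame c₁ c₂ (c • f) = c • lame c₁ c₂ f := by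
  simp only [lame, pd_const_smul hf, pd_const_smul (hf.pd _), Finset.smul_sum]
  refine Finset.sum_congr rfl fun i _ => Finset.sum_congr rfl fun j _ => ?_
  funext p; simp

theorem pd_lame {f : SpaceTime → E3} (hf : Smooth f) (β : Fin 4) :
    pd β (lame c₁ c₂ f) = lame c₁ c₂ (pd β f) := by
  rw [lame, pd_sum fun i _ => Smooth.sum fun j _ => ((hf.pd _).pd _).clm _, lame]
  refine Finset.sum_congr rfl fun i _ => ?_
  rw [pd_sum fun j _ => ((hf.pd _).pd _).clm _]
  refine Finset.sum_congr rfl fun j _ => ?_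
  rw [pd_clm ((hf.pd _).pd _), pd_comm (hf.pd _) β, pd_comm hf β]

theorem scal_sum {F : Type*} [NormedAddCommGroup F] [NormedSpace ℝ F] {ι : Type*} {s : Finset ι}
    {f : ι → SpaceTime → F} (hf : ∀ i ∈ s, Smooth (f i)) :
    scal (∑ i ∈ s, f i) = ∑ i ∈ s, scal (f i) := by
  funext p
  simp [scal_apply, fderiv_sum (fun i hi => (hf i hi).diff p)]

/-- `A S = (S + 2) A`. -/
theorem lame_scal {f : SpaceTime → E3} (hf : Smooth f) :
    lame c₁ c₂ (scal f) = scal (lame c₁ c₂ f) + (2 : ℝ) • lame c₁ c₂ f := by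
  rw [lame, lame, scal_sum fun i _ => Smooth.sum fun j _ => ((hf.pd _).pd _).clm _,
    Finset.smul_sum, ← Finset.sum_add_distrib]
  refine Finset.sum_congr rfl fun i _ => ?_
  rw [scal_sum fun j _ => ((hf.pd _).pd _).clm _, Finset.smul_sum, ← Finset.sum_add_distrib]
  refine Finset.sum_congr rfl fun j _ => ?_
  rw [scal_clm ((hf.pd _).pd _), pd_scal hf, pd_add (hf.pd _).scal (hf.pd _), pd_scal (hf.pd _)]
  funext p
  simp only [Pi.add_apply, map_add, Pi.smul_apply]
  module

/-- The first order operator `∑ z_l ∂_l`. -/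
def vf {F : Type*} [NormedAddCommGroup F] [NormedSpace ℝ F] (z : Fin 3 → SpaceTime → ℝ)
    (f : SpaceTime → F) : SpaceTime → F := ∑ l : Fin 3, z l • pd l.succ f

theorem vf_smooth {F : Type*} [NormedAddCommGroup F] [NormedSpace ℝ F]
    {z : Fin 3 → SpaceTime → ℝ} (hz : ∀ l, IsCoef (z l)) {f : SpaceTime → F} (hf : Smooth f) :
    Smooth (vf z f) := Smooth.sum fun l _ => (hz l).smul (hf.pd _)

theorem vf_tame (hK : IsSmoothObstacle K) {F : Type*} [NormedAddCommGroup F] [NormedSpace ℝ F]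
    {z : Fin 3 → SpaceTime → ℝ} (hz : ∀ l, IsCoef (z l)) {f : SpaceTime → F} (hf : Tame K f) :
    Tame K (vf z f) := Tame.sum fun l _ => (hf.pd hK _).smul (hz l).smooth

theorem pd_vf {F : Type*} [NormedAddCommGroup F] [NormedSpace ℝ F]
    {z : Fin 3 → SpaceTime → ℝ} (hz : ∀ l, IsCoef (z l)) {f : SpaceTime → F} (hf : Smooth f)
    (β : Fin 4) : pd β (vf z f) = vf z (pd β f) + vf (fun l => pd β (z l)) f := by
  rw [vf, pd_sum fun l _ => (hz l).smul (hf.pd _), vf, vf, ← Finset.sum_add_distrib]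
  refine Finset.sum_congr rfl fun l _ => ?_
  rw [pd_smul (hz l).smooth (hf.pd _), pd_comm hf β, add_comm]

theorem vf_clm {F G : Type*} [NormedAddCommGroup F] [NormedSpace ℝ F] [NormedAddCommGroup G]
    [NormedSpace ℝ G] (z : Fin 3 → SpaceTime → ℝ) {f : SpaceTime → F} (hf : Smooth f)
    (L : F →L[ℝ] G) : vf z (fun p => L (f p)) = fun p => L (vf z f p) := by
  funext p
  simp [vf, pd_clm hf]

theorem vf_sum {F : Type*} [NormedAddCommGroup F] [NormedSpace ℝ F] (z : Fin 3 → SpaceTime → ℝ)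
    {ι : Type*} {s : Finset ι} {f : ι → SpaceTime → F} (hf : ∀ i ∈ s, Smooth (f i)) :
    vf z (∑ i ∈ s, f i) = ∑ i ∈ s, vf z (f i) := by
  simp only [vf, pd_sum hf, Finset.smul_sum]
  exact Finset.sum_comm

/-- The commutator of `A` with the first order operator `∑ z_l ∂_l`. -/
def lameComm (c₁ c₂ : ℝ) (z : Fin 3 → SpaceTime → ℝ) (f : SpaceTime → E3) : SpaceTime → E3 :=
  ∑ i : Fin 3, ∑ j : Fin 3, ∑ l : Fin 3,
    ((fun p => lameM c₁ c₂ i j ((pd j.succ (z l) • pd l.succ (pd i.succ f)) p))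
      + ((fun p => lameM c₁ c₂ i j ((pd i.succ (z l) • pd l.succ (pd j.succ f)) p))
      + fun p => lameM c₁ c₂ i j ((pd i.succ (pd j.succ (z l)) • pd l.succ f) p)))

theorem lame_vf {z : Fin 3 → SpaceTime → ℝ} (hz : ∀ l, IsCoef (z l)) {f : SpaceTime → E3}
    (hf : Smooth f) : lame c₁ c₂ (vf z f) = vf z (lame c₁ c₂ f) + lameComm c₁ c₂ z f := by
  rw [lame, lame, vf_sum z fun i _ => Smooth.sum fun j _ => ((hf.pd _).pd _).clm _, lameComm,
    ← Finset.sum_add_distrib]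
  refine Finset.sum_congr rfl fun i _ => ?_
  rw [vf_sum z fun j _ => ((hf.pd _).pd _).clm _, ← Finset.sum_add_distrib]
  refine Finset.sum_congr rfl fun j _ => ?_
  rw [vf_clm z ((hf.pd _).pd _), pd_vf hz hf, pd_add (vf_smooth hz (hf.pd _))
    (vf_smooth (fun l => (hz l).pd _) hf), pd_vf hz (hf.pd _), pd_vf (fun l => (hz l).pd _) hf]
  funext p
  simp only [vf, Pi.add_apply, map_add, Finset.sum_apply, Pi.smul_apply', map_sum, map_smul,
    Finset.sum_add_distrib]
  abel

/-! ### The energy estimate for tangential derivatives -/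

variable (hK : IsSmoothObstacle K)
include hK

/-- With this choice of coefficient matrices the form equals `c₂² |y|² + (c₁² - c₂²) (tr y)²`. It is
coercive on all matrices, not just symmetric ones, so no Korn inequality is required. -/
theorem lameM_form_ge (h12 : c₂ ^ 2 ≤ c₁ ^ 2) (y : Fin 3 → E3) :
    c₂ ^ 2 * ∑ k : Fin 3, ‖y k‖ ^ 2
      ≤ ∑ i : Fin 3, ∑ j : Fin 3, inner ℝ (lameM c₁ c₂ i j (y j)) (y i) := by
  have h : ∑ i : Fin 3, ∑ j : Fin 3, inner ℝ (lameM c₁ c₂ i j (y j)) (y i)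
      = c₂ ^ 2 * ∑ k : Fin 3, ‖y k‖ ^ 2 + (c₁ ^ 2 - c₂ ^ 2) * (∑ k : Fin 3, y k k) ^ 2 := by
    simp only [EuclideanSpace.norm_sq_eq, Fin.sum_univ_three, PiLp.inner_apply, lameM_apply,
      Real.norm_eq_abs, sq_abs, RCLike.inner_apply, conj_trivial]
    simp
    ring
  rw [h]
  have := mul_nonneg (sub_nonneg.2 h12) (sq_nonneg (∑ k : Fin 3, y k k))
  linarith

/-- Integrate by parts once, without boundary term since `v = 0` on `∂K`, and apply the pointwise
coercivity of the form. -/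
theorem lame_energy (h12 : c₂ ^ 2 ≤ c₁ ^ 2) {v : SpaceTime → E3} (hv : Adm K v) (ht : 0 ≤ t) :
    c₂ ^ 2 * ∑ k : Fin 3, nrm K (pd k.succ v) t ^ 2
      ≤ -∫ x in Kᶜ, inner ℝ (lame c₁ c₂ v (t, x)) (v (t, x)) := by
  have hM : ∀ i j : Fin 3, Tame K (fun p => lameM c₁ c₂ i j (pd j.succ v p)) :=
    fun i j => (hv.toTame.pd hK _).clm _
  have hterm : ∀ i j : Fin 3, Tame K (fun p => inner ℝ
      (lameM c₁ c₂ i j (pd i.succ (pd j.succ v) p)) (v p)) :=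
    fun i j => (((hv.toTame.pd hK _).pd hK _).clm _).inner hv.smooth
  have hterm' : ∀ i j : Fin 3, Tame K (fun p => inner ℝ
      (lameM c₁ c₂ i j (pd j.succ v p)) (pd i.succ v p)) :=
    fun i j => (hM i j).inner (hv.smooth.pd _)
  have h1 : -∫ x in Kᶜ, inner ℝ (lame c₁ c₂ v (t, x)) (v (t, x))
      = ∫ x in Kᶜ, ∑ i : Fin 3, ∑ j : Fin 3,
        inner ℝ (lameM c₁ c₂ i j (pd j.succ v (t, x))) (pd i.succ v (t, x)) := by
    simp only [lame, Finset.sum_apply, sum_inner]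
    rw [MeasureTheory.integral_finsetSum _ fun i _ =>
        MeasureTheory.integrable_finsetSum _ fun j _ => (hterm i j).integrable hK ht,
      MeasureTheory.integral_finsetSum _ fun i _ =>
        MeasureTheory.integrable_finsetSum _ fun j _ => (hterm' i j).integrable hK ht,
      ← Finset.sum_neg_distrib]
    refine Finset.sum_congr rfl fun i _ => ?_
    rw [MeasureTheory.integral_finsetSum _ fun j _ => (hterm i j).integrable hK ht,
      MeasureTheory.integral_finsetSum _ fun j _ => (hterm' i j).integrable hK ht,
      ← Finset.sum_neg_distrib]
    refine Finset.sum_congr rfl fun j _ => ?_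
    have := integral_inner_pd hK (hM i j) hv ht i
    rw [pd_clm (hv.smooth.pd _)] at this
    rw [this, neg_neg]
  simp only [sq_nrm]
  rw [h1, ← MeasureTheory.integral_finsetSum _ fun k _ =>
    ((hv.toTame.pd hK _).norm_sq).integrable hK ht, ← MeasureTheory.integral_const_mul]
  refine MeasureTheory.integral_mono ?_ ?_ fun x => lameM_form_ge hK h12 fun k => pd k.succ v (t, x)
  · exact (MeasureTheory.integrable_finsetSum _ fun k _ =>
      ((hv.toTame.pd hK _).norm_sq).integrable hK ht).const_mul _
  · exact MeasureTheory.integrable_finsetSum _ fun i _ =>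
      MeasureTheory.integrable_finsetSum _ fun j _ => (hterm' i j).integrable hK ht

theorem nrm_le_of_bound {C : ℝ≥0} {f g : SpaceTime → E3} (hf : Tame K f) (hg : Tame K g)
    (ht : 0 ≤ t) (h : ∀ x ∈ Kᶜ, ‖f (t, x)‖ ≤ C * ‖g (t, x)‖) : nrm K f t ≤ C * nrm K g t := by
  simpa using nrm_le_sum hK (s := {()}) (g := fun _ => g) hf (fun _ _ => hg) ht
    (by simpa using h)

theorem pairing_coef_le {b : SpaceTime → ℝ} (hb : IsCoef b) (M : E3 →L[ℝ] E3) :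
    ∃ C : ℝ≥0, ∀ y g : SpaceTime → E3, Tame K y → Tame K g → ∀ t, 0 ≤ t →
      |∫ x in Kᶜ, inner ℝ (M ((b • y) (t, x))) (g (t, x))| ≤ C * (nrm K y t * nrm K g t) := by
  obtain ⟨B, hB⟩ := hb.bounded
  refine ⟨‖M‖₊ * B, fun y g hy hg t ht => ?_⟩
  refine (abs_integral_inner_le hK ((hy.smul hb.smooth).clm M) hg ht).trans ?_
  rw [← mul_assoc]
  refine mul_le_mul_of_nonneg_right ?_ (nrm_nonneg _)
  refine nrm_le_of_bound hK ((hy.smul hb.smooth).clm M) hy ht fun x _ => ?_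
  refine (M.le_opNorm _).trans ?_
  rw [Pi.smul_apply', norm_smul, NNReal.coe_mul, mul_assoc]
  simp only [coe_nnnorm]
  gcongr
  exact hB _

/-- The derivative of `y` is moved onto the product of `b` and the test function `g`, which vanishes
on the boundary; `y` itself enters without derivatives. -/
theorem pairing_pd_le {b : SpaceTime → ℝ} (hb : IsCoef b) (M : E3 →L[ℝ] E3) (m : Fin 3) :
    ∃ C : ℝ≥0, ∀ y g : SpaceTime → E3, Tame K y → Adm K g → ∀ t, 0 ≤ t →
      |∫ x in Kᶜ, inner ℝ (M ((b • pd m.succ y) (t, x))) (g (t, x))|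
        ≤ C * (nrm K y t * (nrm K g t + nrm K (pd m.succ g) t)) := by
  obtain ⟨C₁, h₁⟩ := pairing_coef_le hK (hb.pd m.succ) M
  obtain ⟨C₂, h₂⟩ := pairing_coef_le hK hb M
  refine ⟨C₁ + C₂, fun y g hy hg t ht => ?_⟩
  have hby : Tame K (b • y) := hy.smul hb.smooth
  have hibp := integral_inner_pd hK (hby.clm M) hg ht m
  rw [pd_clm hby.smooth, pd_smul hb.smooth hy.smooth] at hibp
  simp only [Pi.add_apply, map_add, inner_add_left] at hibp
  rw [MeasureTheory.integral_add
    ((((hy.smul (hb.pd _).smooth).clm M).inner hg.smooth).integrable hK ht)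
    (((((hy.pd hK _).smul hb.smooth).clm M).inner hg.smooth).integrable hK ht)] at hibp
  have e₁ := h₁ y g hy hg.toTame t ht
  have e₂ := h₂ y (pd m.succ g) hy (hg.toTame.pd hK _) t ht
  have hy0 := nrm_nonneg (K := K) (t := t) y
  have hg0 := nrm_nonneg (K := K) (t := t) g
  have hg1 := nrm_nonneg (K := K) (t := t) (pd m.succ g)
  have h3 : ∫ x in Kᶜ, inner ℝ (M ((b • pd m.succ y) (t, x))) (g (t, x))
      = -(∫ x in Kᶜ, inner ℝ (M ((b • y) (t, x))) (pd m.succ g (t, x)))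
        - ∫ x in Kᶜ, inner ℝ (M ((pd m.succ b • y) (t, x))) (g (t, x)) := by linarith
  rw [h3]
  have h4 : ∀ u v : ℝ, |-u - v| ≤ |v| + |u| := fun u v => by
    rw [← abs_neg (-u - v)]
    simpa [add_comm] using abs_add_le v u
  refine (h4 _ _).trans ((add_le_add e₁ e₂).trans ?_)
  push_cast
  nlinarith [mul_nonneg C₁.coe_nonneg (mul_nonneg hy0 hg1),
    mul_nonneg C₂.coe_nonneg (mul_nonneg hy0 hg0)]

/-- A vector field, with bounded smooth coefficients, tangential to the boundary of `K`. -/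
structure IsTangential (K : Set E3) (z : Fin 3 → SpaceTime → ℝ) : Prop where
  coef : ∀ l, IsCoef (z l)
  tangential : ∀ f : SpaceTime → E3, Smooth f → ∀ t : ℝ, (∀ x ∈ frontier K, f (t, x) = 0) →
    ∀ x ∈ frontier K, vf z f (t, x) = 0

theorem IsTangential.adm {z : Fin 3 → SpaceTime → ℝ} (hz : IsTangential K z)
    {f : SpaceTime → E3} (hf : Adm K f) : Adm K (vf z f) :=
  ⟨vf_tame hK hz.coef hf.toTame, fun t ht => hz.tangential f hf.smooth t (hf.bdry t ht)⟩

/-- The quantity `‖A w‖ + ∑ ‖∂_k w‖`. -/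
def basicNrm (c₁ c₂ : ℝ) (K : Set E3) (w : SpaceTime → E3) (t : ℝ) : ℝ :=
  nrm K (lame c₁ c₂ w) t + ∑ k : Fin 3, nrm K (pd k.succ w) t

/-- The quantity `‖g‖ + ∑ ‖∂_k g‖`. -/
def sobNrm (K : Set E3) (g : SpaceTime → E3) (t : ℝ) : ℝ :=
  nrm K g t + ∑ k : Fin 3, nrm K (pd k.succ g) t

/-- Operators which are, in the weak sense, controlled by `basicNrm`. -/
def Paired (c₁ c₂ : ℝ) (K : Set E3) (Φ : (SpaceTime → E3) → SpaceTime → E3) : Prop :=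
  (∀ w, Tame K w → Tame K (Φ w)) ∧ ∃ C : ℝ≥0, ∀ w g : SpaceTime → E3, Tame K w → Adm K g →
    ∀ t, 0 ≤ t → |∫ x in Kᶜ, inner ℝ (Φ w (t, x)) (g (t, x))|
      ≤ C * (basicNrm c₁ c₂ K w t * sobNrm K g t)

theorem Paired.add {Φ Ψ : (SpaceTime → E3) → SpaceTime → E3} (h₁ : Paired c₁ c₂ K Φ)
    (h₂ : Paired c₁ c₂ K Ψ) : Paired c₁ c₂ K fun w => Φ w + Ψ w := by
  obtain ⟨t₁, C₁, h₁⟩ := h₁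
  obtain ⟨t₂, C₂, h₂⟩ := h₂
  refine ⟨fun w hw => (t₁ w hw).add (t₂ w hw), C₁ + C₂, fun w g hw hg t ht => ?_⟩
  simp only [Pi.add_apply, inner_add_left]
  rw [MeasureTheory.integral_add (((t₁ w hw).inner hg.smooth).integrable hK ht)
    (((t₂ w hw).inner hg.smooth).integrable hK ht), NNReal.coe_add, add_mul]
  exact (abs_add_le _ _).trans (add_le_add (h₁ w g hw hg t ht) (h₂ w g hw hg t ht))

theorem Paired.sum {Φ : Fin 3 → (SpaceTime → E3) → SpaceTime → E3}
    (h : ∀ i, Paired c₁ c₂ K (Φ i)) : Paired c₁ c₂ K fun w => ∑ i, Φ i w := by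
  simp only [Fin.sum_univ_three]
  exact ((h 0).add hK (h 1)).add hK (h 2)

omit hK in
theorem nrm_lame_le_basicNrm (w : SpaceTime → E3) :
    nrm K (lame c₁ c₂ w) t ≤ basicNrm c₁ c₂ K w t :=
  le_add_of_nonneg_right (Finset.sum_nonneg fun _ _ => nrm_nonneg _)

omit hK in
theorem sum_nrm_pd_le_basicNrm (w : SpaceTime → E3) :
    ∑ k : Fin 3, nrm K (pd k.succ w) t ≤ basicNrm c₁ c₂ K w t :=
  le_add_of_nonneg_left (nrm_nonneg _)

omit hK in
theorem nrm_pd_le_basicNrm (w : SpaceTime → E3) (k : Fin 3) :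
    nrm K (pd k.succ w) t ≤ basicNrm c₁ c₂ K w t :=
  (Finset.single_le_sum (f := fun k : Fin 3 => nrm K (pd k.succ w) t)
    (fun _ _ => nrm_nonneg _) (Finset.mem_univ k)).trans (sum_nrm_pd_le_basicNrm w)

omit hK in
theorem nrm_le_sobNrm (g : SpaceTime → E3) : nrm K g t ≤ sobNrm K g t :=
  le_add_of_nonneg_right (Finset.sum_nonneg fun _ _ => nrm_nonneg _)

omit hK in
theorem nrm_add_pd_le_sobNrm (g : SpaceTime → E3) (k : Fin 3) :
    nrm K g t + nrm K (pd k.succ g) t ≤ sobNrm K g t := by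
  unfold sobNrm
  gcongr
  exact Finset.single_le_sum (f := fun k : Fin 3 => nrm K (pd k.succ g) t)
    (fun _ _ => nrm_nonneg _) (Finset.mem_univ k)

theorem paired_pd {b : SpaceTime → ℝ} (hb : IsCoef b) (M : E3 →L[ℝ] E3) (m : Fin 3)
    {Y : (SpaceTime → E3) → SpaceTime → E3} (hY : ∀ w, Tame K w → Tame K (Y w))
    (hle : ∀ w t, nrm K (Y w) t ≤ basicNrm c₁ c₂ K w t) :
    Paired c₁ c₂ K fun w p => M ((b • pd m.succ (Y w)) p) := by
  obtain ⟨C, hC⟩ := pairing_pd_le hK hb M m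
  refine ⟨fun w hw => (((hY w hw).pd hK _).smul hb.smooth).clm M, C, fun w g hw hg t ht => ?_⟩
  refine (hC _ g (hY w hw) hg t ht).trans ?_
  gcongr
  · exact add_nonneg (nrm_nonneg _) (nrm_nonneg _)
  · exact (nrm_nonneg _).trans (hle w t)
  · exact hle w t
  · exact nrm_add_pd_le_sobNrm g m

theorem paired_coef {b : SpaceTime → ℝ} (hb : IsCoef b) (M : E3 →L[ℝ] E3) (l : Fin 3) :
    Paired c₁ c₂ K fun w p => M ((b • pd l.succ w) p) := by
  obtain ⟨C, hC⟩ := pairing_coef_le hK hb M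
  refine ⟨fun w hw => ((hw.pd hK _).smul hb.smooth).clm M, C, fun w g hw hg t ht => ?_⟩
  refine (hC _ g (hw.pd hK _) hg.toTame t ht).trans ?_
  gcongr
  · exact nrm_nonneg _
  · exact (nrm_nonneg _).trans (nrm_pd_le_basicNrm w l)
  · exact nrm_pd_le_basicNrm w l
  · exact nrm_le_sobNrm g

/-- The operator is `A Z` in expanded form. Its leading terms are a coefficient times one derivative
of `A w` or of some `∂_k w`; moving that derivative onto the test function leaves only `A w` and
first derivatives of `w`. The remaining terms are already of first order. -/
theorem paired_lame_vf {z : Fin 3 → SpaceTime → ℝ} (hz : ∀ l, IsCoef (z l)) :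
    Paired c₁ c₂ K fun w => vf z (lame c₁ c₂ w) + lameComm c₁ c₂ z w := by
  refine Paired.add hK (Paired.sum hK fun l => ?_) (Paired.sum hK fun i => Paired.sum hK fun j =>
    Paired.sum hK fun l => Paired.add hK ?_ (Paired.add hK ?_ ?_))
  · exact paired_pd hK (hz l) (ContinuousLinearMap.id ℝ E3) l (fun w hw => hw.lame hK)
      fun w t => nrm_lame_le_basicNrm w
  · exact paired_pd hK ((hz l).pd _) _ l (fun w hw => hw.pd hK _)
      fun w t => nrm_pd_le_basicNrm w i
  · exact paired_pd hK ((hz l).pd _) _ l (fun w hw => hw.pd hK _)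
      fun w t => nrm_pd_le_basicNrm w j
  · exact paired_coef hK (((hz l).pd _).pd _) _ l

theorem vf_nrm_le {z : Fin 3 → SpaceTime → ℝ} (hz : ∀ l, IsCoef (z l)) :
    ∃ C : ℝ≥0, ∀ w : SpaceTime → E3, Tame K w → ∀ t, 0 ≤ t →
      nrm K (vf z w) t ≤ C * ∑ k : Fin 3, nrm K (pd k.succ w) t := by
  choose B hB using fun l => (hz l).bounded
  refine ⟨∑ l, B l, fun w hw t ht => ?_⟩
  refine nrm_le_sum hK (vf_tame hK hz hw) (fun k _ => hw.pd hK _) ht fun x _ => ?_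
  rw [vf, Finset.sum_apply, Finset.mul_sum]
  refine (norm_sum_le _ _).trans (Finset.sum_le_sum fun l _ => ?_)
  rw [Pi.smul_apply', norm_smul]
  gcongr
  refine (hB l _).trans ?_
  push_cast
  exact Finset.single_le_sum (f := fun l => (B l : ℝ)) (fun l _ => (B l).2) (Finset.mem_univ l)

omit hK in
-- An inequality of type `X² ≤ M Y (B Y + X)` forces `X` to be bounded by a multiple of `Y`. If not,
-- then `Y ≤ X`, the right side is at most `M (B + 1) Y X`, and dividing by `X > 0` is
-- contradictory. The factor `3` is the Cauchy–Schwarz loss for three derivatives.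
theorem le_of_sq_le_mul_add {X Y Q B C c : ℝ} (hc : 0 < c) (hB : 0 ≤ B) (hC : 0 ≤ C) (hX : 0 ≤ X)
    (hY : 0 ≤ Y) (h₁ : X ^ 2 ≤ 3 * Q) (h₂ : c * Q ≤ C * (Y * (B * Y + X))) :
    X ≤ (3 / c * C * (B + 1) + 1) * Y := by
  set M : ℝ := 3 / c * C with hM
  have hM0 : 0 ≤ M := by positivity
  have h6 : X ^ 2 ≤ M * (Y * (B * Y + X)) := by
    have e : Q ≤ (C * (Y * (B * Y + X))) / c := by
      rw [le_div_iff₀ hc]; linarith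
    refine h₁.trans ((mul_le_mul_of_nonneg_left e (by norm_num)).trans (le_of_eq ?_))
    rw [hM]; ring
  by_contra! hlt
  have h7 : Y ≤ X := by
    have : 0 ≤ M * (B + 1) * Y := by positivity
    linarith
  have h8 : M * (Y * (B * Y + X)) ≤ M * (Y * ((B + 1) * X)) := by
    have := mul_le_mul_of_nonneg_left h7 hB
    gcongr
    linarith
  have h9 : 0 < X := lt_of_le_of_lt (by positivity) hlt
  have h10 := mul_lt_mul_of_pos_right hlt h9
  have h11 := mul_nonneg hY hX
  linarith

/-- Tangential derivatives are controlled, with one more derivative, by `‖A w‖ + ‖∇ w‖`. -/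
theorem tangential_estimate (hc₂ : 0 < c₂ ^ 2) (h12 : c₂ ^ 2 ≤ c₁ ^ 2)
    {z : Fin 3 → SpaceTime → ℝ} (hz : IsTangential K z) :
    ∃ C : ℝ≥0, ∀ w : SpaceTime → E3, Adm K w → ∀ t, 0 ≤ t →
      ∑ k : Fin 3, nrm K (pd k.succ (vf z w)) t ≤ C * basicNrm c₁ c₂ K w t := by
  obtain ⟨-, C, hC⟩ := paired_lame_vf (c₁ := c₁) (c₂ := c₂) hK hz.coef
  obtain ⟨B, hB⟩ := vf_nrm_le hK hz.coef
  refine ⟨Real.toNNReal (3 / c₂ ^ 2 * C * (B + 1) + 1), fun w hw t ht => ?_⟩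
  rw [Real.coe_toNNReal _ (by positivity)]
  have hv := hz.adm hK hw
  have h1 := lame_energy (c₁ := c₁) hK h12 hv ht
  -- The test function is `Zw` itself, which vanishes on `∂K` because `Z` is tangential; the pairing
  -- then becomes the elastic energy of `Zw`.
  have h2 := hC w _ hw.toTame hv t ht
  beta_reduce at h2
  rw [← lame_vf hz.coef hw.smooth] at h2
  have hX0 : 0 ≤ ∑ k : Fin 3, nrm K (pd k.succ (vf z w)) t :=
    Finset.sum_nonneg fun k _ => nrm_nonneg _
  have hY0 : 0 ≤ basicNrm c₁ c₂ K w t := (nrm_nonneg _).trans (nrm_lame_le_basicNrm w)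
  have h3 : nrm K (vf z w) t ≤ B * basicNrm c₁ c₂ K w t :=
    (hB w hw.toTame t ht).trans (mul_le_mul_of_nonneg_left (sum_nrm_pd_le_basicNrm w) B.2)
  have h4 := sq_sum_le_card_mul_sum_sq (s := (Finset.univ : Finset (Fin 3)))
      (f := fun k => nrm K (pd k.succ (vf z w)) t)
  refine le_of_sq_le_mul_add hc₂ B.2 C.2 hX0 hY0 (by simpa using h4) ?_
  refine h1.trans ((neg_le_abs _).trans (h2.trans ?_))
  refine mul_le_mul_of_nonneg_left (mul_le_mul_of_nonneg_left ?_ hY0) C.2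
  exact add_le_add h3 le_rfl

end Lame

end

end ExteriorElastic

namespace ExteriorElastic

noncomputable section

/-! ### Second derivatives in terms of tangential derivatives and the elastic operator -/

section Frame

variable {K : Set E3} {c₁ c₂ : ℝ}

/-- Think of `H` as a Hessian and of `φ` as the gradient of a defining function of the boundary.
Smallness of all rotations `φ_j H_{ml} - φ_l H_{mj}` makes `H` a multiple of `φ_i φ_k y` up to an
error, where `y` is the normal-normal component. Inserting this into `∑ M_{ij} H_{ij}` and using
that the symbol of `A` at `φ` is positive definite bounds `y`. -/
theorem frame_algebra (hK : IsSmoothObstacle K) (hc₂ : 0 < c₂ ^ 2) (h12 : c₂ ^ 2 ≤ c₁ ^ 2)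
    {B q₀ : ℝ} (hB : 0 ≤ B) (hq₀ : 0 < q₀) :
    ∃ C : ℝ≥0, ∀ (H : Fin 3 → Fin 3 → E3) (φ : Fin 3 → ℝ) (N : ℝ), 0 ≤ N →
      (∀ i k, H i k = H k i) → (∀ i, |φ i| ≤ B) → q₀ ≤ ∑ i, φ i ^ 2 →
      (∀ m j l, ‖φ j • H m l - φ l • H m j‖ ≤ N) →
      ‖∑ i, ∑ j, lameM c₁ c₂ i j (H i j)‖ ≤ N → ∀ i k, ‖H i k‖ ≤ C * N := by
  set Q : ℝ := 3 * B ^ 2 with hQ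
  set ρ : ℝ := Q * (3 * B) + B * (9 * B ^ 2) with hρ
  set μ : ℝ := ∑ i : Fin 3, ∑ j : Fin 3, ‖lameM c₁ c₂ i j‖ with hμ
  have hμ0 : 0 ≤ μ := Finset.sum_nonneg fun i _ => Finset.sum_nonneg fun j _ => norm_nonneg _
  set σ : ℝ := (Q ^ 2 + μ * ρ) / (c₂ ^ 2 * q₀) with hσ
  have hQ0 : 0 ≤ Q := by positivity
  have hρ0 : 0 ≤ ρ := by positivity
  have hσ0 : 0 ≤ σ := by positivity
  refine ⟨Real.toNNReal ((ρ + B ^ 2 * σ) / q₀ ^ 2), fun H φ N hN hsymm hφ hq hT hA i k => ?_⟩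
  rw [Real.coe_toNNReal _ (by positivity)]
  set q : ℝ := ∑ i, φ i ^ 2 with hqdef
  have hqQ : q ≤ Q := by
    have : ∀ i, φ i ^ 2 ≤ B ^ 2 := fun i => sq_le_sq' (by linarith [neg_abs_le (φ i), hφ i])
      (by linarith [le_abs_self (φ i), hφ i])
    rw [hqdef, hQ, Fin.sum_univ_three]; linarith [this 0, this 1, this 2]
  have hqpos : 0 < q := hq₀.trans_le hq
  -- `h` is the contraction of `H` with `φ`, `y` the double contraction, and `E` is a combination of
  -- rotations. Expanding `h` once more through `E` gives the exact decomposition `q² H_{ik} =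
  -- R_{ik} + φ_i φ_k y` used below.
  let h : Fin 3 → E3 := fun k => ∑ j, φ j • H k j
  let E : Fin 3 → Fin 3 → E3 := fun i k => q • H i k - φ i • h k
  let y : E3 := ∑ k, φ k • h k
  have hE : ∀ i k, ‖E i k‖ ≤ 3 * B * N := by
    intro i k
    have : E i k = ∑ j, φ j • (φ j • H k i - φ i • H k j) := by
      simp only [E, h, hqdef, Fin.sum_univ_three, hsymm i k]; module
    rw [this]
    refine (norm_sum_le _ _).trans ?_
    have hj : ∀ j, ‖φ j • (φ j • H k i - φ i • H k j)‖ ≤ B * N := fun j => by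
      rw [norm_smul]; exact mul_le_mul (hφ j) (hT k j i) (norm_nonneg _) hB
    refine (Finset.sum_le_sum fun j _ => hj j).trans (le_of_eq ?_)
    simp; ring
  let R : Fin 3 → Fin 3 → E3 := fun i k => q • E i k + φ i • ∑ j, φ j • E k j
  have hR : ∀ i k, ‖R i k‖ ≤ ρ * N := by
    intro i k
    refine (norm_add_le _ _).trans ?_
    rw [norm_smul, norm_smul, Real.norm_of_nonneg hqpos.le, hρ, add_mul, mul_assoc Q, mul_assoc B]
    refine add_le_add (mul_le_mul hqQ (hE i k) (norm_nonneg _) hQ0)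
      (mul_le_mul (hφ i) ?_ (norm_nonneg _) hB)
    refine (norm_sum_le _ _).trans ?_
    have hj : ∀ j, ‖φ j • E k j‖ ≤ B * (3 * B * N) := fun j => by
      rw [norm_smul]; exact mul_le_mul (hφ j) (hE k j) (norm_nonneg _) hB
    refine (Finset.sum_le_sum fun j _ => hj j).trans (le_of_eq ?_)
    simp; ring
  have hH : ∀ i k, q ^ 2 • H i k = R i k + (φ i * φ k) • y := by
    intro i k
    simp only [R, E, y, h, Fin.sum_univ_three, hqdef]
    module
  have hT : ‖∑ i, ∑ j, lameM c₁ c₂ i j ((φ i * φ j) • y)‖ ≤ (Q ^ 2 + μ * ρ) * N := by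
    have e : ∑ i, ∑ j, lameM c₁ c₂ i j ((φ i * φ j) • y)
        = q ^ 2 • (∑ i, ∑ j, lameM c₁ c₂ i j (H i j)) - ∑ i, ∑ j, lameM c₁ c₂ i j (R i j) := by
      rw [eq_sub_iff_add_eq, ← Finset.sum_add_distrib, Finset.smul_sum]
      refine Finset.sum_congr rfl fun i _ => ?_
      rw [← Finset.sum_add_distrib, Finset.smul_sum]
      refine Finset.sum_congr rfl fun j _ => ?_
      rw [← map_add, ← map_smul, hH, add_comm]
    rw [e, add_mul]
    refine (norm_sub_le _ _).trans (add_le_add ?_ ?_)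
    · rw [norm_smul, Real.norm_of_nonneg (by positivity)]
      gcongr
    · rw [hμ, mul_assoc, Finset.sum_mul]
      refine (norm_sum_le _ _).trans (Finset.sum_le_sum fun i _ => ?_)
      rw [Finset.sum_mul]
      refine (norm_sum_le _ _).trans (Finset.sum_le_sum fun j _ => ?_)
      exact (ContinuousLinearMap.le_opNorm _ _).trans
        (mul_le_mul_of_nonneg_left (hR i j) (norm_nonneg _))
  -- Pair the bound just obtained with `y`: coercivity applied to the matrix with rows `φ_k y` gives
  -- at least `c₂² q |y|²`, and one power of `|y|` cancels.
  have hy : ‖y‖ ≤ σ * N := by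
    have h1 := lameM_form_ge (c₁ := c₁) hK h12 fun k => φ k • y
    have h2 : ∑ i, ∑ j, inner ℝ (lameM c₁ c₂ i j (φ j • y)) (φ i • y)
        = inner ℝ (∑ i, ∑ j, lameM c₁ c₂ i j ((φ i * φ j) • y)) y := by
      simp only [sum_inner, map_smul, inner_smul_left, inner_smul_right, conj_trivial]
      refine Finset.sum_congr rfl fun i _ => Finset.sum_congr rfl fun j _ => ?_
      ring
    have h3 : ∑ k, ‖φ k • y‖ ^ 2 = q * ‖y‖ ^ 2 := by
      simp only [norm_smul, mul_pow, Real.norm_eq_abs, sq_abs, ← Finset.sum_mul, hqdef]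
    rw [h2, h3] at h1
    have h4 := h1.trans ((real_inner_le_norm _ _).trans
      (mul_le_mul_of_nonneg_right hT (norm_nonneg y)))
    rcases (norm_nonneg y).eq_or_lt with h0 | h0
    · rw [← h0]; positivity
    have h5 : c₂ ^ 2 * (q * ‖y‖) ≤ (Q ^ 2 + μ * ρ) * N := by
      refine le_of_mul_le_mul_right ?_ h0
      calc c₂ ^ 2 * (q * ‖y‖) * ‖y‖ = c₂ ^ 2 * (q * ‖y‖ ^ 2) := by ring
        _ ≤ _ := h4
    have h6 : (c₂ ^ 2 * q₀) * ‖y‖ ≤ (Q ^ 2 + μ * ρ) * N := by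
      refine le_trans ?_ h5
      rw [mul_assoc]
      gcongr
    rw [hσ, div_mul_eq_mul_div, le_div_iff₀ (by positivity)]
    linarith
  rw [div_mul_eq_mul_div, le_div_iff₀ (by positivity)]
  have h1 : q ^ 2 * ‖H i k‖ ≤ (ρ + B ^ 2 * σ) * N := by
    have : q ^ 2 * ‖H i k‖ = ‖q ^ 2 • H i k‖ := by
      rw [norm_smul, Real.norm_of_nonneg (by positivity)]
    rw [this, hH, add_mul]
    refine (norm_add_le _ _).trans (add_le_add (hR i k) ?_)
    rw [norm_smul, norm_mul, mul_assoc (B ^ 2), sq]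
    exact mul_le_mul (mul_le_mul (hφ i) (hφ k) (norm_nonneg _) hB) hy (norm_nonneg _)
      (by positivity)
  refine le_trans ?_ h1
  rw [mul_comm]
  gcongr

/-- On `V`, outside `K`, second derivatives are controlled by `A f`, by derivatives of finitely many
tangential derivatives, and by first derivatives. -/
def FrameOn (c₁ c₂ : ℝ) (K V : Set E3) : Prop :=
  ∃ 𝒵 : Finset (Fin 3 → SpaceTime → ℝ), (∀ z ∈ 𝒵, IsTangential K z) ∧
    ∃ C : ℝ≥0, ∀ f : SpaceTime → E3, Smooth f → ∀ t, ∀ x ∈ V ∩ Kᶜ, ∀ i k : Fin 3,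
      ‖pd i.succ (pd k.succ f) (t, x)‖ ≤ C * (‖lame c₁ c₂ f (t, x)‖
        + ∑ z ∈ 𝒵, ∑ m : Fin 3, ‖pd m.succ (vf z f) (t, x)‖
        + ∑ m : Fin 3, ‖pd m.succ f (t, x)‖)

theorem FrameOn.mono {V V' : Set E3} (h : FrameOn c₁ c₂ K V') (hV : V ⊆ V') :
    FrameOn c₁ c₂ K V := by
  obtain ⟨𝒵, hZ, C, hC⟩ := h
  exact ⟨𝒵, hZ, C, fun f hf t x hx => hC f hf t x ⟨hV hx.1, hx.2⟩⟩

theorem FrameOn.of_disjoint {V : Set E3} (h : V ∩ Kᶜ = ∅) : FrameOn c₁ c₂ K V :=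
  ⟨∅, by simp, 0, fun f _ t x hx => by simp [h] at hx⟩

theorem FrameOn.union {V V' : Set E3} (h : FrameOn c₁ c₂ K V) (h' : FrameOn c₁ c₂ K V') :
    FrameOn c₁ c₂ K (V ∪ V') := by
  classical
  obtain ⟨𝒵, hZ, C, hC⟩ := h
  obtain ⟨𝒵', hZ', C', hC'⟩ := h'
  refine ⟨𝒵 ∪ 𝒵', fun z hz => (Finset.mem_union.1 hz).elim (hZ z) (hZ' z), C + C',
    fun f hf t x hx i k => ?_⟩
  have hsub : ∀ s : Finset (Fin 3 → SpaceTime → ℝ), s ⊆ 𝒵 ∪ 𝒵' →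
      ∑ z ∈ s, ∑ m : Fin 3, ‖pd m.succ (vf z f) (t, x)‖
        ≤ ∑ z ∈ 𝒵 ∪ 𝒵', ∑ m : Fin 3, ‖pd m.succ (vf z f) (t, x)‖ := fun s hs =>
    Finset.sum_le_sum_of_subset_of_nonneg hs fun z _ _ =>
      Finset.sum_nonneg fun m _ => norm_nonneg _
  push_cast
  rcases hx with ⟨hx | hx, hxK⟩
  · refine (hC f hf t x ⟨hx, hxK⟩ i k).trans ?_
    have := hsub 𝒵 Finset.subset_union_left
    gcongr
    exact le_add_of_nonneg_right C'.coe_nonneg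
  · refine (hC' f hf t x ⟨hx, hxK⟩ i k).trans ?_
    have := hsub 𝒵' Finset.subset_union_right
    gcongr
    exact le_add_of_nonneg_left C.coe_nonneg

theorem vf_bound {z : Fin 3 → SpaceTime → ℝ} (hz : ∀ l, IsCoef (z l)) :
    ∃ C : ℝ≥0, ∀ (f : SpaceTime → E3) (p : SpaceTime),
      ‖vf z f p‖ ≤ C * ∑ m : Fin 3, ‖pd m.succ f p‖ := by
  choose B hB using fun l => (hz l).bounded
  refine ⟨∑ l, B l, fun f p => ?_⟩
  rw [vf, Finset.sum_apply, Finset.mul_sum]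
  refine (norm_sum_le _ _).trans (Finset.sum_le_sum fun l _ => ?_)
  rw [Pi.smul_apply', norm_smul]
  gcongr
  refine (hB l _).trans ?_
  push_cast
  exact Finset.single_le_sum (f := fun l => (B l : ℝ)) (fun l _ => (B l).2) (Finset.mem_univ l)

/-- `∂_m Z f - Z ∂_m f` is of first order. -/
theorem norm_vf_pd_le {z : Fin 3 → SpaceTime → ℝ} (hz : ∀ l, IsCoef (z l)) :
    ∃ C : ℝ≥0, ∀ f : SpaceTime → E3, Smooth f → ∀ (p : SpaceTime) (m : Fin 3),
      ‖vf z (pd m.succ f) p‖ ≤ ‖pd m.succ (vf z f) p‖ + C * ∑ k : Fin 3, ‖pd k.succ f p‖ := by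
  choose C hC using fun m : Fin 3 => vf_bound fun l => (hz l).pd m.succ
  refine ⟨∑ m, C m, fun f hf p m => ?_⟩
  have h : vf z (pd m.succ f) p = pd m.succ (vf z f) p - vf (fun l => pd m.succ (z l)) f p := by
    rw [pd_vf hz hf]; simp
  rw [h]
  refine (norm_sub_le _ _).trans (add_le_add le_rfl ((hC m f p).trans ?_))
  gcongr
  exact Finset.single_le_sum (f := C) (fun _ _ => zero_le) (Finset.mem_univ m)

/-- The vector field `b ∂_j`. -/
def coordField (b : E3 → ℝ) (j : Fin 3) : Fin 3 → SpaceTime → ℝ :=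
  fun m p => if m = j then b p.2 else 0

theorem vf_coordField {F : Type*} [NormedAddCommGroup F] [NormedSpace ℝ F] (b : E3 → ℝ)
    (j : Fin 3) (f : SpaceTime → F) (p : SpaceTime) :
    vf (coordField b j) f p = b p.2 • pd j.succ f p := by
  simp only [vf, coordField, Finset.sum_apply, Pi.smul_apply']
  rw [Finset.sum_eq_single j] <;> simp +contextual

theorem isTangential_coordField (hK : IsSmoothObstacle K) {b : E3 → ℝ}
    (hb : IsCoef fun p => b p.2) (h0 : ∀ x ∈ K, b x = 0) (j : Fin 3) :
    IsTangential K (coordField b j) := by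
  refine ⟨fun l => ?_, fun f _ t _ x hx => ?_⟩
  · by_cases h : l = j
    · have : coordField b j l = fun p => b p.2 := by funext p; simp [coordField, h]
      rwa [this]
    · have : coordField b j l = fun _ => 0 := by funext p; simp [coordField, h]
      rw [this]; exact isCoef_const 0
  · rw [vf_coordField]; simp [h0 x (hK.frontier_subset hx)]

/-- A field `b ∂_j` with `b = 0` on `K` is trivially tangential, and where `b = 1` these fields are
all the coordinate derivatives. Away from the boundary the operator `A` is therefore not needed. -/
theorem FrameOn.of_cutoff (hK : IsSmoothObstacle K) {b : E3 → ℝ}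
    (hb : IsCoef fun p => b p.2) (h0 : ∀ x ∈ K, b x = 0) {V : Set E3} (h1 : ∀ x ∈ V, b x = 1) :
    FrameOn c₁ c₂ K V := by
  classical
  have hT := isTangential_coordField hK hb h0
  choose C hC using fun j : Fin 3 => norm_vf_pd_le (hT j).coef
  refine ⟨Finset.univ.image (coordField b), fun z hz => ?_, 1 + ∑ j, C j,
    fun f hf t x hx i k => ?_⟩
  · obtain ⟨j, -, rfl⟩ := Finset.mem_image.1 hz
    exact hT j
  · have h2 := hC i f hf (t, x) k
    rw [vf_coordField, h1 x hx.1, one_smul] at h2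
    have h3 : ‖pd k.succ (vf (coordField b i) f) (t, x)‖
        ≤ ∑ z ∈ Finset.univ.image (coordField b), ∑ m : Fin 3, ‖pd m.succ (vf z f) (t, x)‖ := by
      refine le_trans ?_ (Finset.single_le_sum
        (f := fun z => ∑ m : Fin 3, ‖pd m.succ (vf z f) (t, x)‖)
        (fun z _ => Finset.sum_nonneg fun m _ => norm_nonneg _)
        (Finset.mem_image_of_mem (coordField b) (Finset.mem_univ i)))
      exact Finset.single_le_sum (f := fun m : Fin 3 => ‖pd m.succ (vf (coordField b i) f) (t, x)‖)
        (fun m _ => norm_nonneg _) (Finset.mem_univ k)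
    have h4 : (C i : ℝ) ≤ ∑ j, (C j : ℝ) :=
      Finset.single_le_sum (f := fun j => (C j : ℝ)) (fun j _ => (C j).2) (Finset.mem_univ i)
    have h5 : 0 ≤ ∑ m : Fin 3, ‖pd m.succ f (t, x)‖ := Finset.sum_nonneg fun _ _ => norm_nonneg _
    have h6 : 0 ≤ ∑ j, (C j : ℝ) := Finset.sum_nonneg fun j _ => (C j).2
    have h7 := mul_le_mul_of_nonneg_right h4 h5
    have h8 := norm_nonneg (lame c₁ c₂ f (t, x))
    have h9 := (norm_nonneg _).trans h3
    push_cast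
    nlinarith [mul_nonneg h6 h8, mul_nonneg h6 h9]

/-- `ψ` is constant on `{φ = 0}` near `x`, hence has a constrained extremum there, and the Lagrange
multiplier rule applies. The multiplier of `ψ` is nonzero because `dφ ≠ 0`. -/
theorem fderiv_eq_smul_of_zero_on {φ ψ : E3 → ℝ} (hφ : ContDiff ℝ ∞ φ) (hψ : ContDiff ℝ ∞ ψ)
    {x : E3} (hd : fderiv ℝ φ x ≠ 0) (hx : φ x = 0)
    (h : ∀ᶠ y in 𝓝 x, φ y = 0 → ψ y = 0) : ∃ c : ℝ, fderiv ℝ ψ x = c • fderiv ℝ φ x := by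
  have hext : IsLocalExtrOn ψ {y | φ y = φ x} x := by
    refine Or.inl ?_
    filter_upwards [nhdsWithin_le_nhds h, self_mem_nhdsWithin] with y hy hy'
    rw [h.self_of_nhds hx, hy (by rw [← hx]; exact hy')]
  obtain ⟨a, b, hab, hzero⟩ := hext.exists_multipliers_of_hasStrictFDerivAt_1d
    (hφ.contDiffAt.hasStrictFDerivAt (by simp)) (hψ.contDiffAt.hasStrictFDerivAt (by simp))
  have hb : b ≠ 0 := by
    rintro rfl
    rw [zero_smul, add_zero, smul_eq_zero] at hzero
    rcases hzero with rfl | h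
    · exact hab rfl
    · exact hd h
  refine ⟨-(b⁻¹ * a), ?_⟩
  have : b • fderiv ℝ ψ x = -(a • fderiv ℝ φ x) := by
    rw [eq_neg_iff_add_eq_zero, add_comm]; exact hzero
  rw [neg_smul, mul_smul, ← smul_neg, ← this, smul_smul, inv_mul_cancel₀ hb, one_smul]

/-- The vector field `χ (∂_jφ ∂_l - ∂_lφ ∂_j)`. -/
def rotField (χ φ : E3 → ℝ) (j l : Fin 3) : Fin 3 → SpaceTime → ℝ :=
  fun m p => χ p.2 * ((if m = l then fderiv ℝ φ p.2 (EuclideanSpace.single j 1) else 0)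
    - if m = j then fderiv ℝ φ p.2 (EuclideanSpace.single l 1) else 0)

theorem vf_rotField (χ φ : E3 → ℝ) (j l : Fin 3) (f : SpaceTime → E3) (p : SpaceTime) :
    vf (rotField χ φ j l) f p = χ p.2 • (fderiv ℝ φ p.2 (EuclideanSpace.single j 1) • pd l.succ f p
      - fderiv ℝ φ p.2 (EuclideanSpace.single l 1) • pd j.succ f p) := by
  simp only [vf, rotField, Finset.sum_apply, Pi.smul_apply', mul_smul, sub_smul, ite_smul,
    zero_smul, ← Finset.smul_sum, Finset.sum_sub_distrib]
  simp

/-- If `f` vanishes on the boundary, the spatial gradient of each component is parallel to `∇φ`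
there, and a rotation built from `∇φ` annihilates `∇φ`. -/
theorem isTangential_rotField {φ χ : E3 → ℝ} (hφ : ContDiff ℝ ∞ φ) (hχ : ContDiff ℝ ∞ χ) {R : ℝ}
    (hR : ∀ x, R < ‖x‖ → χ x = 0) (h : ∀ x ∈ frontier K, χ x ≠ 0 → fderiv ℝ φ x ≠ 0 ∧
      ∀ᶠ y in 𝓝 x, (y ∈ frontier K ↔ φ y = 0)) (j l : Fin 3) :
    IsTangential K (rotField χ φ j l) := by
  refine ⟨fun m => ?_, fun f hf t hz x hx => ?_⟩
  · have hd : ∀ i : Fin 3, ContDiff ℝ ∞ fun x => fderiv ℝ φ x (EuclideanSpace.single i 1) :=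
      fun i => (hφ.fderiv_right (by simp)).clm_apply contDiff_const
    have h0 : ContDiff ℝ ∞ fun _ : E3 => (0 : ℝ) := contDiff_const
    refine isCoef_of_spatial (b := fun x => χ x *
      ((if m = l then fderiv ℝ φ x (EuclideanSpace.single j 1) else 0)
        - if m = j then fderiv ℝ φ x (EuclideanSpace.single l 1) else 0)) (R := R) (c := 0) ?_ ?_
    · refine hχ.mul (ContDiff.sub ?_ ?_)
      · split_ifs
        exacts [hd j, h0]
      · split_ifs
        exacts [hd l, h0]
    · intro x hx; simp [hR x hx]
  · rw [vf_rotField]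
    by_cases hχx : χ x = 0
    · simp [hχx]
    obtain ⟨hd, hev⟩ := h x hx hχx
    have hφx : φ x = 0 := hev.self_of_nhds.1 hx
    ext I
    have hsm : ContDiff ℝ ∞ fun y => f (t, y) I :=
      (EuclideanSpace.proj (𝕜 := ℝ) I : E3 →L[ℝ] ℝ).contDiff.comp (hf.comp (by fun_prop))
    obtain ⟨c, hc⟩ := fderiv_eq_smul_of_zero_on hφ hsm hd hφx (by
      filter_upwards [hev] with y hy hy0
      rw [hz y (hy.2 hy0)]; rfl)
    have hI : ∀ k : Fin 3, (pd k.succ f (t, x)) I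
        = c * fderiv ℝ φ x (EuclideanSpace.single k 1) := by
      intro k
      have h1 := congrFun (pd_clm hf (EuclideanSpace.proj (𝕜 := ℝ) I : E3 →L[ℝ] ℝ) k.succ) (t, x)
      have h2 := pd_succ_eq_fderiv (hf.clm (EuclideanSpace.proj (𝕜 := ℝ) I : E3 →L[ℝ] ℝ)) k t x
      have h3 := h1.symm.trans h2
      have h4 : (fun y => (EuclideanSpace.proj (𝕜 := ℝ) I : E3 →L[ℝ] ℝ) (f (t, y)))
          = fun y => f (t, y) I := rfl
      rw [h4, hc] at h3
      simpa using h3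
    simp only [PiLp.smul_apply, PiLp.sub_apply, hI, PiLp.zero_apply, smul_eq_mul]
    ring

/-- `frame_algebra` is applied at each point to the Hessian of `f` and the gradient of the defining
function. The rotations of the Hessian are `Z ∂_m f`, which differ from `∂_m Z f` by first order
terms. -/
theorem FrameOn.exists_nhds_frontier (hK : IsSmoothObstacle K) (hc₂ : 0 < c₂ ^ 2)
    (h12 : c₂ ^ 2 ≤ c₁ ^ 2) {x₀ : E3} (hx₀ : x₀ ∈ frontier K) :
    ∃ V ∈ 𝓝 x₀, FrameOn c₁ c₂ K V := by
  classical
  obtain ⟨φ, hφ, hd, hev⟩ := hK.exists_defining hx₀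
  obtain ⟨r, hr, hball⟩ := Metric.eventually_nhds_iff_ball.1 hev
  -- The cutoff is `1` on the half ball, where the estimate is claimed, and supported where `φ`
  -- still describes the boundary.
  let χ : ContDiffBump x₀ := ⟨r / 2, r, by positivity, by linarith⟩
  let D : Fin 3 → E3 → ℝ := fun i x => fderiv ℝ φ x (EuclideanSpace.single i 1)
  have hD : ∀ i, Continuous (D i) := fun i =>
    (hφ.continuous_fderiv (by simp)).clm_apply continuous_const
  have hq : 0 < ∑ i, D i x₀ ^ 2 := by
    by_contra! hle
    apply hd
    have hz : ∀ i, D i x₀ = 0 := fun i => by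
      have h1 := Finset.single_le_sum (f := fun i => D i x₀ ^ 2) (fun i _ => sq_nonneg _)
        (Finset.mem_univ i)
      exact pow_eq_zero_iff (two_ne_zero) |>.1 (le_antisymm (h1.trans hle) (sq_nonneg _))
    refine ContinuousLinearMap.ext fun v => ?_
    have hv : v = ∑ k : Fin 3, v k • EuclideanSpace.single k (1 : ℝ) := by
      ext i; simp [Fin.sum_univ_three]; fin_cases i <;> simp
    rw [hv, map_sum]
    simp only [map_smul]
    simp only [D] at hz
    simp [hz]
  -- Half the value of `|∇φ|²` at `x₀`, and below more than any `|∂_iφ(x₀)|`: by continuity both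
  -- bounds persist nearby.
  set q₀ := (∑ i, D i x₀ ^ 2) / 2 with hq₀
  set B := ∑ i, |D i x₀| + 1 with hB
  have hB0 : 0 ≤ B := by positivity
  have hevB : ∀ᶠ x in 𝓝 x₀, ∀ i, |D i x| < B := by
    refine Filter.eventually_all.2 fun i => ?_
    refine ((hD i).abs.continuousAt).eventually_lt continuousAt_const ?_
    have := Finset.single_le_sum (f := fun i => |D i x₀|) (fun i _ => abs_nonneg _)
      (Finset.mem_univ i)
    rw [hB]; linarith
  have hevq : ∀ᶠ x in 𝓝 x₀, q₀ < ∑ i, D i x ^ 2 := by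
    have hc : Continuous fun x => ∑ i, D i x ^ 2 :=
      continuous_finsetSum _ fun i _ => (hD i).pow 2
    refine continuousAt_const.eventually_lt hc.continuousAt ?_
    rw [hq₀]; linarith
  have hT : ∀ j l, IsTangential K (rotField χ φ j l) := fun j l => by
    refine isTangential_rotField hφ χ.contDiff (R := ‖x₀‖ + r) (fun x hx => ?_)
      (fun x hx hχx => ?_) j l
    · refine χ.zero_of_le_dist ?_
      have h1 := norm_sub_norm_le x x₀
      rw [dist_eq_norm]
      change r ≤ _
      linarith
    · have hxb : x ∈ Metric.ball x₀ r := by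
        have : x ∈ Function.support χ := hχx
        rwa [χ.support_eq] at this
      refine ⟨(hball x hxb).1, ?_⟩
      filter_upwards [Metric.isOpen_ball.mem_nhds hxb] with y hy using (hball y hy).2
  obtain ⟨C, hC⟩ := frame_algebra (c₁ := c₁) hK hc₂ h12 hB0 (show 0 < q₀ by positivity)
  choose M hM using fun j l : Fin 3 => norm_vf_pd_le (hT j l).coef
  set Mt : ℝ≥0 := ∑ j, ∑ l, M j l with hMt
  have hMle : ∀ j l, (M j l : ℝ) ≤ Mt := fun j l => by
    have h1 := Finset.single_le_sum (f := fun l => M j l) (fun _ _ => zero_le) (Finset.mem_univ l)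
    have h2 := Finset.single_le_sum (f := fun j => ∑ l, M j l) (fun _ _ => zero_le)
      (Finset.mem_univ j)
    exact_mod_cast h1.trans h2
  clear_value Mt
  refine ⟨_, Filter.inter_mem (Metric.ball_mem_nhds x₀ (half_pos hr))
    (Filter.inter_mem hevB hevq), (Finset.univ ×ˢ Finset.univ).image
      fun jl : Fin 3 × Fin 3 => rotField χ φ jl.1 jl.2, fun z hz => ?_, C * (1 + Mt), ?_⟩
  · obtain ⟨jl, -, rfl⟩ := Finset.mem_image.1 hz
    exact hT _ _
  rintro f hf t x ⟨⟨hxb, hxB, hxq⟩, -⟩ i k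
  generalize hS : ∑ z ∈ (Finset.univ ×ˢ Finset.univ).image
      (fun jl : Fin 3 × Fin 3 => rotField χ φ jl.1 jl.2),
      ∑ m : Fin 3, ‖pd m.succ (vf z f) (t, x)‖ = S
  have hSle : ∀ m j l : Fin 3, ‖pd m.succ (vf (rotField χ φ j l) f) (t, x)‖ ≤ S := by
    intro m j l
    rw [← hS]
    refine le_trans ?_ (Finset.single_le_sum
      (f := fun z => ∑ m : Fin 3, ‖pd m.succ (vf z f) (t, x)‖)
      (fun z _ => Finset.sum_nonneg fun m _ => norm_nonneg _)
      (Finset.mem_image.2 ⟨(j, l), by simp, rfl⟩))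
    exact Finset.single_le_sum (f := fun m : Fin 3 => ‖pd m.succ (vf (rotField χ φ j l) f) (t, x)‖)
      (fun m _ => norm_nonneg _) (Finset.mem_univ m)
  have hP0 : 0 ≤ ∑ m : Fin 3, ‖pd m.succ f (t, x)‖ := Finset.sum_nonneg fun m _ => norm_nonneg _
  have hS0 : 0 ≤ S := (norm_nonneg _).trans (hSle 0 0 0)
  have hL0 := norm_nonneg (lame c₁ c₂ f (t, x))
  have hM0 := Mt.coe_nonneg
  have hχ1 : χ x = 1 := χ.one_of_mem_closedBall (Metric.ball_subset_closedBall hxb)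
  have hP : ∀ j l m : Fin 3, ‖vf (rotField χ φ j l) (pd m.succ f) (t, x)‖
      ≤ S + Mt * ∑ m : Fin 3, ‖pd m.succ f (t, x)‖ := fun j l m =>
    (hM j l f hf (t, x) m).trans
      (add_le_add (hSle m j l) (mul_le_mul_of_nonneg_right (hMle j l) hP0))
  generalize ∑ m : Fin 3, ‖pd m.succ f (t, x)‖ = P at hP0 hP ⊢
  have key := hC (fun m l => pd m.succ (pd l.succ f) (t, x)) (fun i => D i x)
    (‖lame c₁ c₂ f (t, x)‖ + S + Mt * P)
    (add_nonneg (add_nonneg hL0 hS0) (mul_nonneg hM0 hP0))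
    (fun i k => congrFun (pd_comm hf _ _) _) (fun i => (hxB i).le) hxq.le ?_ ?_ i k
  · refine key.trans ?_
    rw [NNReal.coe_mul, mul_assoc]
    refine mul_le_mul_of_nonneg_left ?_ C.2
    push_cast
    nlinarith [mul_nonneg hM0 hL0, mul_nonneg hM0 hS0]
  · intro m j l
    have h1 := hP j l m
    rw [vf_rotField, hχ1, one_smul, pd_comm hf l.succ, pd_comm hf j.succ] at h1
    refine h1.trans ?_
    linarith
  · have : ∑ i, ∑ j, lameM c₁ c₂ i j (pd i.succ (pd j.succ f) (t, x)) = lame c₁ c₂ f (t, x) := by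
      simp [lame]
    rw [this]
    nlinarith [mul_nonneg hM0 hP0]

theorem FrameOn.exists_nhds_compl (hK : IsSmoothObstacle K) {x₀ : E3} (hx₀ : x₀ ∈ Kᶜ) :
    ∃ V ∈ 𝓝 x₀, FrameOn c₁ c₂ K V := by
  obtain ⟨r, hr, hball⟩ := Metric.isOpen_iff.1 hK.isOpen_compl x₀ hx₀
  let χ : ContDiffBump x₀ := ⟨r / 2, r, by positivity, by linarith⟩
  refine ⟨Metric.ball x₀ (r / 2), Metric.ball_mem_nhds _ (half_pos hr),
    FrameOn.of_cutoff hK (b := χ) (isCoef_of_spatial χ.contDiff (R := ‖x₀‖ + r) (c := 0)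
      fun x hx => ?_) (fun x hx => ?_) fun x hx => ?_⟩
  · refine χ.zero_of_le_dist ?_
    have h1 := norm_sub_norm_le x x₀
    rw [dist_eq_norm]
    change r ≤ _
    linarith
  · refine χ.zero_of_le_dist ?_
    by_contra! hlt
    exact hball hlt hx
  · exact χ.one_of_mem_closedBall (Metric.ball_subset_closedBall hx)

/-- Compactness of the closed unit ball reduces it to finitely many local frames: at the frontier,
off `K`, or inside `K`, where nothing is claimed. For `|x| > 1` the single cutoff `η` serves, so the
total number of fields stays finite. -/
theorem frameOn_univ (hK : IsSmoothObstacle K) {η : E3 → ℝ} (hη : IsCutoff K η) (hc₂ : 0 < c₂ ^ 2)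
    (h12 : c₂ ^ 2 ≤ c₁ ^ 2) : FrameOn c₁ c₂ K Set.univ := by
  have h1 : FrameOn c₁ c₂ K (Metric.closedBall 0 1) := by
    refine (isCompact_closedBall (0 : E3) 1).induction_on (p := FrameOn c₁ c₂ K)
      (FrameOn.of_disjoint (by simp)) (fun s t hst ht => ht.mono hst) (fun s t hs ht => hs.union ht)
      fun x _ => ?_
    suffices ∃ V ∈ 𝓝 x, FrameOn c₁ c₂ K V by
      obtain ⟨V, hV, h⟩ := this
      exact ⟨V, nhdsWithin_le_nhds hV, h⟩
    by_cases hx : x ∈ K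
    · by_cases hxi : x ∈ interior K
      · exact ⟨interior K, isOpen_interior.mem_nhds hxi, FrameOn.of_disjoint (by
          rw [← Set.disjoint_iff_inter_eq_empty, Set.disjoint_compl_right_iff_subset]
          exact interior_subset)⟩
      · exact FrameOn.exists_nhds_frontier hK hc₂ h12 (by
          rw [hK.isClosed.frontier_eq]; exact ⟨hx, hxi⟩)
    · exact FrameOn.exists_nhds_compl hK hx
  have h2 : FrameOn c₁ c₂ K {x : E3 | 1 < ‖x‖} :=
    FrameOn.of_cutoff hK hη.isCoef_self hη.zero fun x hx => hη.one x hx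
  refine (h1.union h2).mono fun x _ => ?_
  rcases le_or_gt ‖x‖ 1 with h | h
  · exact Or.inl (by simpa using h)
  · exact Or.inr h

end Frame

end

end ExteriorElastic

namespace ExteriorElastic

noncomputable section

/-! ### Elliptic regularity -/

namespace Dom

variable {X : Type*} {P : X → Prop} {Φ : X → ℝ → ℝ≥0∞}

theorem sum_right {ι : Type*} {s : Finset ι} {Ψ : ι → X → ℝ → ℝ≥0∞} {i : ι} (hi : i ∈ s)
    (h : Dom P Φ (Ψ i)) : Dom P Φ (fun f t => ∑ i ∈ s, Ψ i f t) :=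
  h.trans_le fun f _ t _ => single_le_sum_ennreal (g := fun i => Ψ i f t) hi

end Dom

section Elliptic

variable {F : Type*} [NormedAddCommGroup F] [NormedSpace ℝ F]
variable {G : Type*} [NormedAddCommGroup G] [NormedSpace ℝ G]
variable {D : Set E3} {t : ℝ}

/-- The sum of the `L²(D)` norms of the spatial derivatives of order less than `n`. -/
def snorm (D : Set E3) : ℕ → (SpaceTime → F) → ℝ → ℝ≥0∞
  | 0, _, _ => 0
  | n + 1, f, t => l2Norm D f t + ∑ k : Fin 3, snorm D n (pd k.succ f) t

@[simp] theorem snorm_zero (f : SpaceTime → F) : snorm D 0 f t = 0 := rfl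

theorem snorm_succ (n : ℕ) (f : SpaceTime → F) : snorm D (n + 1) f t
    = l2Norm D f t + ∑ k : Fin 3, snorm D n (pd k.succ f) t := rfl

theorem snorm_le_wnorm (a n : ℕ) (f : SpaceTime → F) :
    snorm D n f t ≤ wnorm D (a + 1) n f t := by
  induction n generalizing f with
  | zero => simp
  | succ n ih =>
    rw [snorm_succ, wnorm_succ, Fin.sum_univ_succ (fun β : Fin 4 => wnorm D (a + 1) n (pd β f) t)]
    refine le_add_right (add_le_add le_rfl (le_add_left ?_))
    exact Finset.sum_le_sum fun k _ => ih _

theorem snorm_mono {n n' : ℕ} (hn : n ≤ n') (f : SpaceTime → F) :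
    snorm D n f t ≤ snorm D n' f t := by
  induction n' generalizing n f with
  | zero => simp [Nat.le_zero.1 hn]
  | succ n' ih =>
    rcases n with _ | n
    · simp
    rw [snorm_succ, snorm_succ]
    gcongr with k
    exact ih (by omega) _

theorem snorm_pd_le (n : ℕ) (k : Fin 3) (f : SpaceTime → F) :
    snorm D n (pd k.succ f) t ≤ snorm D (n + 1) f t :=
  le_add_left (single_le_sum_ennreal (g := fun k : Fin 3 => snorm D n (pd k.succ f) t)
    (Finset.mem_univ k))

theorem l2Norm_le_snorm (n : ℕ) (f : SpaceTime → F) : l2Norm D f t ≤ snorm D (n + 1) f t :=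
  le_add_right le_rfl

theorem snorm_add_le {f g : SpaceTime → F} (hf : Smooth f) (hg : Smooth g) (n : ℕ) :
    snorm D n (f + g) t ≤ snorm D n f t + snorm D n g t := by
  induction n generalizing f g with
  | zero => simp
  | succ n ih =>
    simp only [snorm_succ, pd_add hf hg]
    have h1 := l2Norm_add_le (D := D) (t := t) hf hg
    have h2 : ∑ k : Fin 3, snorm D n (pd k.succ f + pd k.succ g) t
        ≤ ∑ k : Fin 3, snorm D n (pd k.succ f) t + ∑ k : Fin 3, snorm D n (pd k.succ g) t := by
      rw [← Finset.sum_add_distrib]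
      exact Finset.sum_le_sum fun k _ => ih (hf.pd _) (hg.pd _)
    refine (add_le_add h1 h2).trans (le_of_eq ?_)
    abel

theorem snorm_clm_le (hD : MeasurableSet D) {f : SpaceTime → F} (hf : Smooth f) (L : F →L[ℝ] G)
    (n : ℕ) : snorm D n (fun p => L (f p)) t ≤ ‖L‖₊ * snorm D n f t := by
  induction n generalizing f with
  | zero => simp
  | succ n ih =>
    simp only [snorm_succ, pd_clm hf, mul_add, Finset.mul_sum]
    gcongr with k
    · exact l2Norm_clm_le hD f L
    · exact ih (hf.pd _)

theorem snorm_zero_fun (hD : MeasurableSet D) (n : ℕ) : snorm D n (0 : SpaceTime → F) t = 0 := by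
  have := snorm_clm_le (t := t) hD (f := (0 : SpaceTime → F)) contDiff_const (0 : F →L[ℝ] F) n
  change snorm D n (fun _ => (0 : F)) t = 0
  simpa using this

theorem snorm_sum_le (hD : MeasurableSet D) {ι : Type*} {s : Finset ι} {f : ι → SpaceTime → F}
    (hf : ∀ i ∈ s, Smooth (f i)) (n : ℕ) :
    snorm D n (∑ i ∈ s, f i) t ≤ ∑ i ∈ s, snorm D n (f i) t := by
  classical
  induction s using Finset.induction_on with
  | empty => simp [snorm_zero_fun hD]
  | insert i s hi ih =>
    rw [Finset.sum_insert hi, Finset.sum_insert hi]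
    refine (snorm_add_le (hf i (by simp)) (Smooth.sum fun j hj => hf j (by simp [hj])) n).trans ?_
    gcongr
    exact ih fun j hj => hf j (by simp [hj])

theorem snorm_sub_le (hD : MeasurableSet D) {f g : SpaceTime → F} (hf : Smooth f) (hg : Smooth g)
    (n : ℕ) : snorm D n (f - g) t ≤ snorm D n f t + snorm D n g t := by
  rw [sub_eq_add_neg]
  refine (snorm_add_le hf hg.neg n).trans ?_
  gcongr
  have := snorm_clm_le (t := t) hD hg (-ContinuousLinearMap.id ℝ F) n
  rw [nnnorm_neg] at this
  refine this.trans (mul_le_of_le_one_left zero_le ?_)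
  exact_mod_cast ContinuousLinearMap.norm_id_le

theorem snorm_coef_le {b : SpaceTime → ℝ} (hb : IsCoef b) (hD : MeasurableSet D) (n : ℕ) :
    Dom (fun f : SpaceTime → F => Smooth f) (fun f => snorm D n (b • f))
      (fun f => snorm D n f) := by
  induction n generalizing b with
  | zero => exact Dom.of_eq_zero fun f t => by simp
  | succ n ih =>
    refine Dom.add (((l2Norm_coef_le hb hD).mono fun _ _ => trivial).trans_le
      fun f _ t _ => l2Norm_le_snorm n f) (Dom.sum fun k _ => ?_)
    refine Dom.le_trans (Ψ := fun f t => snorm D n (pd k.succ b • f) t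
        + snorm D n (b • pd k.succ f) t) (fun f hf t _ => ?_) (Dom.add ?_ ?_)
    · rw [pd_smul hb.smooth hf]
      exact snorm_add_le ((hb.pd _).smul hf) (hb.smul (hf.pd _)) _
    · exact (ih (hb.pd _)).trans_le fun f _ t _ => snorm_mono (by omega) f
    · exact ((ih hb).comp (fun f => pd k.succ f) fun f hf => hf.pd _).trans_le
          fun f _ t _ => snorm_pd_le _ _ f

theorem snorm_vf_le (hD : MeasurableSet D) {z : Fin 3 → SpaceTime → ℝ} (hz : ∀ l, IsCoef (z l))
    (n : ℕ) : Dom (fun f : SpaceTime → F => Smooth f) (fun f => snorm D n (vf z f))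
      (fun f t => ∑ k : Fin 3, snorm D n (pd k.succ f) t) := by
  refine Dom.le_trans (Ψ := fun f t => ∑ l : Fin 3, snorm D n (z l • pd l.succ f) t)
    (fun f hf t _ => snorm_sum_le hD (fun l _ => (hz l).smul (hf.pd _)) n) (Dom.sum fun l _ => ?_)
  exact ((snorm_coef_le (hz l) hD n).comp (fun f => pd l.succ f) fun f hf => hf.pd _).sum_right
    (Ψ := fun k f t => snorm D n (pd (Fin.succ k) f) t) (Finset.mem_univ l)

theorem wnorm_vf_le (hD : MeasurableSet D) {z : Fin 3 → SpaceTime → ℝ} (hz : ∀ l, IsCoef (z l))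
    (a n : ℕ) : Dom (fun f : SpaceTime → F => Smooth f) (fun f => wnorm D a n (vf z f))
      (fun f t => ∑ k : Fin 3, wnorm D a n (pd k.succ f) t) := by
  refine Dom.le_trans (Ψ := fun f t => ∑ l : Fin 3, wnorm D a n (z l • pd l.succ f) t)
    (fun f hf t _ => wnorm_sum_le hD (fun l _ => (hz l).smul (hf.pd _)) a n)
    (Dom.sum fun l _ => ?_)
  exact ((wnorm_coef_le (hz l) hD a n).comp (fun f => pd l.succ f) fun f hf => hf.pd _).sum_right
    (Ψ := fun k f t => wnorm D a n (pd (Fin.succ k) f) t) (Finset.mem_univ l)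

variable {K : Set E3} {c₁ c₂ : ℝ}

/-- The first order derivatives of `vf z f`, in terms of the derivatives of `f`. -/
theorem snorm_pd_vf_le (hD : MeasurableSet D) {z : Fin 3 → SpaceTime → ℝ}
    (hz : ∀ l, IsCoef (z l)) (n : ℕ) (m : Fin 3) :
    Dom (fun f : SpaceTime → F => Smooth f) (fun f => snorm D n (pd m.succ (vf z f)))
      (fun f t => ∑ k : Fin 3, snorm D (n + 1) (pd k.succ f) t) := by
  refine Dom.le_trans (Ψ := fun f t => snorm D (n + 1) (vf z f) t)
    (fun f _ t _ => snorm_pd_le n m _) ?_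
  exact snorm_vf_le hD hz (n + 1)

theorem snorm_lameComm_le (hD : MeasurableSet D) {z : Fin 3 → SpaceTime → ℝ}
    (hz : ∀ l, IsCoef (z l)) (n : ℕ) :
    Dom (fun f : SpaceTime → E3 => Smooth f) (fun f => snorm D n (lameComm c₁ c₂ z f))
      (fun f t => ∑ k : Fin 3, snorm D (n + 1) (pd k.succ f) t) := by
  have key : ∀ (b : SpaceTime → ℝ) (_ : IsCoef b) (M : E3 →L[ℝ] E3)
      (Y : (SpaceTime → E3) → SpaceTime → E3) (_ : ∀ f, Smooth f → Smooth (Y f))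
      (_ : Dom (fun f : SpaceTime → E3 => Smooth f) (fun f => snorm D n (Y f))
        (fun f t => ∑ k : Fin 3, snorm D (n + 1) (pd k.succ f) t)),
      Dom (fun f : SpaceTime → E3 => Smooth f) (fun f => snorm D n fun p => M ((b • Y f) p))
        (fun f t => ∑ k : Fin 3, snorm D (n + 1) (pd k.succ f) t) := by
    intro b hb M Y hY h
    refine Dom.le_trans (Ψ := fun f t => ‖M‖₊ * snorm D n (b • Y f) t)
      (fun f hf t _ => snorm_clm_le hD (hb.smul (hY f hf)) M n) (Dom.const_mul _ ?_)
    exact ((snorm_coef_le hb hD n).comp Y hY).trans h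
  have h2 : ∀ i l : Fin 3, Dom (fun f : SpaceTime → E3 => Smooth f)
      (fun f => snorm D n (pd l.succ (pd i.succ f)))
        (fun f t => ∑ k : Fin 3, snorm D (n + 1) (pd k.succ f) t) := fun i l =>
    Dom.sum_right (Ψ := fun k f t => snorm D (n + 1) (pd (Fin.succ k) f) t) (Finset.mem_univ i)
      (Dom.of_le fun f _ t _ => snorm_pd_le n l (pd i.succ f))
  have h1 : ∀ l : Fin 3, Dom (fun f : SpaceTime → E3 => Smooth f)
      (fun f => snorm D n (pd l.succ f))
        (fun f t => ∑ k : Fin 3, snorm D (n + 1) (pd k.succ f) t) := fun l =>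
    Dom.sum_right (Ψ := fun k f t => snorm D (n + 1) (pd (Fin.succ k) f) t) (Finset.mem_univ l)
      (Dom.of_le fun f _ t _ => snorm_mono (by omega) (pd l.succ f))
  have s2 : ∀ i l : Fin 3, ∀ f : SpaceTime → E3, Smooth f → Smooth (pd l.succ (pd i.succ f)) :=
    fun i l f hf => (hf.pd _).pd _
  have s1 : ∀ l : Fin 3, ∀ f : SpaceTime → E3, Smooth f → Smooth (pd l.succ f) :=
    fun l f hf => hf.pd _
  have sm : ∀ (b : SpaceTime → ℝ) (_ : IsCoef b) (M : E3 →L[ℝ] E3) (f : SpaceTime → E3),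
      Smooth f → Smooth fun p => M ((b • f) p) := fun b hb M f hf => (hb.smul hf).clm M
  refine Dom.le_trans (Ψ := fun f t => ∑ i : Fin 3, ∑ j : Fin 3, ∑ l : Fin 3,
    (snorm D n (fun p => lameM c₁ c₂ i j ((pd j.succ (z l) • pd l.succ (pd i.succ f)) p)) t
      + (snorm D n (fun p => lameM c₁ c₂ i j ((pd i.succ (z l) • pd l.succ (pd j.succ f)) p)) t
      + snorm D n (fun p => lameM c₁ c₂ i j ((pd i.succ (pd j.succ (z l)) • pd l.succ f) p)) t)))
    (fun f hf t _ => ?_) (Dom.sum fun i _ => Dom.sum fun j _ => Dom.sum fun l _ =>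
      Dom.add (key _ ((hz l).pd _) _ _ (s2 i l) (h2 i l))
        (Dom.add (key _ ((hz l).pd _) _ _ (s2 j l) (h2 j l))
          (key _ (((hz l).pd _).pd _) _ _ (s1 l) (h1 l))))
  have e1 : ∀ i j l : Fin 3, Smooth fun p =>
      lameM c₁ c₂ i j ((pd j.succ (z l) • pd l.succ (pd i.succ f)) p) := fun i j l =>
    sm _ ((hz l).pd _) _ _ (s2 i l f hf)
  have e2 : ∀ i j l : Fin 3, Smooth fun p =>
      lameM c₁ c₂ i j ((pd i.succ (z l) • pd l.succ (pd j.succ f)) p) := fun i j l =>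
    sm _ ((hz l).pd _) _ _ (s2 j l f hf)
  have e3 : ∀ i j l : Fin 3, Smooth fun p =>
      lameM c₁ c₂ i j ((pd i.succ (pd j.succ (z l)) • pd l.succ f) p) := fun i j l =>
    sm _ (((hz l).pd _).pd _) _ _ (s1 l f hf)
  have e := fun i j l => (e1 i j l).plus ((e2 i j l).plus (e3 i j l))
  refine (snorm_sum_le hD (fun i _ => Smooth.sum fun j _ => Smooth.sum fun l _ => e i j l) n).trans
    (Finset.sum_le_sum fun i _ => ?_)
  refine (snorm_sum_le hD (fun j _ => Smooth.sum fun l _ => e i j l) n).trans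
    (Finset.sum_le_sum fun j _ => ?_)
  refine (snorm_sum_le hD (fun l _ => e i j l) n).trans (Finset.sum_le_sum fun l _ => ?_)
  refine (snorm_add_le (e1 i j l) ((e2 i j l).plus (e3 i j l)) n).trans (add_le_add le_rfl ?_)
  exact snorm_add_le (e2 i j l) (e3 i j l) n

theorem tangential_estimate_l2 (hK : IsSmoothObstacle K) (hc₂ : 0 < c₂ ^ 2)
    (h12 : c₂ ^ 2 ≤ c₁ ^ 2) {z : Fin 3 → SpaceTime → ℝ} (hz : IsTangential K z) (m : Fin 3) :
    Dom (fun w : SpaceTime → E3 => Adm K w) (fun w => l2Norm Kᶜ (pd m.succ (vf z w)))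
      (fun w t => l2Norm Kᶜ (lame c₁ c₂ w) t + ∑ k : Fin 3, l2Norm Kᶜ (pd k.succ w) t) := by
  obtain ⟨C, hC⟩ := tangential_estimate hK hc₂ h12 hz
  refine ⟨C, fun w hw t ht => ?_⟩
  have hw : Adm K w := hw
  have hd := fun k : Fin 3 => hw.toTame.pd hK k.succ
  beta_reduce
  rw [((hz.adm hK hw).toTame.pd hK _).l2Norm_eq hK ht, (hw.toTame.lame hK).l2Norm_eq hK ht,
    Finset.sum_congr rfl fun k _ => (hd k).l2Norm_eq hK ht,
    ← ENNReal.ofReal_sum_of_nonneg fun k _ => nrm_nonneg _,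
    ← ENNReal.ofReal_add (nrm_nonneg _) (Finset.sum_nonneg fun k _ => nrm_nonneg _),
    ← ENNReal.ofReal_coe_nnreal, ← ENNReal.ofReal_mul C.coe_nonneg]
  refine ENNReal.ofReal_le_ofReal (le_trans ?_ (hC w hw t ht))
  exact Finset.single_le_sum (f := fun k : Fin 3 => nrm K (pd k.succ (vf z w)) t)
    (fun k _ => nrm_nonneg _) (Finset.mem_univ m)

/-- The `snorm` version of the right hand side in `FrameOn`. -/
def frameRhs (c₁ c₂ : ℝ) (K : Set E3) (𝒵 : Finset (Fin 3 → SpaceTime → ℝ)) (n : ℕ)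
    (f : SpaceTime → E3) (t : ℝ) : ℝ≥0∞ :=
  snorm Kᶜ n (lame c₁ c₂ f) t + ∑ z ∈ 𝒵, ∑ m : Fin 3, snorm Kᶜ n (pd m.succ (vf z f)) t
    + ∑ m : Fin 3, snorm Kᶜ n (pd m.succ f) t

theorem l2Norm_frame (hK : IsSmoothObstacle K) {𝒵 : Finset (Fin 3 → SpaceTime → ℝ)}
    (hZ : ∀ z ∈ 𝒵, IsTangential K z) {C : ℝ≥0} {f g : SpaceTime → E3} (hf : Smooth f)
    (h : ∀ x ∈ Kᶜ, ‖g (t, x)‖ ≤ C * (‖lame c₁ c₂ f (t, x)‖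
        + ∑ z ∈ 𝒵, ∑ m : Fin 3, ‖pd m.succ (vf z f) (t, x)‖
        + ∑ m : Fin 3, ‖pd m.succ f (t, x)‖)) :
    l2Norm Kᶜ g t ≤ C * frameRhs c₁ c₂ K 𝒵 1 f t := by
  have h1 := l2Norm_le_sum (D := Kᶜ) (t := t) (f := g) (C := C)
    (s := (Finset.univ : Finset ((Unit ⊕ (𝒵 × Fin 3)) ⊕ Fin 3)))
    (g := Sum.elim (Sum.elim (fun _ => lame c₁ c₂ f) fun zm => pd zm.2.succ (vf zm.1.1 f))
      fun m => pd m.succ f) hK.measurableSet_compl ?_ ?_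
  · refine h1.trans (le_of_eq ?_)
    simp only [Fintype.sum_sum_type, Sum.elim_inl, Sum.elim_inr, Fintype.sum_prod_type,
      frameRhs, snorm_succ, snorm_zero, Finset.sum_const_zero, add_zero, Finset.univ_unique,
      Finset.sum_singleton]
    rw [Finset.sum_coe_sort 𝒵 (fun z => ∑ m : Fin 3, l2Norm Kᶜ (pd m.succ (vf z f)) t)]
  · rintro ((_ | zm) | m) -
    · exact hf.lame
    · exact (vf_smooth (hZ zm.1.1 zm.1.2).coef hf).pd _
    · exact hf.pd _
  · intro x hx
    refine (h x hx).trans (le_of_eq ?_)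
    simp only [Fintype.sum_sum_type, Sum.elim_inl, Sum.elim_inr, Fintype.sum_prod_type,
      Finset.univ_unique, Finset.sum_singleton]
    rw [Finset.sum_coe_sort 𝒵 (fun z => ∑ m : Fin 3, ‖pd m.succ (vf z f) (t, x)‖)]

/-- `∂_l` commutes with `A`, and its commutator with a tangential field is the field with
differentiated coefficients. That error costs no more derivatives of `f` than the last sum of the
right side at level `n + 1` contains. -/
theorem frameRhs_pd_le (hK : IsSmoothObstacle K) {𝒵 : Finset (Fin 3 → SpaceTime → ℝ)}
    (hZ : ∀ z ∈ 𝒵, IsTangential K z) (n : ℕ) (l : Fin 3) :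
    Dom (fun f : SpaceTime → E3 => Smooth f) (fun f => frameRhs c₁ c₂ K 𝒵 n (pd l.succ f))
      (frameRhs c₁ c₂ K 𝒵 (n + 1)) := by
  have hD := hK.measurableSet_compl
  have hR1 : ∀ m : Fin 3, Dom (fun f : SpaceTime → E3 => Smooth f)
      (fun f => snorm Kᶜ (n + 1) (pd m.succ f)) (frameRhs c₁ c₂ K 𝒵 (n + 1)) := fun m =>
    (Dom.sum_right (Ψ := fun m f t => snorm Kᶜ (n + 1) (pd (Fin.succ m) f) t) (Finset.mem_univ m)
      Dom.refl).add_left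
  refine (Dom.add ?_ (Dom.sum fun z hz => Dom.sum fun m _ => ?_)).add (Dom.sum fun m _ => ?_)
  · refine Dom.of_le fun f hf t _ => ?_
    rw [← pd_lame hf]
    exact (snorm_pd_le _ _ _).trans (le_add_right le_self_add)
  · refine Dom.le_trans (Ψ := fun f t => snorm Kᶜ n (pd m.succ (pd l.succ (vf z f))) t
      + snorm Kᶜ n (pd m.succ (vf (fun k => pd l.succ (z k)) f)) t) (fun f hf t _ => ?_)
      (Dom.add ?_ ?_)
    · have hzc := (hZ z hz).coef
      have h : vf z (pd l.succ f) = pd l.succ (vf z f) - vf (fun k => pd l.succ (z k)) f := by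
        rw [pd_vf hzc hf]; simp
      have s1 := (vf_smooth hzc hf).pd l.succ
      have s2 := vf_smooth (fun k => (hzc k).pd l.succ) hf
      rw [h, pd_sub s1 s2]
      exact snorm_sub_le hD (s1.pd _) (s2.pd _) n
    · refine Dom.of_le fun f hf t _ => ?_
      rw [pd_comm (vf_smooth (hZ z hz).coef hf)]
      refine (snorm_pd_le _ _ _).trans (le_add_right (le_add_left ?_))
      refine le_trans ?_ (single_le_sum_ennreal
        (g := fun z => ∑ m : Fin 3, snorm Kᶜ (n + 1) (pd m.succ (vf z f)) t) hz)
      exact single_le_sum_ennreal (g := fun m : Fin 3 => snorm Kᶜ (n + 1) (pd m.succ (vf z f)) t)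
        (Finset.mem_univ m)
    · exact (snorm_pd_vf_le hD (fun k => ((hZ z hz).coef k).pd _) n m).trans
        (Dom.sum fun k _ => hR1 k)
  · refine Dom.le_trans (fun f hf t _ => ?_) (hR1 m)
    rw [pd_comm hf]
    exact snorm_pd_le _ _ _

theorem snorm_frame (hK : IsSmoothObstacle K) {𝒵 : Finset (Fin 3 → SpaceTime → ℝ)}
    (hZ : ∀ z ∈ 𝒵, IsTangential K z) {C : ℝ≥0} (h : ∀ f : SpaceTime → E3, Smooth f → ∀ t,
      ∀ x ∈ Set.univ ∩ Kᶜ, ∀ i k : Fin 3, ‖pd i.succ (pd k.succ f) (t, x)‖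
        ≤ C * (‖lame c₁ c₂ f (t, x)‖ + ∑ z ∈ 𝒵, ∑ m : Fin 3, ‖pd m.succ (vf z f) (t, x)‖
        + ∑ m : Fin 3, ‖pd m.succ f (t, x)‖)) (n : ℕ) (i k : Fin 3) :
    Dom (fun f : SpaceTime → E3 => Smooth f) (fun f => snorm Kᶜ n (pd i.succ (pd k.succ f)))
      (frameRhs c₁ c₂ K 𝒵 n) := by
  induction n with
  | zero => exact Dom.of_eq_zero fun f t => by simp
  | succ n ih =>
    refine Dom.add ?_ (Dom.sum fun l _ => ?_)
    · refine Dom.trans_le (Ψ := frameRhs c₁ c₂ K 𝒵 1) ⟨C, fun f hf t _ => l2Norm_frame hK hZ hf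
        fun x hx => h f hf t x ⟨trivial, hx⟩ i k⟩ fun f _ t _ => ?_
      unfold frameRhs
      exact add_le_add (add_le_add (snorm_mono (by omega) _) (Finset.sum_le_sum fun z _ =>
        Finset.sum_le_sum fun m _ => snorm_mono (by omega) _))
        (Finset.sum_le_sum fun m _ => snorm_mono (by omega) _)
    · refine Dom.le_trans (Ψ := fun f t => snorm Kᶜ n (pd i.succ (pd k.succ (pd l.succ f))) t)
        (fun f hf t _ => ?_) ?_
      · rw [pd_comm (hf.pd _) l.succ, pd_comm hf l.succ]
      · exact (ih.comp (fun f => pd l.succ f) fun f hf => hf.pd _).trans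
          (frameRhs_pd_le hK hZ n l)

/-- Elliptic regularity for the Dirichlet problem. -/
theorem elliptic_estimate (hK : IsSmoothObstacle K) {η : E3 → ℝ} (hη : IsCutoff K η)
    (hc₂ : 0 < c₂ ^ 2) (h12 : c₂ ^ 2 ≤ c₁ ^ 2) (n : ℕ) (i k : Fin 3) :
    Dom (fun v : SpaceTime → E3 => Adm K v) (fun v => snorm Kᶜ n (pd i.succ (pd k.succ v)))
      (fun v t => snorm Kᶜ n (lame c₁ c₂ v) t + ∑ m : Fin 3, snorm Kᶜ n (pd m.succ v) t) := by
  have hD := hK.measurableSet_compl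
  obtain ⟨𝒵, hZ, C, hC⟩ := frameOn_univ (c₁ := c₁) hK hη hc₂ h12
  induction n generalizing i k with
  | zero => exact Dom.of_eq_zero fun f t => by simp
  | succ n ih =>
    have hR1 : ∀ m : Fin 3, Dom (fun v : SpaceTime → E3 => Adm K v)
        (fun v => snorm Kᶜ (n + 1) (pd m.succ v)) (fun v t => snorm Kᶜ (n + 1) (lame c₁ c₂ v) t
          + ∑ m : Fin 3, snorm Kᶜ (n + 1) (pd m.succ v) t) := fun m =>
      (Dom.sum_right (Ψ := fun m f t => snorm Kᶜ (n + 1) (pd (Fin.succ m) f) t)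
        (Finset.mem_univ m) Dom.refl).add_left
    -- The frame replaces arbitrary second derivatives by `∂_m Z v`, apart from terms already
    -- present in the conclusion.
    refine ((snorm_frame hK hZ hC (n + 1) i k).mono fun v hv => hv.smooth).trans ?_
    refine (Dom.add (Dom.refl.add_right) (Dom.sum fun z hz => Dom.sum fun m _ => ?_)).add
      Dom.refl.add_left
    have hzc := (hZ z hz).coef
    refine Dom.add ?_ (Dom.sum fun l _ => ?_)
    · refine (tangential_estimate_l2 (c₁ := c₁) hK hc₂ h12 (hZ z hz) m).trans_le
        fun v _ t _ => ?_
      gcongr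
      · exact l2Norm_le_snorm n _
      · exact l2Norm_le_snorm n _
    -- For the derivatives of `∂_m Z v` the induction hypothesis is applied to `Zv`, which again
    -- vanishes on the boundary. Its right side involves `A Z v = Z A v + [A, Z] v`, that is, one
    -- more derivative of `A v` and lower order terms.
    · refine ((ih l m).comp (vf z) fun v hv => (hZ z hz).adm hK hv).trans
        (Dom.add ?_ (Dom.sum fun m' _ => ?_))
      · refine Dom.le_trans (Ψ := fun v t => snorm Kᶜ n (vf z (lame c₁ c₂ v)) t
          + snorm Kᶜ n (lameComm c₁ c₂ z v) t) (fun v hv t _ => ?_) (Dom.add ?_ ?_)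
        · rw [lame_vf hzc hv.smooth]
          refine snorm_add_le (vf_smooth hzc hv.smooth.lame) ?_ n
          have : lameComm c₁ c₂ z v = lame c₁ c₂ (vf z v) - vf z (lame c₁ c₂ v) := by
            rw [lame_vf hzc hv.smooth]; simp
          rw [this]
          exact (vf_smooth hzc hv.smooth).lame.minus (vf_smooth hzc hv.smooth.lame)
        · refine ((snorm_vf_le hD hzc n).comp (lame c₁ c₂) fun v hv =>
            (Adm.toTame hv).smooth.lame).trans (Dom.sum fun j _ => ?_)
          exact Dom.of_le fun v _ t _ => (snorm_pd_le _ _ _).trans le_self_add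
        · exact ((snorm_lameComm_le hD hzc n).mono fun v hv => (Adm.toTame hv).smooth).trans
            (Dom.sum fun j _ => hR1 j)
      · exact ((snorm_pd_vf_le hD hzc n m').mono fun v hv => (Adm.toTame hv).smooth).trans
          (Dom.sum fun j _ => hR1 j)

end Elliptic

end

end ExteriorElastic

namespace ExteriorElastic

noncomputable section

/-! ### Estimates by time derivatives and the modified scaling operator -/

section Operators

variable {K : Set E3} {η : E3 → ℝ} {c₁ c₂ : ℝ}

theorem Smooth.elastic {f : SpaceTime → E3} (hf : Smooth f) : Smooth (elastic c₁ c₂ f) := by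
  rw [elastic_eq hf]
  exact ((hf.pd _).pd _).minus hf.lame

theorem lameComm_smooth {z : Fin 3 → SpaceTime → ℝ} (hz : ∀ l, IsCoef (z l)) {f : SpaceTime → E3}
    (hf : Smooth f) : Smooth (lameComm c₁ c₂ z f) := by
  have : lameComm c₁ c₂ z f = lame c₁ c₂ (vf z f) - vf z (lame c₁ c₂ f) := by
    rw [lame_vf hz hf]; simp
  rw [this]
  exact (vf_smooth hz hf).lame.minus (vf_smooth hz hf.lame)

theorem lame_sub {f g : SpaceTime → E3} (hf : Smooth f) (hg : Smooth g) :
    lame c₁ c₂ (f - g) = lame c₁ c₂ f - lame c₁ c₂ g := by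
  have h := lame_add (c₁ := c₁) (c₂ := c₂) hf (hg.csmul (-1))
  rw [lame_const_smul hg] at h
  simpa [sub_eq_add_neg] using h

theorem elastic_sub {f g : SpaceTime → E3} (hf : Smooth f) (hg : Smooth g) :
    elastic c₁ c₂ (f - g) = elastic c₁ c₂ f - elastic c₁ c₂ g := by
  rw [elastic_eq (hf.minus hg), elastic_eq hf, elastic_eq hg, pd_sub hf hg,
    pd_sub (hf.pd _) (hg.pd _), lame_sub hf hg]
  abel

theorem pd_elastic {f : SpaceTime → E3} (hf : Smooth f) (β : Fin 4) :
    pd β (elastic c₁ c₂ f) = elastic c₁ c₂ (pd β f) := by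
  rw [elastic_eq hf, elastic_eq (hf.pd _), pd_sub ((hf.pd _).pd _) hf.lame, pd_lame hf,
    pd_comm (hf.pd 0) β 0, pd_comm hf β 0]

theorem pd_iterate_elastic {f : SpaceTime → E3} (hf : Smooth f) (β : Fin 4) (j : ℕ) :
    (pd β)^[j] (elastic c₁ c₂ f) = elastic c₁ c₂ ((pd β)^[j] f) := by
  induction j with
  | zero => rfl
  | succ j ih =>
    rw [Function.iterate_succ_apply', Function.iterate_succ_apply', ih,
      pd_elastic (pd_iterate_smooth hf _ _)]

/-- `L` is homogeneous of order two under space-time dilations, and each of its two derivatives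
contributes one copy of itself. -/
theorem elastic_scal {f : SpaceTime → E3} (hf : Smooth f) :
    elastic c₁ c₂ (scal f) = scal (elastic c₁ c₂ f) + (2 : ℝ) • elastic c₁ c₂ f := by
  rw [elastic_eq hf.scal, elastic_eq hf, lame_scal hf, pd_scal hf, pd_add (hf.pd _).scal (hf.pd _),
    pd_scal (hf.pd _), scal_sub ((hf.pd _).pd _) hf.lame]
  module

/-- The coefficients are independent of time, so `∂_t²` commutes with the field; only `-A`
contributes to the commutator, hence the minus sign. -/
theorem elastic_vf {z : Fin 3 → SpaceTime → ℝ} (hz : ∀ l, IsCoef (z l)) {f : SpaceTime → E3}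
    (hf : Smooth f) :
    elastic c₁ c₂ (vf z f) = vf z (elastic c₁ c₂ f) - lameComm c₁ c₂ z f := by
  have h0 : ∀ g : SpaceTime → E3, vf (fun l => pd 0 (z l)) g = 0 := fun g => by
    simp [vf, (hz _).pd_zero]
  have h1 : vf z (pd 0 (pd 0 f) - lame c₁ c₂ f) = vf z (pd 0 (pd 0 f)) - vf z (lame c₁ c₂ f) := by
    simp only [vf, pd_sub ((hf.pd 0).pd 0) hf.lame, smul_sub, Finset.sum_sub_distrib]
  rw [elastic_eq (vf_smooth hz hf), elastic_eq hf, lame_vf hz hf, pd_vf hz hf, h0, add_zero,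
    pd_vf hz (hf.pd _), h0, add_zero, h1]
  abel

theorem scalMod_eq_vf (η : E3 → ℝ) {F : Type*} [NormedAddCommGroup F] [NormedSpace ℝ F]
    (f : SpaceTime → F) : scalMod η f = scal f - vf (defect η) f := scalMod_eq η f

theorem elastic_scalMod (hη : IsCutoff K η) {f : SpaceTime → E3} (hf : Smooth f) :
    elastic c₁ c₂ (scalMod η f) = scalMod η (elastic c₁ c₂ f)
      + ((2 : ℝ) • elastic c₁ c₂ f + lameComm c₁ c₂ (defect η) f) := by
  rw [scalMod_eq_vf, scalMod_eq_vf, elastic_sub hf.scal (vf_smooth hη.isCoef_defect hf),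
    elastic_scal hf, elastic_vf hη.isCoef_defect hf]
  abel

variable {F : Type*} [NormedAddCommGroup F] [NormedSpace ℝ F]

theorem pd_zero_iterate_scalMod (hη : IsCutoff K η) {f : SpaceTime → F} (hf : Smooth f) (n : ℕ) :
    (pd 0)^[n] (scalMod η f) = scalMod η ((pd 0)^[n] f) + (n : ℝ) • (pd 0)^[n] f := by
  induction n with
  | zero => simp
  | succ n ih =>
    have h := pd_iterate_smooth hf 0 n
    rw [Function.iterate_succ_apply', Function.iterate_succ_apply', ih,
      pd_add (h.scalMod hη) (h.csmul _), pd_zero_scalMod hη h, pd_const_smul h]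
    push_cast
    module

theorem scalMod_iterate_add (hη : IsCutoff K η) {f g : SpaceTime → F} (hf : Smooth f)
    (hg : Smooth g) (n : ℕ) :
    (scalMod η)^[n] (f + g) = (scalMod η)^[n] f + (scalMod η)^[n] g := by
  induction n with
  | zero => rfl
  | succ n ih =>
    simp only [Function.iterate_succ_apply', ih]
    rw [scalMod_add (scalMod_iterate_smooth hη hf _) (scalMod_iterate_smooth hη hg _)]

theorem scalMod_iterate_const_smul (hη : IsCutoff K η) {f : SpaceTime → F} (hf : Smooth f) (c : ℝ)
    (n : ℕ) : (scalMod η)^[n] (c • f) = c • (scalMod η)^[n] f := by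
  induction n with
  | zero => rfl
  | succ n ih =>
    simp only [Function.iterate_succ_apply', ih]
    rw [scalMod_const_smul (scalMod_iterate_smooth hη hf _)]

end Operators

/-! ### Weighted norms of first derivatives and the reduction to `∂_t` and `S̃`. -/

section Norms

variable {F : Type*} [NormedAddCommGroup F] [NormedSpace ℝ F]
variable {D K : Set E3} {η : E3 → ℝ} {c₁ c₂ t : ℝ}

/-- The sum of the `wnorm`s of the first order derivatives. -/
def gnorm (D : Set E3) (a n : ℕ) (f : SpaceTime → F) (t : ℝ) : ℝ≥0∞ :=
  ∑ β : Fin 4, wnorm D a n (pd β f) t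

theorem wnorm_pd_le_gnorm (a n : ℕ) (β : Fin 4) (f : SpaceTime → F) :
    wnorm D a n (pd β f) t ≤ gnorm D a n f t :=
  single_le_sum_ennreal (g := fun β : Fin 4 => wnorm D a n (pd β f) t) (Finset.mem_univ β)

theorem gnorm_mono {a a' n n' : ℕ} (ha : a ≤ a') (hn : n ≤ n') (f : SpaceTime → F) :
    gnorm D a n f t ≤ gnorm D a' n' f t :=
  Finset.sum_le_sum fun _ _ => wnorm_mono ha hn _

theorem gnorm_pd_le (a n : ℕ) (β : Fin 4) {f : SpaceTime → F} (hf : Smooth f) :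
    gnorm D a n (pd β f) t ≤ gnorm D a (n + 1) f t := by
  refine Finset.sum_le_sum fun β' _ => ?_
  rw [pd_comm hf]
  exact wnorm_pd_le _ _ _ _

theorem gnorm_pd_iterate_le (a n j : ℕ) (β : Fin 4) {f : SpaceTime → F} (hf : Smooth f) :
    gnorm D a n ((pd β)^[j] f) t ≤ gnorm D a (n + j) f t := by
  induction j generalizing n with
  | zero => exact le_rfl
  | succ j ih =>
    rw [Function.iterate_succ_apply']
    refine (gnorm_pd_le _ _ _ (pd_iterate_smooth hf _ _)).trans ((ih (n + 1)).trans ?_)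
    exact gnorm_mono le_rfl (by omega) f

theorem wnorm_vf_le_gnorm (hD : MeasurableSet D) {z : Fin 3 → SpaceTime → ℝ}
    (hz : ∀ l, IsCoef (z l)) (a n : ℕ) :
    Dom (fun f : SpaceTime → F => Smooth f) (fun f => wnorm D a n (vf z f)) (gnorm D a n) :=
  (wnorm_vf_le hD hz a n).trans
    (Dom.sum fun k _ => Dom.of_le fun f _ _ _ => wnorm_pd_le_gnorm a n k.succ f)

theorem gnorm_vf_le (hD : MeasurableSet D) {z : Fin 3 → SpaceTime → ℝ} (hz : ∀ l, IsCoef (z l))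
    (a n : ℕ) :
    Dom (fun f : SpaceTime → F => Smooth f) (fun f => gnorm D a n (vf z f)) (gnorm D a (n + 1)) :=
  Dom.sum fun β _ => Dom.le_trans (fun f _ _ _ => wnorm_pd_le a n β (vf z f))
    (wnorm_vf_le_gnorm hD hz a (n + 1))

theorem gnorm_scalMod_le (hη : IsCutoff K η) (hD : MeasurableSet D) (a n : ℕ) :
    Dom (fun f : SpaceTime → F => Smooth f) (fun f => gnorm D a n (scalMod η f))
      (gnorm D (a + 1) (n + 1)) := by
  refine Dom.sum fun β _ => ?_
  have hz := fun l => (hη.isCoef_defect l).pd β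
  refine Dom.le_trans (Ψ := fun f t => wnorm D a n (scalMod η (pd β f)) t
    + wnorm D a n (pd β f) t + wnorm D a n (vf (fun l => pd β (defect η l)) f) t)
    (fun f hf t _ => ?_) (Dom.add (Dom.add ?_ ?_) ?_)
  · rw [pd_scalMod hη hf]
    have h1 := ((hf.pd β).scalMod hη)
    refine (wnorm_sub_le hD (h1.plus (hf.pd β)) (vf_smooth hz hf) a n).trans ?_
    exact add_le_add (wnorm_add_le h1 (hf.pd β) a n) le_rfl
  · exact ((wnorm_scalMod_le hη hD a n).comp (fun f => pd β f) fun f hf => hf.pd _).trans_le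
      fun f _ t _ => wnorm_pd_le_gnorm _ _ β f
  · exact Dom.of_le fun f _ t _ => (wnorm_pd_le_gnorm _ _ β f).trans
      (gnorm_mono (by omega) (by omega) f)
  · exact (wnorm_vf_le_gnorm hD hz a n).trans_le fun f _ t _ =>
      gnorm_mono (by omega) (by omega) f

theorem wnorm_pd_pd_le_gnorm (a n : ℕ) (α β : Fin 4) (f : SpaceTime → F) :
    wnorm D a n (pd α (pd β f)) t ≤ gnorm D a (n + 1) f t :=
  (wnorm_pd_le a n α _).trans (wnorm_pd_le_gnorm a (n + 1) β f)

theorem wnorm_lame_le (hD : MeasurableSet D) (a n : ℕ) :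
    Dom (fun f : SpaceTime → E3 => Smooth f) (fun f => wnorm D a n (lame c₁ c₂ f))
      (gnorm D a (n + 1)) := by
  refine Dom.le_trans (Ψ := fun f t => ∑ i : Fin 3, ∑ j : Fin 3,
    wnorm D a n (fun p => lameM c₁ c₂ i j (pd i.succ (pd j.succ f) p)) t) (fun f hf t _ => ?_)
    (Dom.sum fun i _ => Dom.sum fun j _ => ?_)
  · have h : ∀ i j : Fin 3, Smooth fun p => lameM c₁ c₂ i j (pd i.succ (pd j.succ f) p) :=
      fun i j => ((hf.pd _).pd _).clm _
    refine (wnorm_sum_le hD (fun i _ => Smooth.sum fun j _ => h i j) a n).trans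
      (Finset.sum_le_sum fun i _ => ?_)
    exact wnorm_sum_le hD (fun j _ => h i j) a n
  · refine Dom.le_trans (Ψ := fun f t => ‖lameM c₁ c₂ i j‖₊
      * wnorm D a n (pd i.succ (pd j.succ f)) t)
      (fun f hf t _ => wnorm_clm_le hD ((hf.pd _).pd _) _ a n) (Dom.const_mul _ ?_)
    exact Dom.of_le fun f _ t _ => wnorm_pd_pd_le_gnorm a n _ _ f

theorem wnorm_elastic_le (hD : MeasurableSet D) (a n : ℕ) :
    Dom (fun f : SpaceTime → E3 => Smooth f) (fun f => wnorm D a n (elastic c₁ c₂ f))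
      (gnorm D a (n + 1)) := by
  refine Dom.le_trans (Ψ := fun f t => wnorm D a n (pd 0 (pd 0 f)) t
    + wnorm D a n (lame c₁ c₂ f) t) (fun f hf t _ => ?_) (Dom.add ?_ (wnorm_lame_le hD a n))
  · rw [elastic_eq hf]
    exact wnorm_sub_le hD ((hf.pd _).pd _) hf.lame a n
  · exact Dom.of_le fun f _ t _ => wnorm_pd_pd_le_gnorm a n _ _ f

theorem wnorm_lameComm_le (hD : MeasurableSet D) {z : Fin 3 → SpaceTime → ℝ}
    (hz : ∀ l, IsCoef (z l)) (a n : ℕ) :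
    Dom (fun f : SpaceTime → E3 => Smooth f) (fun f => wnorm D a n (lameComm c₁ c₂ z f))
      (gnorm D a (n + 1)) := by
  have key : ∀ (b : SpaceTime → ℝ) (_ : IsCoef b) (M : E3 →L[ℝ] E3)
      (Y : (SpaceTime → E3) → SpaceTime → E3) (_ : ∀ f, Smooth f → Smooth (Y f))
      (_ : ∀ f t, wnorm D a n (Y f) t ≤ gnorm D a (n + 1) f t),
      Dom (fun f : SpaceTime → E3 => Smooth f) (fun f => wnorm D a n fun p => M ((b • Y f) p))
        (gnorm D a (n + 1)) := by
    intro b hb M Y hY h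
    refine Dom.le_trans (Ψ := fun f t => ‖M‖₊ * wnorm D a n (b • Y f) t)
      (fun f hf t _ => wnorm_clm_le hD (hb.smul (hY f hf)) M a n) (Dom.const_mul _ ?_)
    exact ((wnorm_coef_le hb hD a n).comp Y hY).trans_le fun f _ t _ => h f t
  have sm : ∀ (b : SpaceTime → ℝ) (_ : IsCoef b) (M : E3 →L[ℝ] E3) (f : SpaceTime → E3),
      Smooth f → Smooth fun p => M ((b • f) p) := fun b hb M f hf => (hb.smul hf).clm M
  refine Dom.le_trans (Ψ := fun f t => ∑ i : Fin 3, ∑ j : Fin 3, ∑ l : Fin 3,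
    (wnorm D a n (fun p => lameM c₁ c₂ i j ((pd j.succ (z l) • pd l.succ (pd i.succ f)) p)) t
      + (wnorm D a n (fun p => lameM c₁ c₂ i j ((pd i.succ (z l) • pd l.succ (pd j.succ f)) p)) t
      + wnorm D a n (fun p => lameM c₁ c₂ i j
          ((pd i.succ (pd j.succ (z l)) • pd l.succ f) p)) t)))
    (fun f hf t _ => ?_) (Dom.sum fun i _ => Dom.sum fun j _ => Dom.sum fun l _ =>
      Dom.add (key _ ((hz l).pd _) _ _ (fun f hf => (hf.pd _).pd _)
        fun f t => wnorm_pd_pd_le_gnorm a n _ _ f)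
        (Dom.add (key _ ((hz l).pd _) _ _ (fun f hf => (hf.pd _).pd _)
          fun f t => wnorm_pd_pd_le_gnorm a n _ _ f)
          (key _ (((hz l).pd _).pd _) _ _ (fun f hf => hf.pd _)
          fun f t => (wnorm_pd_le_gnorm a n l.succ f).trans (gnorm_mono le_rfl (by omega) f))))
  have e1 : ∀ i j l : Fin 3, Smooth fun p =>
      lameM c₁ c₂ i j ((pd j.succ (z l) • pd l.succ (pd i.succ f)) p) := fun i j l =>
    sm _ ((hz l).pd _) _ _ ((hf.pd _).pd _)
  have e2 : ∀ i j l : Fin 3, Smooth fun p =>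
      lameM c₁ c₂ i j ((pd i.succ (z l) • pd l.succ (pd j.succ f)) p) := fun i j l =>
    sm _ ((hz l).pd _) _ _ ((hf.pd _).pd _)
  have e3 : ∀ i j l : Fin 3, Smooth fun p =>
      lameM c₁ c₂ i j ((pd i.succ (pd j.succ (z l)) • pd l.succ f) p) := fun i j l =>
    sm _ (((hz l).pd _).pd _) _ _ (hf.pd _)
  have e := fun i j l => (e1 i j l).plus ((e2 i j l).plus (e3 i j l))
  refine (wnorm_sum_le hD (fun i _ => Smooth.sum fun j _ => Smooth.sum fun l _ => e i j l) a
    n).trans (Finset.sum_le_sum fun i _ => ?_)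
  refine (wnorm_sum_le hD (fun j _ => Smooth.sum fun l _ => e i j l) a n).trans
    (Finset.sum_le_sum fun j _ => ?_)
  refine (wnorm_sum_le hD (fun l _ => e i j l) a n).trans (Finset.sum_le_sum fun l _ => ?_)
  refine (wnorm_add_le (e1 i j l) ((e2 i j l).plus (e3 i j l)) a n).trans (add_le_add le_rfl ?_)
  exact wnorm_add_le (e2 i j l) (e3 i j l) a n

/-- All `S` and space-time derivatives are controlled by the spatial derivatives, and by terms
in which either a time derivative or `S` has been applied to the function. -/
theorem wnorm_split (hD : MeasurableSet D) (a n : ℕ) :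
    Dom (fun f : SpaceTime → F => Smooth f) (wnorm D (a + 1) (n + 1))
      (fun f t => snorm D (n + 1) f t + wnorm D (a + 1) n (pd 0 f) t
        + (wnorm D a n (scal f) t + wnorm D a n f t)) := by
  induction n with
  | zero =>
    refine Dom.of_le fun f _ t _ => ?_
    simp [wnorm_succ, snorm_succ]
  | succ n ih =>
    refine Dom.le_trans (Ψ := fun f t => l2Norm D f t + (wnorm D (a + 1) (n + 1) (pd 0 f) t
      + ∑ k : Fin 3, wnorm D (a + 1) (n + 1) (pd k.succ f) t) + wnorm D a (n + 1) (scal f) t)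
      (fun f _ t _ => ?_) (Dom.add (Dom.add ?_ (Dom.add ?_ (Dom.sum fun k _ => ?_))) ?_)
    · rw [wnorm_succ, Fin.sum_univ_succ (fun β : Fin 4 => wnorm D (a + 1) (n + 1) (pd β f) t)]
    · exact ((Dom.of_le fun f _ t _ => l2Norm_le_snorm (n + 1) f).add_right).add_right
    · exact Dom.refl.add_left.add_right
    · refine (ih.comp (fun f => pd k.succ f) fun f hf => hf.pd _).trans
        (Dom.add (Dom.add ?_ ?_) (Dom.add ?_ ?_))
      · exact (Dom.of_le fun f _ t _ => snorm_pd_le (n + 1) k f).add_right.add_right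
      · refine (Dom.le_trans (fun f hf t _ => ?_) (Dom.refl.add_left)).add_right
        rw [pd_comm hf]
        exact wnorm_pd_le _ _ _ _
      · refine Dom.le_trans (fun f hf t _ => ?_) Dom.refl.add_left
        have h2 : scal (pd k.succ f) = pd k.succ (scal f) - pd k.succ f := by
          rw [pd_scal hf]; simp
        rw [h2]
        exact (wnorm_sub_le hD (hf.scal.pd _) (hf.pd _) a n).trans
          (add_le_add (wnorm_pd_le _ _ _ _) (wnorm_pd_le _ _ _ _))
      · exact (Dom.of_le fun f _ t _ => wnorm_pd_le a n k.succ f).add_left.add_left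
    · exact Dom.refl.add_right.add_left

/-- The sum of the `L²` norms of `(S̃^μ ∂_t^j v)'`. -/
def tnorm (K : Set E3) (η : E3 → ℝ) (a n : ℕ) (v : SpaceTime → F) (t : ℝ) : ℝ≥0∞ :=
  ∑ q ∈ timeIdx a n, ∑ β : Fin 4, l2Norm Kᶜ (pd β ((scalMod η)^[q.1] ((pd 0)^[q.2] v))) t

theorem timeIdx_mono {a a' n n' : ℕ} (ha : a ≤ a') (hn : n ≤ n') : timeIdx a n ⊆ timeIdx a' n' :=
  fun q hq => by rw [mem_timeIdx] at hq ⊢; omega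

theorem tnorm_mono {a a' n n' : ℕ} (ha : a ≤ a') (hn : n ≤ n') (v : SpaceTime → F) :
    tnorm K η a n v t ≤ tnorm K η a' n' v t :=
  Finset.sum_le_sum_of_subset (timeIdx_mono ha hn)

theorem l2Norm_pd_le_tnorm {a n μ j : ℕ} (hμ : μ < a) (hj : j + μ < n) (β : Fin 4)
    (v : SpaceTime → F) :
    l2Norm Kᶜ (pd β ((scalMod η)^[μ] ((pd 0)^[j] v))) t ≤ tnorm K η a n v t := by
  have hq : (μ, j) ∈ timeIdx a n := mem_timeIdx.2 ⟨hμ, hj⟩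
  refine le_trans ?_ (single_le_sum_ennreal (g := fun q : ℕ × ℕ => ∑ β : Fin 4,
    l2Norm Kᶜ (pd β ((scalMod η)^[q.1] ((pd 0)^[q.2] v))) t) hq)
  exact single_le_sum_ennreal (g := fun β : Fin 4 =>
    l2Norm Kᶜ (pd β ((scalMod η)^[μ] ((pd 0)^[j] v))) t) (Finset.mem_univ β)

theorem tnorm_pd_zero_le (a n : ℕ) :
    Dom (fun _ : SpaceTime → F => True) (fun v => tnorm K η a n (pd 0 v))
      (tnorm K η a (n + 1)) := by
  refine Dom.sum fun q hq => Dom.sum fun β _ => Dom.of_le fun v _ t _ => ?_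
  rw [mem_timeIdx] at hq
  exact l2Norm_pd_le_tnorm (j := q.2 + 1) hq.1 (by omega) β v

theorem tnorm_scalMod_le (hK : IsSmoothObstacle K) (hη : IsCutoff K η) (a n : ℕ) :
    Dom (fun v : SpaceTime → F => Smooth v) (fun v => tnorm K η a n (scalMod η v))
      (tnorm K η (a + 1) (n + 1)) := by
  refine Dom.sum fun q hq => Dom.sum fun β _ => ?_
  rw [mem_timeIdx] at hq
  refine Dom.le_trans (Ψ := fun v t =>
    l2Norm Kᶜ (pd β ((scalMod η)^[q.1 + 1] ((pd 0)^[q.2] v))) t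
    + ‖(q.2 : ℝ)‖₊ * l2Norm Kᶜ (pd β ((scalMod η)^[q.1] ((pd 0)^[q.2] v))) t)
    (fun v hv t _ => ?_) (Dom.add ?_ (Dom.const_mul _ ?_))
  · have h0 := pd_iterate_smooth hv 0 q.2
    have h1 := scalMod_iterate_smooth hη (h0.scalMod hη) q.1
    have h2 := scalMod_iterate_smooth hη h0 q.1
    rw [pd_zero_iterate_scalMod hη hv, scalMod_iterate_add hη (h0.scalMod hη) (h0.csmul _),
      scalMod_iterate_const_smul hη h0, pd_add h1 (h2.csmul _), pd_const_smul h2]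
    exact (l2Norm_add_le (h1.pd _) ((h2.pd _).csmul _)).trans
      (add_le_add le_rfl (l2Norm_const_smul_le hK.measurableSet_compl _ _))
  · exact Dom.of_le fun v _ t _ => l2Norm_pd_le_tnorm (by omega) (by omega) β v
  · exact Dom.of_le fun v _ t _ => l2Norm_pd_le_tnorm (by omega) (by omega) β v

/-- The right hand side of the estimate `gnorm_le_main`. -/
def mainRhs (c₁ c₂ : ℝ) (K : Set E3) (η : E3 → ℝ) (a n : ℕ) (v : SpaceTime → E3) (t : ℝ) : ℝ≥0∞ :=
  tnorm K η a n v t + wnorm Kᶜ a (n - 1) (elastic c₁ c₂ v) t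

theorem mainRhs_mono {a a' n n' : ℕ} (ha : a ≤ a') (hn : n ≤ n') (v : SpaceTime → E3) :
    mainRhs c₁ c₂ K η a n v t ≤ mainRhs c₁ c₂ K η a' n' v t :=
  add_le_add (tnorm_mono ha hn v) (wnorm_mono ha (by omega) _)

theorem mainRhs_pd_zero_le (a n : ℕ) :
    Dom (fun v : SpaceTime → E3 => Smooth v) (fun v => mainRhs c₁ c₂ K η a n (pd 0 v))
      (mainRhs c₁ c₂ K η a (n + 1)) := by
  refine Dom.add (((tnorm_pd_zero_le a n).mono fun _ _ => trivial).add_right) ?_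
  -- For `n = 0` the truncated `n - 1` is again `0`, and a norm over words of negative length is
  -- empty.
  rcases n with _ | n
  · exact Dom.of_eq_zero fun f t => by simp
  · refine (Dom.of_le fun v hv t _ => ?_).add_left
    rw [← pd_elastic hv]
    exact wnorm_pd_le _ _ _ _

/-- `L S̃ v` equals `S̃ L v + 2 L v` plus the commutator of `A` with the field `S - S̃`. This last
term is not expressible by `L v`; it is the source of the lower order norm of `v'`. -/
theorem mainRhs_scalMod_le (hK : IsSmoothObstacle K) (hη : IsCutoff K η) (a n : ℕ) :
    Dom (fun v : SpaceTime → E3 => Smooth v) (fun v => mainRhs c₁ c₂ K η a n (scalMod η v))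
      (fun v t => mainRhs c₁ c₂ K η (a + 1) (n + 1) v t + gnorm Kᶜ a n v t) := by
  have hD := hK.measurableSet_compl
  refine Dom.add ((tnorm_scalMod_le hK hη a n).add_right.add_right) ?_
  rcases n with _ | n
  · exact Dom.of_eq_zero fun f t => by simp
  refine Dom.le_trans (Ψ := fun v t => wnorm Kᶜ a n (scalMod η (elastic c₁ c₂ v)) t
    + (‖(2 : ℝ)‖₊ * wnorm Kᶜ a n (elastic c₁ c₂ v) t
    + wnorm Kᶜ a n (lameComm c₁ c₂ (defect η) v) t)) (fun v hv t _ => ?_)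
    (Dom.add ?_ (Dom.add (Dom.const_mul _ ?_) ?_))
  · rw [elastic_scalMod hη hv]
    have h1 := hv.elastic (c₁ := c₁) (c₂ := c₂)
    have h2 := lameComm_smooth (c₁ := c₁) (c₂ := c₂) hη.isCoef_defect hv
    refine (wnorm_add_le (h1.scalMod hη) ((h1.csmul _).plus h2) _ _).trans
      (add_le_add le_rfl ?_)
    exact (wnorm_add_le (h1.csmul _) h2 _ _).trans
      (add_le_add (wnorm_const_smul_le hD h1 _ _ _) le_rfl)
  · exact ((wnorm_scalMod_le hη hD a n).comp (elastic c₁ c₂)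
      fun v hv => hv.elastic).add_left.add_right
  · refine (Dom.of_le fun v _ t _ => ?_).add_left.add_right
    exact wnorm_mono (by omega) (by omega) _
  · exact (wnorm_lameComm_le hD hη.isCoef_defect a n).add_left

/-- Derivatives of functions vanishing on the boundary are controlled by those involving only time
derivatives and the modified scaling operator, and by the elastic operator. -/
theorem gnorm_le_main (hK : IsSmoothObstacle K) (hη : IsCutoff K η) (hc₂ : 0 < c₂ ^ 2)
    (h12 : c₂ ^ 2 ≤ c₁ ^ 2) (a n : ℕ) :
    Dom (fun v : SpaceTime → E3 => Adm K v) (gnorm Kᶜ a n) (mainRhs c₁ c₂ K η a n) := by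
  have hD := hK.measurableSet_compl
  -- The outer induction is on the total order `n`, the inner one on the number `a` of factors `S`.
  induction n generalizing a with
  | zero => exact Dom.of_eq_zero fun f t => by simp [gnorm]
  | succ n ihn =>
  induction a with
  | zero => exact Dom.of_eq_zero fun f t => by simp [gnorm]
  | succ a iha =>
  have hdt : Dom (fun v : SpaceTime → E3 => Adm K v) (fun v => gnorm Kᶜ (a + 1) n (pd 0 v))
      (mainRhs c₁ c₂ K η (a + 1) (n + 1)) :=
    ((ihn (a + 1)).comp (fun v => pd 0 v) fun v hv => Adm.pd_zero hK hv).trans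
      ((mainRhs_pd_zero_le (a + 1) n).mono fun v hv => hv.smooth)
  have hlow : Dom (fun v : SpaceTime → E3 => Adm K v) (gnorm Kᶜ (a + 1) n)
      (mainRhs c₁ c₂ K η (a + 1) (n + 1)) :=
    (ihn (a + 1)).trans_le fun v _ t _ => mainRhs_mono le_rfl (by omega) v
  have hlow' : Dom (fun v : SpaceTime → E3 => Adm K v) (gnorm Kᶜ a n)
      (mainRhs c₁ c₂ K η (a + 1) (n + 1)) :=
    Dom.le_trans (fun v _ t _ => gnorm_mono (by omega) le_rfl v) hlow
  refine Dom.sum fun β _ => ?_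
  -- What remains are purely spatial derivatives, a factor `∂_t`, and a factor `S`. A factor `∂_t`
  -- is absorbed by applying the estimate of lower order to `∂_t v`.
  refine (((wnorm_split hD a n).comp (fun v => pd β v) fun v hv => hv.pd β).mono
    fun v (hv : Adm K v) => hv.smooth).trans (Dom.add (Dom.add (Dom.add ?_ ?_) ?_) (Dom.add ?_ ?_))
  · exact (Dom.of_le fun v _ t _ => l2Norm_pd_le_tnorm (μ := 0) (j := 0) (by omega) (by omega)
      β v).add_right
  · refine Dom.sum fun k _ => ?_
    induction β using Fin.cases with
    | zero =>
      refine Dom.le_trans (fun v hv t _ => ?_) hdt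
      exact (snorm_le_wnorm a n _).trans (wnorm_pd_le_gnorm (a + 1) n k.succ (pd 0 v))
    | succ i =>
      -- Two spatial derivatives are traded for `A v = ∂_t² v - L v` and first derivatives of lower
      -- order.
      refine (elliptic_estimate (c₁ := c₁) hK hη hc₂ h12 n k i).trans
        (Dom.add ?_ (Dom.sum fun m _ => ?_))
      · refine Dom.le_trans (Ψ := fun v t => snorm Kᶜ n (pd 0 (pd 0 v)) t
          + snorm Kᶜ n (elastic c₁ c₂ v) t) (fun v hv t _ => ?_) (Dom.add ?_ ?_)
        · have hs : Smooth v := (Adm.toTame hv).smooth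
          have : lame c₁ c₂ v = pd 0 (pd 0 v) - elastic c₁ c₂ v := by
            rw [elastic_eq hs]; simp
          rw [this]
          exact snorm_sub_le hD ((hs.pd _).pd _) hs.elastic n
        · refine Dom.le_trans (fun v hv t _ => ?_) hdt
          exact (snorm_le_wnorm a n _).trans (wnorm_pd_le_gnorm (a + 1) n 0 (pd 0 v))
        · exact (Dom.of_le fun v _ t _ => snorm_le_wnorm a n _).add_left
      · refine Dom.le_trans (fun v hv t _ => ?_) hlow
        exact (snorm_le_wnorm a n _).trans (wnorm_pd_le_gnorm (a + 1) n m.succ v)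
  · refine Dom.le_trans (fun v hv t _ => ?_) hdt
    rw [pd_comm ((Adm.toTame hv).smooth)]
    exact wnorm_pd_le_gnorm (a + 1) n β (pd 0 v)
  -- `S ∂_β v` is rewritten as `∂_β S̃ v + ∂_β (S - S̃) v - ∂_β v`; the first term falls under the
  -- induction on `n` because `S̃ v` vanishes on `∂K`.
  · refine Dom.le_trans (Ψ := fun v t => wnorm Kᶜ a n (pd β (scalMod η v)) t
      + wnorm Kᶜ a n (pd β (vf (defect η) v)) t + wnorm Kᶜ a n (pd β v) t)
      (fun v hv t _ => ?_) (Dom.add (Dom.add ?_ ?_) ?_)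
    · have hs : Smooth v := (Adm.toTame hv).smooth
      have h1 := hs.scalMod hη
      have h2 := vf_smooth hη.isCoef_defect hs
      have : scal (pd β v) = pd β (scalMod η v) + pd β (vf (defect η) v) - pd β v := by
        rw [← pd_add h1 h2, scalMod_eq_vf, sub_add_cancel, pd_scal hs]; simp
      rw [this]
      refine (wnorm_sub_le hD ((h1.pd _).plus (h2.pd _)) (hs.pd _) a n).trans ?_
      exact add_le_add (wnorm_add_le (h1.pd _) (h2.pd _) a n) le_rfl
    · refine Dom.le_trans (fun v _ t _ => wnorm_pd_le_gnorm a n β (scalMod η v)) ?_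
      refine ((ihn a).comp (scalMod η) fun v hv => Adm.scalMod hK hη hv).trans ?_
      exact ((mainRhs_scalMod_le hK hη a n).mono fun v (hv : Adm K v) => hv.smooth).trans
        (Dom.add Dom.refl hlow')
    -- Replacing `S` by the field `S - S̃` costs one spatial derivative but saves one factor `S`:
    -- the order is unchanged and the induction on `a` applies.
    · refine Dom.le_trans (fun v _ t _ => wnorm_pd_le_gnorm a n β (vf (defect η) v)) ?_
      refine ((gnorm_vf_le hD hη.isCoef_defect a n).mono fun v (hv : Adm K v) => hv.smooth).trans ?_
      exact iha.trans_le fun v _ t _ => mainRhs_mono (by omega) le_rfl v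
    · exact Dom.le_trans (fun v _ t _ => wnorm_pd_le_gnorm a n β v) hlow'
  · exact Dom.le_trans (fun v _ t _ => wnorm_pd_le_gnorm a n β v) hlow'

end Norms

end

end ExteriorElastic

namespace ExteriorElastic

noncomputable section

/-! ### Commutators of the elastic operator with the scaling operators -/

section Commutators

variable {D K : Set E3} {η : E3 → ℝ} {c₁ c₂ t : ℝ}

/-- The commutator telescopes, one `S̃` being moved past `L` at a time. Each step replaces an `S̃`
by the second order operator `2L + [A, S - S̃]`, so one scaling factor is lost and first derivatives
suffice on the right. -/
theorem wnorm_comm_scalMod_le (hη : IsCutoff K η) (hD : MeasurableSet D) (a n μ : ℕ) :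
    Dom (fun f : SpaceTime → E3 => Smooth f)
      (fun f => wnorm D a n (elastic c₁ c₂ ((scalMod η)^[μ + 1] f)
        - (scalMod η)^[μ + 1] (elastic c₁ c₂ f)))
      (gnorm D (a + μ) (n + μ + 1)) := by
  have hX : ∀ μ, Dom (fun f : SpaceTime → E3 => Smooth f) (fun f => wnorm D a n
      ((scalMod η)^[μ] ((2 : ℝ) • elastic c₁ c₂ f + lameComm c₁ c₂ (defect η) f)))
      (gnorm D (a + μ) (n + μ + 1)) := fun μ => by
    refine ((wnorm_scalMod_iterate_le hη hD a n μ).comp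
      (fun f => (2 : ℝ) • elastic c₁ c₂ f + lameComm c₁ c₂ (defect η) f) fun f hf =>
        (hf.elastic.csmul _).plus (lameComm_smooth hη.isCoef_defect hf)).trans ?_
    refine Dom.le_trans (Ψ := fun f t => ‖(2 : ℝ)‖₊ * wnorm D (a + μ) (n + μ) (elastic c₁ c₂ f) t
      + wnorm D (a + μ) (n + μ) (lameComm c₁ c₂ (defect η) f) t) (fun f hf t _ => ?_)
      (Dom.add (Dom.const_mul _ (wnorm_elastic_le hD _ _))
        (wnorm_lameComm_le hD hη.isCoef_defect _ _))
    exact (wnorm_add_le (hf.elastic.csmul _) (lameComm_smooth hη.isCoef_defect hf) _ _).trans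
      (add_le_add (wnorm_const_smul_le hD hf.elastic _ _ _) le_rfl)
  have hstep : ∀ (μ : ℕ) (f : SpaceTime → E3), Smooth f →
      elastic c₁ c₂ ((scalMod η)^[μ + 1] f) - (scalMod η)^[μ + 1] (elastic c₁ c₂ f)
        = (elastic c₁ c₂ ((scalMod η)^[μ] (scalMod η f))
          - (scalMod η)^[μ] (elastic c₁ c₂ (scalMod η f)))
        + (scalMod η)^[μ] ((2 : ℝ) • elastic c₁ c₂ f + lameComm c₁ c₂ (defect η) f) := by
    intro μ f hf
    rw [Function.iterate_succ_apply, Function.iterate_succ_apply, elastic_scalMod hη hf,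
      scalMod_iterate_add hη (hf.elastic.scalMod hη)
        ((hf.elastic.csmul _).plus (lameComm_smooth hη.isCoef_defect hf))]
    abel
  induction μ with
  | zero =>
    refine Dom.le_trans (fun f hf t _ => le_of_eq ?_) (hX 0)
    rw [hstep 0 f hf]
    simp
  | succ μ ih =>
    refine Dom.le_trans (Ψ := fun f t => wnorm D a n
      (elastic c₁ c₂ ((scalMod η)^[μ + 1] (scalMod η f))
          - (scalMod η)^[μ + 1] (elastic c₁ c₂ (scalMod η f))) t
        + wnorm D a n ((scalMod η)^[μ + 1]
          ((2 : ℝ) • elastic c₁ c₂ f + lameComm c₁ c₂ (defect η) f)) t)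
      (fun f hf t _ => ?_) (Dom.add ?_ (hX (μ + 1)))
    · rw [hstep (μ + 1) f hf]
      refine wnorm_add_le ?_ (scalMod_iterate_smooth hη
        ((hf.elastic.csmul _).plus (lameComm_smooth hη.isCoef_defect hf)) _) a n
      exact (scalMod_iterate_smooth hη (hf.scalMod hη) _).elastic.minus
        (scalMod_iterate_smooth hη (hf.scalMod hη).elastic _)
    · exact (ih.comp (scalMod η) fun f hf => hf.scalMod hη).trans
        (gnorm_scalMod_le hη hD _ _)

/-- The same telescoping with the exact rule `[L, S] = 2L`: only `L f` occurs, with fewer factors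
`S`, which is why no term in `f'` is needed far from the obstacle. -/
theorem wnorm_comm_scal_le (hD : MeasurableSet D) (a n μ : ℕ) :
    Dom (fun f : SpaceTime → E3 => Smooth f)
      (fun f => wnorm D a n (elastic c₁ c₂ (scal^[μ + 1] f) - scal^[μ + 1] (elastic c₁ c₂ f)))
      (fun f => wnorm D (a + μ) (n + μ) (elastic c₁ c₂ f)) := by
  have hX : ∀ μ, Dom (fun f : SpaceTime → E3 => Smooth f) (fun f => wnorm D a n
      (scal^[μ] ((2 : ℝ) • elastic c₁ c₂ f)))
      (fun f => wnorm D (a + μ) (n + μ) (elastic c₁ c₂ f)) := fun μ =>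
    ⟨‖(2 : ℝ)‖₊, fun f hf t _ => (wnorm_scal_iterate_le _ _ _ _).trans
      (wnorm_const_smul_le hD hf.elastic _ _ _)⟩
  have hstep : ∀ (μ : ℕ) (f : SpaceTime → E3), Smooth f →
      elastic c₁ c₂ (scal^[μ + 1] f) - scal^[μ + 1] (elastic c₁ c₂ f)
        = (elastic c₁ c₂ (scal^[μ] (scal f)) - scal^[μ] (elastic c₁ c₂ (scal f)))
        + scal^[μ] ((2 : ℝ) • elastic c₁ c₂ f) := by
    intro μ f hf
    rw [Function.iterate_succ_apply, Function.iterate_succ_apply, elastic_scal hf,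
      scal_iterate_add hf.elastic.scal (hf.elastic.csmul _)]
    abel
  induction μ with
  | zero =>
    refine Dom.le_trans (fun f hf t _ => le_of_eq ?_) (hX 0)
    rw [hstep 0 f hf]
    simp
  | succ μ ih =>
    refine Dom.le_trans (Ψ := fun f t => wnorm D a n
      (elastic c₁ c₂ (scal^[μ + 1] (scal f)) - scal^[μ + 1] (elastic c₁ c₂ (scal f))) t
        + wnorm D a n (scal^[μ + 1] ((2 : ℝ) • elastic c₁ c₂ f)) t)
      (fun f hf t _ => ?_) (Dom.add ?_ (hX (μ + 1)))
    · rw [hstep (μ + 1) f hf]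
      refine wnorm_add_le ?_ (scal_iterate_smooth (hf.elastic.csmul _) _) a n
      exact (scal_iterate_smooth hf.scal _).elastic.minus (scal_iterate_smooth hf.scal.elastic _)
    · refine (ih.comp scal fun f hf => hf.scal).trans ?_
      refine Dom.le_trans (Ψ := fun f t => wnorm D (a + μ) (n + μ) (scal (elastic c₁ c₂ f)) t
        + ‖(2 : ℝ)‖₊ * wnorm D (a + μ) (n + μ) (elastic c₁ c₂ f) t) (fun f hf t _ => ?_)
        (Dom.add ?_ (Dom.const_mul _ ?_))
      · rw [elastic_scal hf]
        exact (wnorm_add_le hf.elastic.scal (hf.elastic.csmul _) _ _).trans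
          (add_le_add le_rfl (wnorm_const_smul_le hD hf.elastic _ _ _))
      · exact Dom.of_le fun f _ t _ => wnorm_scal_le _ _ _
      · exact Dom.of_le fun f _ t _ => wnorm_mono (by omega) (by omega) _

/-! ### Localization to `|x| > 1`, where `S̃ = S`. -/

section Local

variable {F : Type*} [NormedAddCommGroup F] [NormedSpace ℝ F]

/-- The region where the modified scaling operator is the scaling operator. -/
def farRegion : Set SpaceTime := {p | 1 < ‖p.2‖}

theorem isOpen_farRegion : IsOpen farRegion := isOpen_lt (by fun_prop) (by fun_prop)

theorem pd_eqOn {f g : SpaceTime → F} (h : Set.EqOn f g farRegion) (β : Fin 4) :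
    Set.EqOn (pd β f) (pd β g) farRegion := fun p hp => by
  have : f =ᶠ[𝓝 p] g := Filter.eventuallyEq_of_mem (isOpen_farRegion.mem_nhds hp) h
  simp only [pd, this.fderiv_eq]

theorem elastic_eqOn {f g : SpaceTime → E3} (hf : Smooth f) (hg : Smooth g)
    (h : Set.EqOn f g farRegion) : Set.EqOn (elastic c₁ c₂ f) (elastic c₁ c₂ g) farRegion :=
  fun p hp => by
  rw [elastic_eq hf, elastic_eq hg]
  simp only [lame, Pi.sub_apply, Finset.sum_apply, pd_eqOn (pd_eqOn h _) _ hp]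

theorem scalMod_eqOn (hη : IsCutoff K η) {f g : SpaceTime → F} (h : Set.EqOn f g farRegion) :
    Set.EqOn (scalMod η f) (scal g) farRegion := fun p hp => by
  have : f =ᶠ[𝓝 p] g := Filter.eventuallyEq_of_mem (isOpen_farRegion.mem_nhds hp) h
  simp [scalMod, scal, pd_eqOn h 0 hp, this.fderiv_eq, h hp, hη.one p.2 hp]

theorem scalMod_iterate_eqOn (hη : IsCutoff K η) (f : SpaceTime → F) (μ : ℕ) :
    Set.EqOn ((scalMod η)^[μ] f) (scal^[μ] f) farRegion := by
  induction μ with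
  | zero => exact fun _ _ => rfl
  | succ μ ih =>
    rw [Function.iterate_succ_apply', Function.iterate_succ_apply']
    exact scalMod_eqOn hη ih

/-- Splitting of the `L²` norm along the unit sphere. -/
theorem l2Norm_le_near_add_far (hD : MeasurableSet D) {f : SpaceTime → F} (hf : Smooth f) :
    l2Norm D f t ≤ l2Norm (D ∩ Metric.ball 0 1) f t + l2Norm (D ∩ {x | 1 < ‖x‖}) f t := by
  have hB : MeasurableSet (D ∩ Metric.ball (0 : E3) 1) := hD.inter Metric.isOpen_ball.measurableSet
  have hE : MeasurableSet (D ∩ {x : E3 | 1 < ‖x‖}) :=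
    hD.inter (isOpen_lt continuous_const continuous_norm).measurableSet
  simp only [l2Norm]
  rw [← MeasureTheory.eLpNorm_indicator_eq_eLpNorm_restrict hB,
    ← MeasureTheory.eLpNorm_indicator_eq_eLpNorm_restrict hE,
    ← MeasureTheory.eLpNorm_indicator_eq_eLpNorm_restrict hD]
  have h1 := MeasureTheory.eLpNorm_add_le (p := 2)
    (((hf.aesm t MeasureTheory.volume).indicator hB)) ((hf.aesm t MeasureTheory.volume).indicator hE)
    (by norm_num)
  refine le_trans (le_of_eq (MeasureTheory.eLpNorm_congr_ae ?_)) h1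
  have h2 : ∀ᵐ x : E3, x ∉ Metric.sphere (0 : E3) 1 :=
    MeasureTheory.measure_eq_zero_iff_ae_notMem.1 (MeasureTheory.Measure.addHaar_sphere _ 0 1)
  filter_upwards [h2] with x hx
  have hx' : ‖x‖ ≠ 1 := by simpa using hx
  rw [Pi.add_apply]
  by_cases hxD : x ∈ D
  · rcases lt_or_gt_of_ne hx' with h | h
    · rw [Set.indicator_of_mem hxD,
        Set.indicator_of_mem (s := D ∩ Metric.ball 0 1) ⟨hxD, by simpa using h⟩,
        Set.indicator_of_notMem (s := D ∩ {x : E3 | 1 < ‖x‖}) (fun h' => absurd h'.2 (not_lt.2 h.le)),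
        add_zero]
    · rw [Set.indicator_of_mem hxD, Set.indicator_of_mem (s := D ∩ {x : E3 | 1 < ‖x‖}) ⟨hxD, h⟩,
        Set.indicator_of_notMem, zero_add]
      exact fun h' => absurd (mem_ball_zero_iff.1 h'.2) (not_lt.2 (le_of_lt h))
  · rw [Set.indicator_of_notMem hxD, Set.indicator_of_notMem fun h => hxD h.1,
      Set.indicator_of_notMem fun h => hxD h.1, add_zero]

end Local

/-- The commutator of the elastic operator with the modified scaling operator and time derivatives:
near the obstacle it is controlled by local norms with one factor `S` less. -/
theorem l2Norm_comm_le (hK : IsSmoothObstacle K) (hη : IsCutoff K η) {ν n : ℕ} {q : ℕ × ℕ}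
    (hq : q ∈ timeIdx (ν + 1) (n + 1)) :
    Dom (fun u : SpaceTime → E3 => Smooth u)
      (fun u => l2Norm Kᶜ (elastic c₁ c₂ ((scalMod η)^[q.1] ((pd 0)^[q.2] u))
        - (scalMod η)^[q.1] ((pd 0)^[q.2] (elastic c₁ c₂ u))))
      (fun u t => wnorm Kᶜ ν n (elastic c₁ c₂ u) t
        + gnorm (Kᶜ ∩ Metric.ball 0 1) ν (n + 1) u t) := by
  have hD := hK.measurableSet_compl
  have hB : MeasurableSet (Kᶜ ∩ Metric.ball (0 : E3) 1) :=
    hD.inter Metric.isOpen_ball.measurableSet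
  have hE : MeasurableSet (Kᶜ ∩ {x : E3 | 1 < ‖x‖}) :=
    hD.inter (isOpen_lt continuous_const continuous_norm).measurableSet
  obtain ⟨μ, j⟩ := q
  rw [mem_timeIdx] at hq
  rcases μ with _ | μ
  -- Time derivatives alone commute with `L` exactly.
  · refine Dom.le_trans (fun u hu t _ => le_of_eq ?_) Dom.zero
    simp only [Function.iterate_zero, id]
    rw [pd_iterate_elastic hu, sub_self, l2Norm_zero]
  have hs : ∀ u : SpaceTime → E3, Smooth u → Smooth (elastic c₁ c₂ ((scalMod η)^[μ + 1]
      ((pd 0)^[j] u)) - (scalMod η)^[μ + 1] (elastic c₁ c₂ ((pd 0)^[j] u))) := fun u hu =>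
    (scalMod_iterate_smooth hη (pd_iterate_smooth hu _ _) _).elastic.minus
      (scalMod_iterate_smooth hη (pd_iterate_smooth hu _ _).elastic _)
  refine Dom.le_trans (Ψ := fun u t => l2Norm (Kᶜ ∩ Metric.ball 0 1)
      (elastic c₁ c₂ ((scalMod η)^[μ + 1] ((pd 0)^[j] u))
        - (scalMod η)^[μ + 1] (elastic c₁ c₂ ((pd 0)^[j] u))) t
      + l2Norm (Kᶜ ∩ {x | 1 < ‖x‖}) (elastic c₁ c₂ (scal^[μ + 1] ((pd 0)^[j] u))
        - scal^[μ + 1] (elastic c₁ c₂ ((pd 0)^[j] u))) t) (fun u hu t _ => ?_) (Dom.add ?_ ?_)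
  · rw [pd_iterate_elastic hu]
    refine (l2Norm_le_near_add_far hD (hs u hu)).trans (add_le_add le_rfl (le_of_eq ?_))
    refine l2Norm_congr hE fun x hx => ?_
    have h1 := scalMod_iterate_eqOn hη ((pd 0)^[j] u) (μ + 1)
    have h2 := elastic_eqOn (c₁ := c₁) (c₂ := c₂)
      (scalMod_iterate_smooth hη (pd_iterate_smooth hu 0 j) (μ + 1))
      (scal_iterate_smooth (pd_iterate_smooth hu 0 j) (μ + 1)) h1
    rw [Pi.sub_apply, Pi.sub_apply, h2 (x := (t, x)) hx.2,
      scalMod_iterate_eqOn hη _ (μ + 1) (x := (t, x)) hx.2]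
  -- Near the obstacle the commutator is bounded by local norms of `u'`; the next case uses the
  -- exact scaling rule in the far region.
  · refine Dom.add_left ?_
    have h := (wnorm_comm_scalMod_le (c₁ := c₁) (c₂ := c₂) hη hB 1 1 μ).comp
      (fun u => (pd 0)^[j] u) fun u hu => pd_iterate_smooth hu 0 j
    refine Dom.le_trans (fun u _ t _ => (wnorm_one_one _).ge) (h.trans_le fun u hu t _ => ?_)
    exact (gnorm_pd_iterate_le _ _ _ _ hu).trans (gnorm_mono (by omega) (by omega) u)
  · refine Dom.add_right ?_
    have h := (wnorm_comm_scal_le (c₁ := c₁) (c₂ := c₂) hE 1 1 μ).comp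
      (fun u => (pd 0)^[j] u) fun u hu => pd_iterate_smooth hu 0 j
    refine Dom.le_trans (fun u _ t _ => (wnorm_one_one _).ge) (h.trans_le fun u hu t _ => ?_)
    rw [← pd_iterate_elastic hu]
    refine (wnorm_mono_set Set.inter_subset_left _ _ _).trans ?_
    exact (wnorm_pd_iterate_le _ _ _ _ _).trans (wnorm_mono (by omega) (by omega) _)

variable {F : Type*} [NormedAddCommGroup F] [NormedSpace ℝ F]

/-- Moving the modified scaling operator past a derivative. -/
theorem l2Norm_scalMod_iterate_pd_le (hD : MeasurableSet D) (hη : IsCutoff K η)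
    {b : SpaceTime → ℝ} (hb : IsCoef b) (μ : ℕ) (β : Fin 4) :
    Dom (fun w : SpaceTime → F => Smooth w) (fun w => l2Norm D ((scalMod η)^[μ] (b • pd β w)))
      (fun w t => ∑ m ∈ Finset.range (μ + 1), ∑ β : Fin 4, l2Norm D (pd β ((scalMod η)^[m] w)) t)
    := by
  induction μ generalizing b β with
  | zero =>
    have h := (l2Norm_coef_le (F := F) hb hD).comp (Q := fun w : SpaceTime → F => Smooth w)
      (fun w => pd β w) fun _ _ => trivial
    refine h.trans_le fun w _ t _ => ?_
    simp only [zero_add, Finset.range_one, Finset.sum_singleton, Function.iterate_zero, id]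
    exact single_le_sum_ennreal (g := fun β : Fin 4 => l2Norm D (pd β w) t) (Finset.mem_univ β)
  | succ μ ih =>
    obtain ⟨b', hb', h⟩ := scalMod_smul (F := F) hη hb
    have hup : ∀ (w : SpaceTime → F) (t : ℝ), ∑ m ∈ Finset.range (μ + 1), ∑ β : Fin 4,
        l2Norm D (pd β ((scalMod η)^[m] w)) t ≤ ∑ m ∈ Finset.range (μ + 1 + 1), ∑ β : Fin 4,
        l2Norm D (pd β ((scalMod η)^[m] w)) t := fun w t =>
      Finset.sum_le_sum_of_subset (Finset.range_subset_range.2 (by omega))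
    have hi : ∀ {b : SpaceTime → ℝ} (_ : IsCoef b) (β : Fin 4), Dom (fun w : SpaceTime → F => Smooth w)
        (fun w => l2Norm D ((scalMod η)^[μ] (b • pd β w)))
        (fun w t => ∑ m ∈ Finset.range (μ + 1 + 1), ∑ β : Fin 4,
          l2Norm D (pd β ((scalMod η)^[m] w)) t) := fun hb β =>
      (ih hb β).trans_le fun w _ t _ => hup w t
    refine Dom.le_trans (Ψ := fun w t => l2Norm D ((scalMod η)^[μ] (b' • pd β w)) t
      + (l2Norm D ((scalMod η)^[μ] (b • pd β (scalMod η w))) t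
        + (‖(-1 : ℝ)‖₊ * l2Norm D ((scalMod η)^[μ] (b • pd β w)) t
        + ∑ l : Fin 3, l2Norm D ((scalMod η)^[μ] ((b * pd β (defect η l)) • pd l.succ w)) t)))
      (fun w hw t _ => ?_) (Dom.add (hi hb' β) (Dom.add ?_ (Dom.add (Dom.const_mul _ (hi hb β))
        (Dom.sum fun l _ => hi (hb.mul ((hη.isCoef_defect l).pd β)) l.succ))))
    -- The first `S̃` acts on `b` or passes `∂_β` with the error `-∂_β + ∑ (∂_β e_l) ∂_l`. Every
    -- resulting term is again a coefficient times a derivative of `w` or of `S̃ w`, to which the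
    -- induction hypothesis applies.
    · have e : scalMod η (b • pd β w) = b' • pd β w + (b • pd β (scalMod η w)
          + ((-1 : ℝ) • (b • pd β w)
          + ∑ l : Fin 3, (b * pd β (defect η l)) • pd l.succ w)) := by
        rw [h _ (hw.pd β), pd_scalMod hη hw]
        simp only [smul_add, smul_sub, Finset.smul_sum, mul_smul]
        module
      have s1 := hb'.smul (hw.pd β)
      have s2 := hb.smul ((hw.scalMod hη).pd β)
      have s3 := hb.smul (hw.pd β)
      have s4 := fun l : Fin 3 => (hb.mul ((hη.isCoef_defect l).pd β)).smul (hw.pd l.succ)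
      have s5 : Smooth (∑ l : Fin 3, (b * pd β (defect η l)) • pd l.succ w) :=
        Smooth.sum fun l _ => s4 l
      have it := fun {f : SpaceTime → F} (hf : Smooth f) => scalMod_iterate_smooth hη hf μ
      have e5 : (scalMod η)^[μ] (∑ l : Fin 3, (b * pd β (defect η l)) • pd l.succ w)
          = ∑ l : Fin 3, (scalMod η)^[μ] ((b * pd β (defect η l)) • pd l.succ w) := by
        simp only [Fin.sum_univ_three]
        rw [scalMod_iterate_add hη ((s4 0).plus (s4 1)) (s4 2),
          scalMod_iterate_add hη (s4 0) (s4 1)]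
      rw [Function.iterate_succ_apply, e,
        scalMod_iterate_add hη s1 (s2.plus ((s3.csmul _).plus s5)),
        scalMod_iterate_add hη s2 ((s3.csmul _).plus s5),
        scalMod_iterate_add hη (s3.csmul _) s5, scalMod_iterate_const_smul hη s3, e5]
      have s6 : Smooth (∑ l : Fin 3, (scalMod η)^[μ] ((b * pd β (defect η l)) • pd l.succ w)) :=
        Smooth.sum fun l _ => it (s4 l)
      refine (l2Norm_add_le (it s1) ((it s2).plus (((it s3).csmul _).plus s6))).trans
        (add_le_add le_rfl ?_)
      refine (l2Norm_add_le (it s2) (((it s3).csmul _).plus s6)).trans (add_le_add le_rfl ?_)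
      refine (l2Norm_add_le ((it s3).csmul _) s6).trans (add_le_add ?_ ?_)
      · exact l2Norm_const_smul_le hD _ _
      · exact l2Norm_sum_le fun l _ => it (s4 l)
    · refine ((ih hb β).comp (scalMod η) fun w hw => hw.scalMod hη).trans_le fun w _ t _ => ?_
      simp only [← Function.iterate_succ_apply]
      rw [Finset.sum_range_succ' _ (μ + 1)]
      exact le_self_add

/-- The embedding of the component `β` of the gradient. -/
def gradSingle (F : Type*) [NormedAddCommGroup F] [NormedSpace ℝ F] (β : Fin 4) :
    F →L[ℝ] PiLp 2 (fun _ : Fin 4 => F) :=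
  ((PiLp.continuousLinearEquiv 2 ℝ (fun _ : Fin 4 => F)).symm :
    (Fin 4 → F) →L[ℝ] PiLp 2 (fun _ : Fin 4 => F)).comp
    (ContinuousLinearMap.single ℝ (fun _ : Fin 4 => F) β)

theorem grad_eq (f : SpaceTime → F) : grad f = ∑ β : Fin 4, fun p => gradSingle F β (pd β f p) := by
  funext p
  ext β
  simp [grad, gradSingle, Pi.single_apply]

theorem pd_eq_proj_grad (f : SpaceTime → F) (β : Fin 4) :
    pd β f = fun p => (PiLp.proj 2 (fun _ : Fin 4 => F) β : PiLp 2 (fun _ : Fin 4 => F) →L[ℝ] F)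
      (grad f p) := by
  funext p
  simp [grad]

theorem grad_smooth {f : SpaceTime → F} (hf : Smooth f) : Smooth (grad f) := by
  rw [grad_eq]
  exact Smooth.sum fun β _ => (hf.pd β).clm _

theorem wnorm_grad_le (hD : MeasurableSet D) (a n : ℕ) :
    Dom (fun f : SpaceTime → F => Smooth f) (fun f => wnorm D a n (grad f)) (gnorm D a n) := by
  refine Dom.le_trans (Ψ := fun f t => ∑ β : Fin 4, ‖gradSingle F β‖₊ * wnorm D a n (pd β f) t)
    (fun f hf t _ => ?_) (Dom.sum fun β _ => Dom.const_mul _ (Dom.of_le fun f _ t _ =>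
      wnorm_pd_le_gnorm a n β f))
  rw [grad_eq]
  refine (wnorm_sum_le hD (fun β _ => (hf.pd β).clm _) a n).trans (Finset.sum_le_sum fun β _ => ?_)
  exact wnorm_clm_le hD (hf.pd β) _ a n

theorem gnorm_le_fnorm_grad (hD : MeasurableSet D) (a n : ℕ) :
    Dom (fun f : SpaceTime → F => Smooth f) (gnorm D a n) (fun f => fnorm D a n (grad f)) := by
  refine Dom.sum fun β _ => ?_
  refine Dom.trans (Ψ := fun f => wnorm D a n (grad f))
    ⟨‖(PiLp.proj 2 (fun _ : Fin 4 => F) β : PiLp 2 (fun _ : Fin 4 => F) →L[ℝ] F)‖₊,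
      fun f hf t _ => ?_⟩ ((wnorm_le_fnorm hD a n).comp grad fun f hf => grad_smooth hf)
  beta_reduce
  rw [pd_eq_proj_grad f β]
  exact wnorm_clm_le hD (grad_smooth hf) _ a n

theorem iterate_scalMod_pd_clm (hη : IsCutoff K η) {G : Type*} [NormedAddCommGroup G]
    [NormedSpace ℝ G] {f : SpaceTime → F} (hf : Smooth f) (L : F →L[ℝ] G) (μ j : ℕ) :
    (scalMod η)^[μ] ((pd 0)^[j] fun p => L (f p))
      = fun p => L ((scalMod η)^[μ] ((pd 0)^[j] f) p) := by
  have h1 : (pd 0)^[j] (fun p => L (f p)) = fun p => L ((pd 0)^[j] f p) := by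
    induction j with
    | zero => rfl
    | succ j ih =>
      rw [Function.iterate_succ_apply', Function.iterate_succ_apply', ih,
        pd_clm (pd_iterate_smooth hf _ _)]
  rw [h1]
  induction μ with
  | zero => rfl
  | succ μ ih =>
    rw [Function.iterate_succ_apply', Function.iterate_succ_apply', ih,
      scalMod_clm (scalMod_iterate_smooth hη (pd_iterate_smooth hf _ _) _)]

theorem iterate_scalMod_pd_add (hη : IsCutoff K η) {f g : SpaceTime → F} (hf : Smooth f)
    (hg : Smooth g) (μ j : ℕ) : (scalMod η)^[μ] ((pd 0)^[j] (f + g))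
      = (scalMod η)^[μ] ((pd 0)^[j] f) + (scalMod η)^[μ] ((pd 0)^[j] g) := by
  rw [pd_iterate_add hf hg, scalMod_iterate_add hη (pd_iterate_smooth hf _ _)
    (pd_iterate_smooth hg _ _)]

theorem l2Norm_iterate_grad_le (hK : IsSmoothObstacle K) (hη : IsCutoff K η) {a n : ℕ}
    {q : ℕ × ℕ} (hq : q ∈ timeIdx a n) :
    Dom (fun u : SpaceTime → F => Smooth u)
      (fun u => l2Norm Kᶜ ((scalMod η)^[q.1] ((pd 0)^[q.2] (grad u)))) (tnorm K η a n) := by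
  have hD := hK.measurableSet_compl
  refine Dom.le_trans (Ψ := fun u t => ∑ β : Fin 4, ‖gradSingle F β‖₊
    * l2Norm Kᶜ ((scalMod η)^[q.1] ((pd 0)^[q.2] (pd β u))) t) (fun u hu t _ => ?_)
    (Dom.sum fun β _ => Dom.const_mul _ ?_)
  · have s := fun β : Fin 4 => (hu.pd β).clm (gradSingle F β)
    have it := fun {f : SpaceTime → PiLp 2 (fun _ : Fin 4 => F)} (hf : Smooth f) =>
      scalMod_iterate_smooth hη (pd_iterate_smooth hf 0 q.2) q.1
    have e : (scalMod η)^[q.1] ((pd 0)^[q.2] (grad u)) = ∑ β : Fin 4,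
        fun p => gradSingle F β ((scalMod η)^[q.1] ((pd 0)^[q.2] (pd β u)) p) := by
      rw [grad_eq]
      simp only [← iterate_scalMod_pd_clm hη (hu.pd _)]
      simp only [Fin.sum_univ_four]
      rw [iterate_scalMod_pd_add hη (((s 0).plus (s 1)).plus (s 2)) (s 3),
        iterate_scalMod_pd_add hη ((s 0).plus (s 1)) (s 2),
        iterate_scalMod_pd_add hη (s 0) (s 1)]
    rw [e]
    refine (l2Norm_sum_le fun β _ => (scalMod_iterate_smooth hη
      (pd_iterate_smooth (hu.pd β) _ _) _).clm _).trans (Finset.sum_le_sum fun β _ => ?_)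
    exact l2Norm_clm_le hD _ _
  · have h := (l2Norm_scalMod_iterate_pd_le (F := F) hD hη (isCoef_const 1) q.1 β).comp
      (fun u => (pd 0)^[q.2] u) fun u hu => pd_iterate_smooth hu 0 q.2
    refine Dom.le_trans (fun u hu t _ => le_of_eq ?_) (h.trans (Dom.sum fun m hm =>
      Dom.sum fun β _ => Dom.of_le fun u _ t _ => ?_))
    · rw [pd_iterate_comm hu]
      congr 2
      funext p
      simp
    · rw [mem_timeIdx] at hq
      rw [Finset.mem_range] at hm
      exact l2Norm_pd_le_tnorm (by omega) (by omega) β u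

end Commutators

end

end ExteriorElastic

namespace ExteriorElastic

noncomputable section

/-! ### The energy identity -/

section ParametricIntegral

variable {K : Set E3}

/-- Differentiation under the integral sign. -/
theorem hasDerivWithinAt_integral_tame (hK : IsSmoothObstacle K) {h : SpaceTime → ℝ}
    (hh : Tame K h) {t : ℝ} (ht : 0 ≤ t) :
    HasDerivWithinAt (fun s => ∫ x in Kᶜ, h (s, x)) (∫ x in Kᶜ, pd 0 h (t, x)) (Set.Ici 0) t := by
  have hd := hh.pd hK 0
  -- On `[0, t + 1]` the integral may be taken over a fixed ball, where the time derivative is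
  -- uniformly bounded. For negative times nothing is known about the support, so the derivative is
  -- taken within `[0, ∞)`.
  obtain ⟨R, hR⟩ := hh.supp (t + 1) (by linarith)
  obtain ⟨R', hR'⟩ := hd.supp t ht
  have hB : MeasurableSet (Metric.closedBall (0 : E3) (max R R')) :=
    Metric.isClosed_closedBall.measurableSet
  have hcut : ∀ (f : SpaceTime → ℝ) (s : ℝ),
      (∀ x ∈ Kᶜ, max R R' < ‖x‖ → f (s, x) = 0) →
      ∫ x in Kᶜ, f (s, x) = ∫ x in Kᶜ ∩ Metric.closedBall (0 : E3) (max R R'), f (s, x) := by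
    intro f s hf
    refine MeasureTheory.setIntegral_eq_of_subset_of_forall_sdiff_eq_zero hK.measurableSet_compl
      Set.inter_subset_left fun x hx => hf x hx.1 ?_
    by_contra hc
    exact hx.2 ⟨hx.1, mem_closedBall_zero_iff.2 (not_lt.1 hc)⟩
  obtain ⟨C, hC⟩ := ((isCompact_Icc (a := t - 1) (b := t + 1)).prod
    (isCompact_closedBall (0 : E3) (max R R'))).exists_bound_of_continuousOn
    (hh.smooth.pd 0).continuous.continuousOn
  have hfin : MeasureTheory.IsFiniteMeasure (MeasureTheory.volume.restrict
      (Kᶜ ∩ Metric.closedBall (0 : E3) (max R R'))) := by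
    refine ⟨?_⟩
    rw [MeasureTheory.Measure.restrict_apply_univ]
    exact (MeasureTheory.measure_mono Set.inter_subset_right).trans_lt
      (isCompact_closedBall _ _).measure_lt_top
  have hder : HasDerivAt
      (fun s => ∫ x in Kᶜ ∩ Metric.closedBall (0 : E3) (max R R'), h (s, x))
      (∫ x in Kᶜ ∩ Metric.closedBall (0 : E3) (max R R'), pd 0 h (t, x)) t := by
    refine (hasDerivAt_integral_of_dominated_loc_of_deriv_le (F := fun s x => h (s, x))
      (F' := fun s x => pd 0 h (s, x)) (bound := fun _ => C) (s := Set.Icc (t - 1) (t + 1))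
      (Icc_mem_nhds (by linarith) (by linarith))
      (Filter.Eventually.of_forall fun s => hh.smooth.aesm s _)
      ((hh.integrable hK ht).mono_set Set.inter_subset_left)
      ((hh.smooth.pd 0).aesm t _) ?_ (MeasureTheory.integrable_const C) ?_).2
    · refine (MeasureTheory.ae_restrict_iff' (hK.measurableSet_compl.inter hB)).2
        (Filter.Eventually.of_forall fun x hx s hs => hC (s, x) ⟨hs, hx.2⟩)
    · refine Filter.Eventually.of_forall fun x s _ => ?_
      have h3 : HasDerivAt (fun r : ℝ => (r, x)) ((1 : ℝ), (0 : E3)) s :=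
        (hasDerivAt_id s).prodMk (hasDerivAt_const _ _)
      exact (hh.smooth.diff (s, x)).hasFDerivAt.comp_hasDerivAt s h3
  rw [hcut (pd 0 h) t fun x hx hxR => hR' t ⟨ht, le_rfl⟩ x hx
    ((le_max_right _ _).trans_lt hxR)]
  have hmem : Set.Icc 0 (t + 1) ∈ 𝓝[Set.Ici 0] t := by
    rw [← Set.Ici_inter_Iic]
    exact inter_mem_nhdsWithin _ (Iic_mem_nhds (by linarith))
  refine hder.hasDerivWithinAt.congr_of_eventuallyEq (Filter.eventuallyEq_of_mem hmem
    fun s hs => ?_) ?_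
  · exact hcut h s fun x hx hxR => hR s hs x hx ((le_max_left _ _).trans_lt hxR)
  · exact hcut h t fun x hx hxR => hR t ⟨ht, by linarith⟩ x hx ((le_max_left _ _).trans_lt hxR)

theorem continuousOn_nrm (hK : IsSmoothObstacle K) {F : Type*} [NormedAddCommGroup F]
    [InnerProductSpace ℝ F] {f : SpaceTime → F} (hf : Tame K f) :
    ContinuousOn (nrm K f) (Set.Ici 0) := fun _ ht =>
  ((hasDerivWithinAt_integral_tame hK hf.norm_sq ht).continuousWithinAt).sqrt

end ParametricIntegral

/-! ### Pointwise energy identity and bounds for the energy density. -/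

section Pointwise

variable {v : SpaceTime → E3} {c₁ c₂ : ℝ} {γ : Coeff}

theorem pd_mul {f g : SpaceTime → ℝ} (hf : Smooth f) (hg : Smooth g) (β : Fin 4) :
    pd β (f * g) = pd β f * g + f * pd β g := pd_smul hf hg β

theorem Smooth.times {f g : SpaceTime → ℝ} (hf : Smooth f) (hg : Smooth g) : Smooth (f * g) :=
  ContDiff.mul hf hg

theorem comp_eq_clm (v : SpaceTime → E3) (J : Fin 3) :
    comp v J = fun p => (EuclideanSpace.proj J : E3 →L[ℝ] ℝ) (v p) := rfl

theorem Smooth.comp (hv : Smooth v) (J : Fin 3) : Smooth (comp v J) := by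
  rw [comp_eq_clm]
  exact hv.clm _

theorem pd_comp (hv : Smooth v) (β : Fin 4) (J : Fin 3) :
    pd β (comp v J) = comp (pd β v) J := by
  rw [comp_eq_clm, pd_clm hv]
  rfl

/-- The matrix `(∂_i v^I)` of spatial derivatives, indexed by the pairs `(I, i)`. -/
def dcomp (v : SpaceTime → E3) (a : Fin 3 × Fin 3) : SpaceTime → ℝ := pd a.2.succ (comp v a.1)

theorem Smooth.dcomp (hv : Smooth v) (a : Fin 3 × Fin 3) : Smooth (dcomp v a) :=
  (hv.comp _).pd _

theorem pd_dcomp (hv : Smooth v) (β : Fin 4) (a : Fin 3 × Fin 3) :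
    pd β (dcomp v a) = dcomp (pd β v) a := by
  rw [dcomp, dcomp, pd_comm (hv.comp _), pd_comp hv]

theorem dcomp_apply (hv : Smooth v) (a : Fin 3 × Fin 3) (p : SpaceTime) :
    dcomp v a p = pd a.2.succ v p a.1 := by
  rw [dcomp, pd_comp hv]
  rfl

/-- The matrix of the coefficients of the perturbed operator, indexed by the pairs `(I, i)`. -/
def stiff (c₁ c₂ : ℝ) (γ : Coeff) (a b : Fin 3 × Fin 3) : SpaceTime → ℝ :=
  (fun _ => (if a = b then c₂ ^ 2 else 0)
    + if a.1 = a.2 ∧ b.1 = b.2 then c₁ ^ 2 - c₂ ^ 2 else 0) - γ a.1 b.1 a.2 b.2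

theorem stiff_smooth (hγ : ∀ I J j k, Smooth (γ I J j k)) (a b : Fin 3 × Fin 3) :
    Smooth (stiff c₁ c₂ γ a b) := Smooth.minus contDiff_const (hγ _ _ _ _)

theorem pd_stiff (hγ : ∀ I J j k, Smooth (γ I J j k)) (a b : Fin 3 × Fin 3) (β : Fin 4) :
    pd β (stiff c₁ c₂ γ a b) = -pd β (γ a.1 b.1 a.2 b.2) := by
  rw [stiff, pd_sub contDiff_const (hγ _ _ _ _)]
  funext p
  simp [pd]

theorem stiff_form (p : SpaceTime) (x y : Fin 3 × Fin 3 → ℝ) :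
    ∑ a, ∑ b, stiff c₁ c₂ γ a b p * (x a * y b)
      = c₂ ^ 2 * ∑ a, x a * y a
        + (c₁ ^ 2 - c₂ ^ 2) * ((∑ I : Fin 3, x (I, I)) * ∑ I : Fin 3, y (I, I))
        - ∑ a : Fin 3 × Fin 3, ∑ b : Fin 3 × Fin 3, γ a.1 b.1 a.2 b.2 p * (x a * y b) := by
  simp only [stiff, Pi.sub_apply, sub_mul, add_mul, Finset.sum_sub_distrib, Finset.sum_add_distrib]
  congr 1
  congr 1
  · simp [Finset.mul_sum]
  · simp only [Fintype.sum_prod_type, Fin.sum_univ_three]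
    simp
    ring

theorem sum_quad (g : Fin 3 → Fin 3 → Fin 3 → Fin 3 → ℝ) :
    ∑ a : Fin 3 × Fin 3, ∑ b : Fin 3 × Fin 3, g a.1 b.1 a.2 b.2
      = ∑ I : Fin 3, ∑ J : Fin 3, ∑ i : Fin 3, ∑ j : Fin 3, g I J i j := by
  simp only [Fintype.sum_prod_type]
  refine Finset.sum_congr rfl fun I _ => ?_
  rw [Finset.sum_comm]

theorem norm_sq_eq_sum (w : E3) : ‖w‖ ^ 2 = ∑ I : Fin 3, w I * w I := by
  simp only [EuclideanSpace.norm_sq_eq, Real.norm_eq_abs, sq_abs, ← sq]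

theorem sum_dcomp_sq (hv : Smooth v) (p : SpaceTime) :
    ∑ a, dcomp v a p * dcomp v a p = ∑ k : Fin 3, ‖pd k.succ v p‖ ^ 2 := by
  simp only [dcomp_apply hv, norm_sq_eq_sum, Fintype.sum_prod_type]
  exact Finset.sum_comm

theorem divergence_eq (v : SpaceTime → E3) : divergence v = ∑ k : Fin 3, dcomp v (k, k) := by
  funext p
  simp [divergence, dcomp]

theorem energyDensity_eq (hv : Smooth v) :
    energyDensity c₁ c₂ γ v = (1 / 2 : ℝ) • (∑ I : Fin 3, comp (pd 0 v) I * comp (pd 0 v) I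
      + ∑ a, ∑ b, stiff c₁ c₂ γ a b * (dcomp v a * dcomp v b)) := by
  funext p
  simp only [Pi.smul_apply, Pi.add_apply, Finset.sum_apply, Pi.mul_apply, smul_eq_mul]
  rw [stiff_form p (fun a => dcomp v a p) fun a => dcomp v a p, sum_dcomp_sq hv]
  have h := sum_quad fun I J i j => γ I J i j p * (dcomp v (I, i) p * dcomp v (J, j) p)
  simp only [Prod.mk.eta] at h
  rw [h, energyDensity, norm_sq_eq_sum, divergence_eq v, Finset.sum_apply]
  simp only [dcomp, ← mul_assoc, comp]
  ring

theorem elasticPert_apply (hv : Smooth v) (p : SpaceTime) (I : Fin 3) :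
    elasticPert c₁ c₂ γ v p I = comp (pd 0 (pd 0 v)) I p
      - ∑ i : Fin 3, ∑ b, stiff c₁ c₂ γ (I, i) b p * pd i.succ (dcomp v b) p := by
  have h1 : ∑ i : Fin 3, ∑ b, stiff c₁ c₂ γ (I, i) b p * pd i.succ (dcomp v b) p
      = c₂ ^ 2 * (∑ k : Fin 3, pd k.succ (pd k.succ v) p I)
        + (c₁ ^ 2 - c₂ ^ 2) * (∑ k : Fin 3, pd I.succ (dcomp v (k, k)) p)
        - ∑ J : Fin 3, ∑ j : Fin 3, ∑ k : Fin 3,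
            γ I J j k p * pd j.succ (pd k.succ (comp v J)) p := by
    have h2 : ∑ J : Fin 3, ∑ j : Fin 3, ∑ k : Fin 3,
        γ I J j k p * pd j.succ (pd k.succ (comp v J)) p
        = ∑ i : Fin 3, ∑ b : Fin 3 × Fin 3, γ I b.1 i b.2 p * pd i.succ (dcomp v b) p := by
      simp only [Fintype.sum_prod_type, dcomp]
      rw [Finset.sum_comm]
    rw [h2]
    simp only [stiff, Pi.sub_apply, sub_mul, add_mul, Finset.sum_sub_distrib,
      Finset.sum_add_distrib]
    congr 1
    congr 1
    · rw [Finset.mul_sum]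
      refine Finset.sum_congr rfl fun k _ => ?_
      simp only [ite_mul, zero_mul, Finset.sum_ite_eq, Finset.mem_univ, if_true]
      rw [pd_dcomp hv, dcomp_apply (hv.pd _), pd_comm hv]
    · simp only [Fintype.sum_prod_type, Finset.mul_sum]
      fin_cases I <;> simp [Fin.sum_univ_three] <;> ring
  have h3 : ∀ I : Fin 3, pd I.succ (∑ k : Fin 3, dcomp v (k, k))
      = ∑ k : Fin 3, pd I.succ (dcomp v (k, k)) := fun I => pd_sum (fun k _ => hv.dcomp _) _
  rw [h1, elasticPert, elastic, divergence_eq v]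
  simp only [h3]
  simp [comp]
  ring

/-- The fluxes in the energy identity. -/
def flux (c₁ c₂ : ℝ) (γ : Coeff) (v : SpaceTime → E3) (i : Fin 3) : SpaceTime → ℝ :=
  ∑ I : Fin 3, ∑ b, stiff c₁ c₂ γ (I, i) b * (dcomp v b * comp (pd 0 v) I)

/-- The error term in the energy identity. -/
def energyErr (γ : Coeff) (v : SpaceTime → E3) : SpaceTime → ℝ :=
  ∑ a : Fin 3 × Fin 3, ∑ b : Fin 3 × Fin 3,
    (pd a.2.succ (γ a.1 b.1 a.2 b.2) * (dcomp v b * comp (pd 0 v) a.1)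
      - (1 / 2 : ℝ) • (pd 0 (γ a.1 b.1 a.2 b.2) * (dcomp v a * dcomp v b)))

/-- Differentiating the quadratic form in `∂v` gives, by symmetry, twice the term in which `∂_t`
hits one factor. This equals a divergence minus the divergence-form part of the operator tested with
`∂_t v`; derivatives falling on `γ` are collected in `energyErr`. -/
theorem pd_energyDensity (hγ : ∀ I J j k, Smooth (γ I J j k)) (hv : Smooth v) {p : SpaceTime}
    (hsymm : ∀ a b, stiff c₁ c₂ γ a b p = stiff c₁ c₂ γ b a p) :
    pd 0 (energyDensity c₁ c₂ γ v) p = inner ℝ (pd 0 v p) (elasticPert c₁ c₂ γ v p)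
      + energyErr γ v p + ∑ i : Fin 3, pd i.succ (flux c₁ c₂ γ v i) p := by
  have sS := stiff_smooth (c₁ := c₁) (c₂ := c₂) hγ
  have sd := hv.dcomp
  have st := fun I => (hv.pd 0).comp I
  have e1 : pd 0 (energyDensity c₁ c₂ γ v) p
      = ∑ I : Fin 3, comp (pd 0 v) I p * comp (pd 0 (pd 0 v)) I p
      + (1 / 2) * (-(∑ a, ∑ b, pd 0 (γ a.1 b.1 a.2 b.2) p * (dcomp v a p * dcomp v b p))
        + (∑ a, ∑ b, stiff c₁ c₂ γ a b p * (dcomp (pd 0 v) a p * dcomp v b p)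
        + ∑ a, ∑ b, stiff c₁ c₂ γ a b p * (dcomp v a p * dcomp (pd 0 v) b p))) := by
    have s1 : ∀ I ∈ (Finset.univ : Finset (Fin 3)),
        Smooth (comp (pd 0 v) I * comp (pd 0 v) I) := fun I _ => (st I).times (st I)
    have s2 : ∀ a b, Smooth (stiff c₁ c₂ γ a b * (dcomp v a * dcomp v b)) :=
      fun a b => (sS a b).times ((sd a).times (sd b))
    have s3 : ∀ a, Smooth (∑ b, stiff c₁ c₂ γ a b * (dcomp v a * dcomp v b)) :=
      fun a => Smooth.sum fun b _ => s2 a b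
    have h1 : ∀ I, pd 0 (comp (pd 0 v) I * comp (pd 0 v) I) p
        = 2 * (comp (pd 0 v) I p * comp (pd 0 (pd 0 v)) I p) := fun I => by
      rw [pd_mul (st I) (st I), pd_comp (hv.pd 0)]
      simp only [Pi.add_apply, Pi.mul_apply]
      ring
    have h2 : ∀ a b, pd 0 (stiff c₁ c₂ γ a b * (dcomp v a * dcomp v b)) p
        = -(pd 0 (γ a.1 b.1 a.2 b.2) p * (dcomp v a p * dcomp v b p))
        + (stiff c₁ c₂ γ a b p * (dcomp (pd 0 v) a p * dcomp v b p)
        + stiff c₁ c₂ γ a b p * (dcomp v a p * dcomp (pd 0 v) b p)) := fun a b => by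
      rw [pd_mul (sS a b) ((sd a).times (sd b)), pd_mul (sd a) (sd b), pd_stiff hγ, pd_dcomp hv,
        pd_dcomp hv]
      simp only [Pi.add_apply, Pi.mul_apply, Pi.neg_apply]
      ring
    rw [energyDensity_eq hv, pd_const_smul ((Smooth.sum s1).plus (Smooth.sum fun a _ => s3 a)),
      pd_add (Smooth.sum s1) (Smooth.sum fun a _ => s3 a), pd_sum s1, pd_sum fun a _ => s3 a]
    simp only [Pi.smul_apply, Pi.add_apply, Finset.sum_apply, smul_eq_mul, h1,
      pd_sum fun b (_ : b ∈ Finset.univ) => s2 _ b, h2, Finset.sum_add_distrib,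
      Finset.sum_neg_distrib, ← Finset.mul_sum]
    ring
  have e2 : inner ℝ (pd 0 v p) (elasticPert c₁ c₂ γ v p)
      = ∑ I : Fin 3, comp (pd 0 v) I p * comp (pd 0 (pd 0 v)) I p
      - ∑ a : Fin 3 × Fin 3, ∑ b, stiff c₁ c₂ γ a b p
          * (pd a.2.succ (dcomp v b) p * comp (pd 0 v) a.1 p) := by
    rw [Fintype.sum_prod_type, ← Finset.sum_sub_distrib, PiLp.inner_apply]
    refine Finset.sum_congr rfl fun I _ => ?_
    simp only [RCLike.inner_apply, conj_trivial, elasticPert_apply hv, sub_mul, Finset.sum_mul]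
    rw [mul_comm (comp (pd 0 (pd 0 v)) I p)]
    congr 1
    refine Finset.sum_congr rfl fun i _ => Finset.sum_congr rfl fun b _ => ?_
    rw [mul_assoc]
    rfl
  have e3 : ∑ i : Fin 3, pd i.succ (flux c₁ c₂ γ v i) p
      = -(∑ a : Fin 3 × Fin 3, ∑ b, pd a.2.succ (γ a.1 b.1 a.2 b.2) p
          * (dcomp v b p * comp (pd 0 v) a.1 p))
        + (∑ a : Fin 3 × Fin 3, ∑ b, stiff c₁ c₂ γ a b p
            * (pd a.2.succ (dcomp v b) p * comp (pd 0 v) a.1 p)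
          + ∑ a, ∑ b, stiff c₁ c₂ γ a b p * (dcomp (pd 0 v) a p * dcomp v b p)) := by
    have s2 : ∀ (i I : Fin 3) b, Smooth (stiff c₁ c₂ γ (I, i) b
        * (dcomp v b * comp (pd 0 v) I)) := fun i I b => (sS _ b).times ((sd b).times (st I))
    have h2 : ∀ (i I : Fin 3) b, pd i.succ (stiff c₁ c₂ γ (I, i) b
        * (dcomp v b * comp (pd 0 v) I)) p
        = -(pd i.succ (γ I b.1 i b.2) p * (dcomp v b p * comp (pd 0 v) I p))
        + (stiff c₁ c₂ γ (I, i) b p * (pd i.succ (dcomp v b) p * comp (pd 0 v) I p)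
        + stiff c₁ c₂ γ (I, i) b p * (dcomp (pd 0 v) (I, i) p * dcomp v b p)) := fun i I b => by
      rw [pd_mul (sS _ b) ((sd b).times (st I)), pd_mul (sd b) (st I), pd_stiff hγ]
      simp only [Pi.add_apply, Pi.mul_apply, Pi.neg_apply, dcomp]
      ring
    simp only [flux]
    simp only [pd_sum fun I (_ : I ∈ Finset.univ) => Smooth.sum fun b (_ : b ∈ Finset.univ) =>
      s2 _ I b, pd_sum fun b (_ : b ∈ Finset.univ) => s2 _ _ b, Finset.sum_apply, h2]
    rw [Finset.sum_comm, ← Finset.sum_add_distrib, ← Finset.sum_neg_distrib,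
      ← Finset.sum_add_distrib, Fintype.sum_prod_type]
    refine Finset.sum_congr rfl fun I _ => Finset.sum_congr rfl fun i _ => ?_
    simp only [Finset.sum_add_distrib, Finset.sum_neg_distrib]
  -- Here symmetry of the coefficients identifies the two halves of the differentiated quadratic
  -- form.
  have e4 : ∑ a, ∑ b, stiff c₁ c₂ γ a b p * (dcomp v a p * dcomp (pd 0 v) b p)
      = ∑ a, ∑ b, stiff c₁ c₂ γ a b p * (dcomp (pd 0 v) a p * dcomp v b p) := by
    rw [Finset.sum_comm]
    refine Finset.sum_congr rfl fun a _ => Finset.sum_congr rfl fun b _ => ?_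
    rw [hsymm]
    ring
  have e5 : energyErr γ v p = ∑ a : Fin 3 × Fin 3, ∑ b : Fin 3 × Fin 3,
      pd a.2.succ (γ a.1 b.1 a.2 b.2) p * (dcomp v b p * comp (pd 0 v) a.1 p)
      - (1 / 2) * ∑ a, ∑ b, pd 0 (γ a.1 b.1 a.2 b.2) p * (dcomp v a p * dcomp v b p) := by
    simp [energyErr, Finset.mul_sum]
  rw [e1, e2, e3, e4, e5]
  ring

/-- The hypotheses on the coefficients `γ`, at every point. -/
structure SmallCoeff (K : Set E3) (γ : Coeff) (δ : ℝ) : Prop where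
  smooth : ∀ I J j k, Smooth (γ I J j k)
  symm : ∀ I J j k, ∀ t : ℝ, 0 ≤ t → ∀ x ∈ Kᶜ, γ I J j k (t, x) = γ J I k j (t, x)
  bound : ∀ t : ℝ, 0 ≤ t → ∀ x ∈ Kᶜ, ∑ I, ∑ J, ∑ j, ∑ k, |γ I J j k (t, x)| ≤ δ / (1 + t)
  bound_pd : ∀ t : ℝ, 0 ≤ t → ∀ x ∈ Kᶜ,
    ∑ I, ∑ J, ∑ j, ∑ k, ∑ β, |pd β (γ I J j k) (t, x)| ≤ δ / (1 + t)

theorem SmallCoeff.stiff_symm {K : Set E3} {δ : ℝ} (hγ : SmallCoeff K γ δ) {t : ℝ} (ht : 0 ≤ t)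
    {x : E3} (hx : x ∈ Kᶜ) (a b : Fin 3 × Fin 3) :
    stiff c₁ c₂ γ a b (t, x) = stiff c₁ c₂ γ b a (t, x) := by
  simp only [stiff, Pi.sub_apply, hγ.symm a.1 b.1 a.2 b.2 t ht x hx, eq_comm (a := a) (b := b),
    and_comm (a := a.1 = a.2)]

theorem abs_sum_sum_mul_le {ι : Type*} [Fintype ι] {g z : ι → ι → ℝ} {G S : ℝ} (hS : 0 ≤ S)
    (hg : ∑ a, ∑ b, |g a b| ≤ G) (hz : ∀ a b, |z a b| ≤ S) :
    |∑ a, ∑ b, g a b * z a b| ≤ G * S := by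
  refine le_trans ?_ (mul_le_mul_of_nonneg_right hg hS)
  rw [Finset.sum_mul]
  refine (Finset.abs_sum_le_sum_abs _ _).trans (Finset.sum_le_sum fun a _ => ?_)
  rw [Finset.sum_mul]
  refine (Finset.abs_sum_le_sum_abs _ _).trans (Finset.sum_le_sum fun b _ => ?_)
  rw [abs_mul]
  exact mul_le_mul_of_nonneg_left (hz a b) (abs_nonneg _)

theorem abs_mul_le_of_sq_le {x y S : ℝ} (hx : x * x ≤ S) (hy : y * y ≤ S) : |x * y| ≤ S := by
  rw [abs_le]
  constructor <;> nlinarith [sq_nonneg (x + y), sq_nonneg (x - y)]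

theorem dcomp_sq_le (hv : Smooth v) (p : SpaceTime) (a : Fin 3 × Fin 3) :
    dcomp v a p * dcomp v a p ≤ ∑ k : Fin 3, ‖pd k.succ v p‖ ^ 2 := by
  rw [← sum_dcomp_sq hv]
  exact Finset.single_le_sum (f := fun a => dcomp v a p * dcomp v a p)
    (fun a _ => mul_self_nonneg _) (Finset.mem_univ a)

theorem energyDensity_ge (h12 : c₂ ^ 2 ≤ c₁ ^ 2) (hv : Smooth v) {p : SpaceTime} {d : ℝ}
    (hd : ∑ I, ∑ J, ∑ j, ∑ k, |γ I J j k p| ≤ d) :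
    1 / 2 * ‖pd 0 v p‖ ^ 2 + (c₂ ^ 2 - d) / 2 * ∑ k : Fin 3, ‖pd k.succ v p‖ ^ 2
      ≤ energyDensity c₁ c₂ γ v p := by
  rw [← sum_quad fun I J j k => |γ I J j k p|] at hd
  have h1 := abs_sum_sum_mul_le (g := fun a b : Fin 3 × Fin 3 => γ a.1 b.1 a.2 b.2 p)
    (z := fun a b => dcomp v a p * dcomp v b p) (Finset.sum_nonneg fun k _ => sq_nonneg _) hd
    fun a b => abs_mul_le_of_sq_le (dcomp_sq_le hv p a) (dcomp_sq_le hv p b)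
  have h2 := (abs_le.1 h1).2
  have h3 := mul_nonneg (sub_nonneg.2 h12) (mul_self_nonneg (∑ I : Fin 3, dcomp v (I, I) p))
  rw [energyDensity_eq hv]
  simp only [Pi.smul_apply, Pi.add_apply, Finset.sum_apply, Pi.mul_apply, smul_eq_mul]
  rw [stiff_form p (fun a => dcomp v a p) fun a => dcomp v a p, sum_dcomp_sq hv, norm_sq_eq_sum]
  have e0 : ∑ I : Fin 3, comp (pd 0 v) I p * comp (pd 0 v) I p
      = ∑ I : Fin 3, pd 0 v p I * pd 0 v p I := rfl
  rw [e0]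
  linarith

/-- The squared norm of the full gradient. -/
theorem sum_norm_sq_succ (p : SpaceTime) : ∑ β : Fin 4, ‖pd β v p‖ ^ 2
    = ‖pd 0 v p‖ ^ 2 + ∑ k : Fin 3, ‖pd k.succ v p‖ ^ 2 :=
  Fin.sum_univ_succ fun β : Fin 4 => ‖pd β v p‖ ^ 2

/-- The perturbation consumes at most half of `c₂²`, leaving the coefficient `(c₂² - c₂²/2)/2 =
c₂²/4` in front of `|∇v|²`; the term with `(∇·v)²` is nonnegative. -/
theorem energyDensity_coercive (h12 : c₂ ^ 2 ≤ c₁ ^ 2) (hv : Smooth v) {p : SpaceTime}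
    (hd : ∑ I, ∑ J, ∑ j, ∑ k, |γ I J j k p| ≤ c₂ ^ 2 / 2) :
    min (1 / 2) (c₂ ^ 2 / 4) * ∑ β : Fin 4, ‖pd β v p‖ ^ 2 ≤ energyDensity c₁ c₂ γ v p := by
  refine le_trans ?_ (energyDensity_ge h12 hv hd)
  rw [sum_norm_sq_succ, mul_add]
  refine add_le_add (mul_le_mul_of_nonneg_right (min_le_left _ _) (sq_nonneg _))
    (mul_le_mul_of_nonneg_right ((min_le_right _ _).trans (le_of_eq (by ring)))
      (Finset.sum_nonneg fun k _ => sq_nonneg _))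

/-- All products of two first derivatives are at most `|v'|²`. The factor `3/2` adds the weights `1`
and `1/2` of the two terms of the error. -/
theorem abs_energyErr_le (hv : Smooth v) {p : SpaceTime} {d : ℝ}
    (hd : ∑ I, ∑ J, ∑ j, ∑ k, ∑ β, |pd β (γ I J j k) p| ≤ d) :
    |energyErr γ v p| ≤ d * (3 / 2 * ∑ β : Fin 4, ‖pd β v p‖ ^ 2) := by
  rw [← sum_quad fun I J j k => ∑ β, |pd β (γ I J j k) p|] at hd
  set S := ∑ β : Fin 4, ‖pd β v p‖ ^ 2 with hS
  have hS1 := sum_norm_sq_succ (v := v) p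
  have hS0 : 0 ≤ S := Finset.sum_nonneg fun k _ => sq_nonneg _
  have h1 : ∀ a, dcomp v a p * dcomp v a p ≤ S := fun a =>
    (dcomp_sq_le hv p a).trans (by rw [hS, hS1]; exact le_add_of_nonneg_left (sq_nonneg _))
  have h2 : ∀ I, comp (pd 0 v) I p * comp (pd 0 v) I p ≤ S := fun I => by
    have h3 : comp (pd 0 v) I p * comp (pd 0 v) I p ≤ ‖pd 0 v p‖ ^ 2 := by
      rw [norm_sq_eq_sum]
      exact Finset.single_le_sum (f := fun I => pd 0 v p I * pd 0 v p I)
        (fun I _ => mul_self_nonneg _) (Finset.mem_univ I)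
    refine h3.trans ?_
    rw [hS, hS1]
    exact le_add_of_nonneg_right (Finset.sum_nonneg fun k _ => sq_nonneg _)
  simp only [energyErr, Finset.sum_apply, Pi.sub_apply, Pi.mul_apply, Pi.smul_apply, smul_eq_mul]
  refine le_trans ?_ (mul_le_mul_of_nonneg_right hd (by positivity))
  rw [Finset.sum_mul]
  refine (Finset.abs_sum_le_sum_abs _ _).trans (Finset.sum_le_sum fun a _ => ?_)
  rw [Finset.sum_mul]
  refine (Finset.abs_sum_le_sum_abs _ _).trans (Finset.sum_le_sum fun b _ => ?_)
  have h4 : ∀ β : Fin 4, |pd β (γ a.1 b.1 a.2 b.2) p| ≤ ∑ β, |pd β (γ a.1 b.1 a.2 b.2) p| :=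
    fun β => Finset.single_le_sum (f := fun β => |pd β (γ a.1 b.1 a.2 b.2) p|)
      (fun _ _ => abs_nonneg _) (Finset.mem_univ β)
  have h5 : ∀ (β : Fin 4) (z : ℝ), |z| ≤ S → |pd β (γ a.1 b.1 a.2 b.2) p * z|
      ≤ (∑ β, |pd β (γ a.1 b.1 a.2 b.2) p|) * S := fun β z hz => by
    rw [abs_mul]
    exact mul_le_mul (h4 β) hz (abs_nonneg _) ((abs_nonneg _).trans (h4 0))
  have h6 := h5 a.2.succ _ (abs_mul_le_of_sq_le (h1 b) (h2 a.1))
  have h7 := h5 0 _ (abs_mul_le_of_sq_le (h1 a) (h1 b))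
  refine (abs_sub _ _).trans ?_
  rw [abs_mul (1 / 2 : ℝ), abs_of_pos (by norm_num : (0 : ℝ) < 1 / 2)]
  linarith

end Pointwise

/-! ### The integrated energy inequality and coercivity. -/

section EnergyInequality

variable {K : Set E3} {v : SpaceTime → E3} {c₁ c₂ δ : ℝ} {γ : Coeff}

theorem Tame.times {f g : SpaceTime → ℝ} (hf : Tame K f) (hg : Smooth g) : Tame K (g * f) :=
  hf.smul hg

theorem Tame.comp (hv : Tame K v) (J : Fin 3) : Tame K (comp v J) := by
  rw [comp_eq_clm]
  exact hv.clm _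

theorem Tame.dcomp (hK : IsSmoothObstacle K) (hv : Tame K v) (a : Fin 3 × Fin 3) :
    Tame K (dcomp v a) :=
  (Tame.comp hv _).pd hK _

theorem elasticPert_eq_sum (v : SpaceTime → E3) : elasticPert c₁ c₂ γ v = elastic c₁ c₂ v
    + ∑ I : Fin 3, fun p => ContinuousLinearMap.toSpanSingleton ℝ (EuclideanSpace.single I (1 : ℝ))
      ((∑ J : Fin 3, ∑ j : Fin 3, ∑ k : Fin 3,
        γ I J j k * pd j.succ (pd k.succ (comp v J))) p) := by
  funext p
  ext I
  simp [elasticPert, Finset.sum_apply, Pi.single_apply]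

theorem Tame.elasticPert (hK : IsSmoothObstacle K) (hγ : ∀ I J j k, Smooth (γ I J j k))
    (hv : Tame K v) : Tame K (elasticPert c₁ c₂ γ v) := by
  rw [elasticPert_eq_sum, elastic_eq hv.smooth]
  refine Tame.add (((hv.pd hK _).pd hK _).sub (hv.lame hK)) (Tame.sum fun I _ => Tame.clm ?_ _)
  refine Tame.sum fun J _ => Tame.sum fun j _ => Tame.sum fun k _ => Tame.times ?_ (hγ _ _ _ _)
  exact ((Tame.comp hv J).pd hK _).pd hK _

theorem Smooth.elasticPert (hγ : ∀ I J j k, Smooth (γ I J j k))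
    (hv : Smooth v) : Smooth (elasticPert c₁ c₂ γ v) := by
  rw [elasticPert_eq_sum]
  refine hv.elastic.plus (Smooth.sum fun I _ => Smooth.clm ?_ _)
  refine Smooth.sum fun J _ => Smooth.sum fun j _ => Smooth.sum fun k _ =>
    (hγ _ _ _ _).times ?_
  exact ((hv.comp J).pd _).pd _

theorem Tame.energyDensity (hK : IsSmoothObstacle K) (hγ : ∀ I J j k, Smooth (γ I J j k))
    (hv : Tame K v) : Tame K (energyDensity c₁ c₂ γ v) := by
  rw [energyDensity_eq hv.smooth]
  have ht := hv.pd hK 0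
  refine Tame.csmul (Tame.add (Tame.sum fun I _ => ?_) (Tame.sum fun a _ => Tame.sum fun b _ => ?_)) _
  · exact (Tame.comp ht I).times (Smooth.comp ht.smooth I)
  · exact ((Tame.dcomp hK hv b).times (Smooth.dcomp hv.smooth a)).times (stiff_smooth hγ a b)

theorem Tame.energyErr (hK : IsSmoothObstacle K) (hγ : ∀ I J j k, Smooth (γ I J j k))
    (hv : Tame K v) : Tame K (energyErr γ v) := by
  have ht := hv.pd hK 0
  refine Tame.sum fun a _ => Tame.sum fun b _ => Tame.sub ?_ (Tame.csmul ?_ _)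
  · exact ((Tame.comp ht a.1).times (Smooth.dcomp hv.smooth b)).times ((hγ _ _ _ _).pd _)
  · exact ((Tame.dcomp hK hv b).times (Smooth.dcomp hv.smooth a)).times ((hγ _ _ _ _).pd _)

theorem Tame.flux (hK : IsSmoothObstacle K) (hγ : ∀ I J j k, Smooth (γ I J j k))
    (hv : Tame K v) (i : Fin 3) : Tame K (flux c₁ c₂ γ v i) :=
  Tame.sum fun I _ => Tame.sum fun b _ => ((Tame.comp (hv.pd hK 0) I).times
    (Smooth.dcomp hv.smooth b)).times (stiff_smooth hγ _ _)

/-- The energy inequality. -/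
theorem energy_deriv_le (hK : IsSmoothObstacle K) (hγ : SmallCoeff K γ δ) (hv : Adm K v) {t : ℝ}
    (ht : 0 ≤ t) : ∫ x in Kᶜ, pd 0 (energyDensity c₁ c₂ γ v) (t, x)
      ≤ nrm K (pd 0 v) t * nrm K (elasticPert c₁ c₂ γ v) t
        + δ / (1 + t) * (3 / 2 * ∑ β : Fin 4, nrm K (pd β v) t ^ 2) := by
  have hvt := hv.toTame
  have hs := hvt.smooth
  have hL := Tame.elasticPert (c₁ := c₁) (c₂ := c₂) hK hγ.smooth hvt
  have hE := Tame.energyErr hK hγ.smooth hvt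
  have hF := Tame.flux (c₁ := c₁) (c₂ := c₂) hK hγ.smooth hvt
  have hd := hvt.pd hK
  have h1 : ∫ x in Kᶜ, pd 0 (energyDensity c₁ c₂ γ v) (t, x)
      = ∫ x in Kᶜ, (inner ℝ (pd 0 v (t, x)) (elasticPert c₁ c₂ γ v (t, x))
        + energyErr γ v (t, x) + ∑ i : Fin 3, pd i.succ (flux c₁ c₂ γ v i) (t, x)) :=
    MeasureTheory.setIntegral_congr_fun hK.measurableSet_compl fun x hx =>
      pd_energyDensity hγ.smooth hs fun a b => hγ.stiff_symm ht hx a b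
  have i1 := (Tame.inner (hd 0) hL.smooth).integrable hK ht
  have i2 := hE.integrable hK ht
  have i3 := fun i : Fin 3 => ((hF i).pd hK i.succ).integrable hK ht
  -- Every flux contains a factor `∂_t v`, which vanishes on `∂K` along with `v`.
  have h2 : ∀ i : Fin 3, ∫ x in Kᶜ, pd i.succ (flux c₁ c₂ γ v i) (t, x) = 0 := fun i => by
    obtain ⟨R, hR⟩ := (hF i).supp t ht
    refine integral_pd_succ_eq_zero hK (hF i).smooth (fun x hx => ?_)
      (fun x hx hxR => hR t ⟨ht, le_rfl⟩ x hx hxR) i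
    have h3 : pd 0 v (t, x) = 0 := (hv.pd_zero hK).bdry t ht x hx
    simp [ExteriorElastic.flux, ExteriorElastic.comp, h3]
  have h4 : ∫ x in Kᶜ, energyErr γ v (t, x)
      ≤ δ / (1 + t) * (3 / 2 * ∑ β : Fin 4, nrm K (pd β v) t ^ 2) := by
    have h5 : δ / (1 + t) * (3 / 2 * ∑ β : Fin 4, nrm K (pd β v) t ^ 2)
        = ∫ x in Kᶜ, δ / (1 + t) * (3 / 2 * ∑ β : Fin 4, ‖pd β v (t, x)‖ ^ 2) := by
      simp only [MeasureTheory.integral_const_mul, sq_nrm]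
      rw [MeasureTheory.integral_finsetSum _ fun β _ => (hd β).norm_sq.integrable hK ht]
    rw [h5]
    refine MeasureTheory.setIntegral_mono_on i2 ?_ hK.measurableSet_compl fun x hx => ?_
    · refine ((MeasureTheory.integrable_finsetSum _ fun β _ =>
        (hd β).norm_sq.integrable hK ht).const_mul _).const_mul _
    · exact (le_abs_self _).trans (abs_energyErr_le hs (hγ.bound_pd t ht x hx))
  have i12 : MeasureTheory.IntegrableOn (fun x => inner ℝ (pd 0 v (t, x))
      (elasticPert c₁ c₂ γ v (t, x)) + energyErr γ v (t, x)) Kᶜ := i1.add i2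
  rw [h1, MeasureTheory.integral_add i12 (MeasureTheory.integrable_finsetSum _
    fun i _ => i3 i), MeasureTheory.integral_add i1 i2,
    MeasureTheory.integral_finsetSum _ fun i _ => i3 i]
  simp only [h2, Finset.sum_const_zero, add_zero]
  exact add_le_add ((le_abs_self _).trans (abs_integral_inner_le hK (hd 0) hL ht)) h4

theorem energy_coercive (hK : IsSmoothObstacle K) (h12 : c₂ ^ 2 ≤ c₁ ^ 2)
    (hγ : SmallCoeff K γ δ) (hδ : 0 ≤ δ) (hδ₂ : δ ≤ c₂ ^ 2 / 2) (hv : Tame K v) {t : ℝ}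
    (ht : 0 ≤ t) : min (1 / 2) (c₂ ^ 2 / 4) * ∑ β : Fin 4, nrm K (pd β v) t ^ 2
      ≤ ∫ x in Kᶜ, energyDensity c₁ c₂ γ v (t, x) := by
  have hd := hv.pd hK
  have h5 : min (1 / 2) (c₂ ^ 2 / 4) * ∑ β : Fin 4, nrm K (pd β v) t ^ 2
      = ∫ x in Kᶜ, min (1 / 2) (c₂ ^ 2 / 4) * ∑ β : Fin 4, ‖pd β v (t, x)‖ ^ 2 := by
    simp only [MeasureTheory.integral_const_mul, sq_nrm]
    rw [MeasureTheory.integral_finsetSum _ fun β _ => (hd β).norm_sq.integrable hK ht]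
  rw [h5]
  refine MeasureTheory.setIntegral_mono_on ?_ ((Tame.energyDensity hK hγ.smooth hv).integrable hK ht)
    hK.measurableSet_compl fun x hx => ?_
  · exact (MeasureTheory.integrable_finsetSum _ fun β _ =>
      (hd β).norm_sq.integrable hK ht).const_mul _
  · refine energyDensity_coercive h12 hv.smooth ((hγ.bound t ht x hx).trans ?_)
    exact (div_le_self hδ (by linarith)).trans hδ₂

end EnergyInequality

end

end ExteriorElastic

namespace ExteriorElastic

noncomputable section

/-! ### Gronwall's inequality for the energies, and the conclusion -/

section Gronwall

/-- The function `(1+s)^{-a} √Y - ∫ g` is nonincreasing: the weight cancels the term `a/(1+s) √Y`,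
and since it is at most `1` it may be dropped in front of `g ≥ 0`. Positivity of `Y` makes the
square root differentiable. -/
theorem sqrt_le_of_deriv_le_of_pos {Y Y' g : ℝ → ℝ} {a : ℝ} (hY : ∀ t, 0 ≤ t → 0 < Y t)
    (hd : ∀ t, 0 ≤ t → HasDerivWithinAt Y (Y' t) (Set.Ici 0) t) (hg : Continuous g)
    (hg0 : ∀ t, 0 ≤ g t) (ha : 0 ≤ a)
    (h : ∀ t, 0 ≤ t → Y' t ≤ 2 * √(Y t) * g t + 2 * (a / (1 + t)) * Y t) {t : ℝ} (ht : 0 ≤ t) :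
    √(Y t) ≤ (1 + t) ^ a * (√(Y 0) + ∫ s in (0 : ℝ)..t, g s) := by
  have hp : ∀ s : ℝ, 0 ≤ s → 0 < 1 + s := fun s hs => by linarith
  have hder : ∀ s, 0 ≤ s → HasDerivWithinAt
      (fun s => (1 + s) ^ (-a) * √(Y s) - ∫ r in (0 : ℝ)..s, g r)
      (-a * (1 + s) ^ (-a - 1) * √(Y s) + (1 + s) ^ (-a) * (Y' s / (2 * √(Y s))) - g s)
      (Set.Ici 0) s := by
    intro s hs
    have h1 : HasDerivWithinAt (fun s : ℝ => (1 + s) ^ (-a)) (-a * (1 + s) ^ (-a - 1))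
        (Set.Ici 0) s := by
      have := (((hasDerivAt_id s).const_add 1).rpow_const (p := -a) (Or.inl (hp s hs).ne'))
      simpa [mul_comm] using this.hasDerivWithinAt
    have h2 := (hd s hs).sqrt (hY s hs).ne'
    have h3 : HasDerivWithinAt (fun s => ∫ r in (0 : ℝ)..s, g r) (g s) (Set.Ici 0) s :=
      (intervalIntegral.integral_hasDerivAt_right (hg.intervalIntegrable _ _)
        hg.aestronglyMeasurable.stronglyMeasurableAtFilter hg.continuousAt).hasDerivWithinAt
    exact (h1.mul h2).sub h3
  have hle : ∀ s, 0 ≤ s →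
      -a * (1 + s) ^ (-a - 1) * √(Y s) + (1 + s) ^ (-a) * (Y' s / (2 * √(Y s))) - g s ≤ 0 := by
    intro s hs
    have hq : 0 < √(Y s) := Real.sqrt_pos.2 (hY s hs)
    have hY2 : Y s = √(Y s) * √(Y s) := (Real.mul_self_sqrt (hY s hs).le).symm
    have e1 : Y' s / (2 * √(Y s)) ≤ g s + a / (1 + s) * √(Y s) := by
      rw [div_le_iff₀ (by positivity)]
      refine (h s hs).trans (le_of_eq ?_)
      nth_rw 2 [hY2]
      ring
    have e2 : (1 + s) ^ (-a - 1) = (1 + s) ^ (-a) / (1 + s) := Real.rpow_sub_one (hp s hs).ne' _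
    have e3 : (1 + s) ^ (-a) ≤ 1 := Real.rpow_le_one_of_one_le_of_nonpos (by linarith) (by linarith)
    have e4 : 0 ≤ (1 + s) ^ (-a) := Real.rpow_nonneg (hp s hs).le _
    have e5 := mul_le_mul_of_nonneg_left e1 e4
    have e6 := mul_le_mul_of_nonneg_right e3 (hg0 s)
    rw [e2]
    have e7 : -a * ((1 + s) ^ (-a) / (1 + s)) * √(Y s)
        = -((1 + s) ^ (-a) * (a / (1 + s) * √(Y s))) := by ring
    rw [e7]
    rw [mul_add] at e5
    linarith
  have hanti : AntitoneOn (fun s => (1 + s) ^ (-a) * √(Y s) - ∫ r in (0 : ℝ)..s, g r)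
      (Set.Ici 0) := by
    refine antitoneOn_of_hasDerivWithinAt_nonpos (convex_Ici 0)
      (fun s hs => (hder s hs).continuousWithinAt) (fun s hs => ?_) (fun s hs => ?_)
      (f' := fun s => -a * (1 + s) ^ (-a - 1) * √(Y s) + (1 + s) ^ (-a) * (Y' s / (2 * √(Y s)))
        - g s)
    · exact (hder s (interior_subset hs)).mono interior_subset
    · exact hle s (interior_subset hs)
  have h0 := hanti (Set.mem_Ici.2 le_rfl) (Set.mem_Ici.2 ht) ht
  simp only [add_zero, Real.one_rpow, one_mul, intervalIntegral.integral_same, sub_zero] at h0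
  have h1 : (1 + t) ^ (-a) * √(Y t) ≤ √(Y 0) + ∫ r in (0 : ℝ)..t, g r := by linarith
  have h2 := mul_le_mul_of_nonneg_left h1 (Real.rpow_nonneg (hp t ht).le a)
  rw [← mul_assoc, ← Real.rpow_add (hp t ht), add_neg_cancel, Real.rpow_zero, one_mul] at h2
  exact h2

/-- A Gronwall inequality for the square root of a nonnegative function. -/
theorem sqrt_le_of_deriv_le {Y Y' g : ℝ → ℝ} {a : ℝ} (hY : ∀ t, 0 ≤ t → 0 ≤ Y t)
    (hd : ∀ t, 0 ≤ t → HasDerivWithinAt Y (Y' t) (Set.Ici 0) t) (hg : Continuous g)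
    (hg0 : ∀ t, 0 ≤ g t) (ha : 0 ≤ a)
    (h : ∀ t, 0 ≤ t → Y' t ≤ 2 * √(Y t) * g t + 2 * (a / (1 + t)) * Y t) {t : ℝ} (ht : 0 ≤ t) :
    √(Y t) ≤ (1 + t) ^ a * (√(Y 0) + ∫ s in (0 : ℝ)..t, g s) := by
  -- `Y` may have zeros, so the positive case is applied to `Y + ε` and `ε` is sent to `0`.
  have key : ∀ ε : ℝ, 0 < ε →
      √(Y t + ε) ≤ (1 + t) ^ a * (√(Y 0 + ε) + ∫ s in (0 : ℝ)..t, g s) := by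
    intro ε hε
    refine sqrt_le_of_deriv_le_of_pos (Y := fun t => Y t + ε) (Y' := Y')
      (fun s hs => add_pos_of_nonneg_of_pos (hY s hs) hε) (fun s hs => (hd s hs).add_const ε)
      hg hg0 ha (fun s hs => (h s hs).trans ?_) ht
    have h1 : √(Y s) ≤ √(Y s + ε) := Real.sqrt_le_sqrt (by linarith)
    have h2 : 0 ≤ a / (1 + s) := div_nonneg ha (by linarith)
    have h3 := hg0 s
    gcongr
    linarith
  have hc : Filter.Tendsto (fun ε : ℝ => (1 + t) ^ a * (√(Y 0 + ε) + ∫ s in (0 : ℝ)..t, g s))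
      (𝓝[>] 0) (𝓝 ((1 + t) ^ a * (√(Y 0 + 0) + ∫ s in (0 : ℝ)..t, g s))) := by
    refine Filter.Tendsto.mono_left (Continuous.tendsto ?_ 0) nhdsWithin_le_nhds
    fun_prop
  rw [add_zero] at hc
  refine ge_of_tendsto hc ?_
  filter_upwards [self_mem_nhdsWithin] with ε hε
  exact (Real.sqrt_le_sqrt (by linarith [Set.mem_Ioi.1 hε])).trans (key ε hε)

end Gronwall

/-! ### From essential supremum bounds to pointwise bounds. -/

section Hypotheses

variable {K : Set E3} {γ : Coeff}

/-- By continuity a violation at one point would persist on a nonempty open subset of `D`, which has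
positive measure. -/
theorem enorm_le_supNorm {D : Set E3} (hD : IsOpen D) {f : SpaceTime → ℝ} (hf : Smooth f) {t : ℝ}
    {x : E3} (hx : x ∈ D) : ‖f (t, x)‖ₑ ≤ supNorm D f t := by
  by_contra hc
  rw [not_le] at hc
  have h1 : ∀ᵐ y ∂(MeasureTheory.volume.restrict D), ‖f (t, y)‖ₑ ≤ supNorm D f t := by
    rw [supNorm, MeasureTheory.eLpNorm_exponent_top]
    exact MeasureTheory.enorm_ae_le_eLpNormEssSup _ _
  have ho : IsOpen (D ∩ {y | supNorm D f t < ‖f (t, y)‖ₑ}) :=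
    hD.inter (isOpen_lt continuous_const (hf.slice t).enorm)
  have h2 := ho.measure_pos MeasureTheory.volume ⟨x, hx, hc⟩
  rw [MeasureTheory.ae_restrict_iff' hD.measurableSet] at h1
  refine h2.ne' (MeasureTheory.measure_mono_null (fun y hy => ?_) (MeasureTheory.ae_iff.1 h1))
  simpa using ⟨hy.1, hy.2⟩

theorem sum_abs_le_of_supNorm_le {ι : Type*} {s : Finset ι} {D : Set E3} (hD : IsOpen D)
    {f : ι → SpaceTime → ℝ} (hf : ∀ i ∈ s, Smooth (f i)) {t c : ℝ} (hc : 0 ≤ c)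
    (h : ∑ i ∈ s, supNorm D (f i) t ≤ ENNReal.ofReal c) {x : E3} (hx : x ∈ D) :
    ∑ i ∈ s, |f i (t, x)| ≤ c := by
  rw [← ENNReal.ofReal_le_ofReal_iff hc, ENNReal.ofReal_sum_of_nonneg fun _ _ => abs_nonneg _]
  refine le_trans (Finset.sum_le_sum fun i hi => ?_) h
  rw [← Real.norm_eq_abs, ofReal_norm]
  exact enorm_le_supNorm hD (hf i hi) hx

theorem smallCoeff_of_supNorm (hK : IsSmoothObstacle K) {δ : ℝ} (hδ : 0 < δ)
    (hγ : ∀ I J j k, ContDiff ℝ ∞ (γ I J j k))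
    (hsymm : ∀ I J j k, ∀ t : ℝ, 0 ≤ t → ∀ x ∈ Kᶜ, γ I J j k (t, x) = γ J I k j (t, x))
    (h₀ : ∀ t : ℝ, 0 ≤ t → ∑ I, ∑ J, ∑ j, ∑ k, supNorm Kᶜ (γ I J j k) t
        ≤ ENNReal.ofReal (δ / (1 + t)))
    (h₁ : ∀ t : ℝ, 0 ≤ t → ∑ I, ∑ J, ∑ j, ∑ k, ∑ β, supNorm Kᶜ (pd β (γ I J j k)) t
        ≤ ENNReal.ofReal (δ / (1 + t))) : SmallCoeff K γ δ := by
  have hc : ∀ t : ℝ, 0 ≤ t → 0 ≤ δ / (1 + t) := fun t ht => div_nonneg hδ.le (by linarith)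
  refine ⟨hγ, hsymm, fun t ht x hx => ?_, fun t ht x hx => ?_⟩
  · have := sum_abs_le_of_supNorm_le hK.isOpen_compl (s := Finset.univ)
      (f := fun q : Fin 3 × Fin 3 × Fin 3 × Fin 3 => γ q.1 q.2.1 q.2.2.1 q.2.2.2)
      (fun _ _ => hγ _ _ _ _) (hc t ht) (by simpa only [Fintype.sum_prod_type] using h₀ t ht) hx
    simpa only [Fintype.sum_prod_type] using this
  · have := sum_abs_le_of_supNorm_le hK.isOpen_compl (s := Finset.univ)
      (f := fun q : Fin 3 × Fin 3 × Fin 3 × Fin 3 × Fin 4 =>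
        pd q.2.2.2.2 (γ q.1 q.2.1 q.2.2.1 q.2.2.2.1))
      (fun _ _ => Smooth.pd (hγ _ _ _ _) _) (hc t ht)
      (by simpa only [Fintype.sum_prod_type] using h₁ t ht) hx
    simpa only [Fintype.sum_prod_type] using this

end Hypotheses

/-! ### Measurability in time, needed to split integrals of sums. -/

section Measurability

variable {F : Type*} [NormedAddCommGroup F] [NormedSpace ℝ F]

theorem measurable_l2Norm (D : Set E3) {f : SpaceTime → F} (hf : Smooth f) :
    Measurable (l2Norm D f) := by
  have h : l2Norm D f = fun t => (∫⁻ x in D, ‖f (t, x)‖ₑ ^ (2 : ℝ)) ^ (1 / (2 : ℝ)) := by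
    funext t
    rw [l2Norm, MeasureTheory.eLpNorm_eq_lintegral_rpow_enorm_toReal (by norm_num) (by norm_num)]
    norm_num
  rw [h]
  refine Measurable.pow_const ?_ _
  refine Measurable.lintegral_prod_right' (f := fun p : ℝ × E3 => ‖f p‖ₑ ^ (2 : ℝ)) ?_
  exact (hf.continuous.enorm.measurable).pow_const _

theorem measurable_fnorm (D : Set E3) (a n : ℕ) {f : SpaceTime → F} (hf : Smooth f) :
    Measurable (fnorm D a n f) := by
  have h : fnorm D a n f = fun t => ∑ q ∈ fullIdx a n, l2Norm D (scal^[q.1] (pdMulti q.2 f)) t :=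
    rfl
  rw [h]
  exact Finset.measurable_sum _ fun q _ =>
    measurable_l2Norm D (scal_iterate_smooth (pdMulti_smooth hf _) _)

end Measurability

end

end ExteriorElastic

namespace ExteriorElastic

noncomputable section

/-! ### Energies of `S̃^μ ∂_t^j u` and their growth rate. -/

section EnergyGrowth

variable {K : Set E3} {η : E3 → ℝ} {c₁ c₂ δ : ℝ} {γ : Coeff} {u : SpaceTime → E3}

theorem iterate_scalMod_pd_smooth (hη : IsCutoff K η) {F : Type*} [NormedAddCommGroup F]
    [NormedSpace ℝ F] {f : SpaceTime → F} (hf : Smooth f) (μ j : ℕ) :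
    Smooth ((scalMod η)^[μ] ((pd 0)^[j] f)) :=
  scalMod_iterate_smooth hη (pd_iterate_smooth hf 0 j) μ

theorem iterate_scalMod_pd_sum (hη : IsCutoff K η) {F : Type*} [NormedAddCommGroup F]
    [NormedSpace ℝ F] {ι : Type*} {s : Finset ι} {f : ι → SpaceTime → F}
    (hf : ∀ i ∈ s, Smooth (f i)) (μ j : ℕ) : (scalMod η)^[μ] ((pd 0)^[j] (∑ i ∈ s, f i))
      = ∑ i ∈ s, (scalMod η)^[μ] ((pd 0)^[j] (f i)) := by
  classical
  induction s using Finset.induction_on with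
  | empty =>
    have := iterate_scalMod_pd_clm hη (f := (0 : SpaceTime → F)) contDiff_const
      (0 : F →L[ℝ] F) μ j
    simp only [_root_.zero_apply] at this
    rw [Finset.sum_empty, Finset.sum_empty]
    exact this
  | insert i s hi ih =>
    rw [Finset.sum_insert hi, Finset.sum_insert hi, iterate_scalMod_pd_add hη (hf i (by simp))
      (Smooth.sum fun j hj => hf j (by simp [hj])), ih fun j hj => hf j (by simp [hj])]

/-- The embedding of the component `I` of a vector. -/
def vecSingle (I : Fin 3) : ℝ →L[ℝ] E3 :=
  ContinuousLinearMap.toSpanSingleton ℝ (EuclideanSpace.single I (1 : ℝ))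

theorem norm_vecSingle (I : Fin 3) (c : ℝ) : ‖vecSingle I c‖ = |c| := by
  simp [vecSingle, norm_smul]

/-- The perturbation `γ^{IJ,jk} ∂_j ∂_k u^J`. -/
def pert (γ : Coeff) (u : SpaceTime → E3) : SpaceTime → E3 :=
  ∑ I : Fin 3, fun p => vecSingle I ((∑ J : Fin 3, ∑ j : Fin 3, ∑ k : Fin 3,
    γ I J j k * pd j.succ (pd k.succ (comp u J))) p)

theorem elasticPert_eq (u : SpaceTime → E3) :
    elasticPert c₁ c₂ γ u = elastic c₁ c₂ u + pert γ u := elasticPert_eq_sum u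

theorem pert_smooth (hγ : ∀ I J j k, Smooth (γ I J j k)) (hu : Smooth u) :
    Smooth (pert γ u) :=
  Smooth.sum fun _ _ => Smooth.clm (Smooth.sum fun J _ => Smooth.sum fun _ _ =>
    Smooth.sum fun _ _ => (hγ _ _ _ _).times (((hu.comp J).pd _).pd _)) _

/-- `S̃^μ ∂_t^j` is linear and acts componentwise, so the vector commutator splits into the scalar
commutators summed in `commSum`, up to the triangle inequality. -/
theorem norm_comm_pert_le (hη : IsCutoff K η) (hγ : ∀ I J j k, Smooth (γ I J j k))
    (hu : Smooth u) (μ j : ℕ) (p : SpaceTime) :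
    ‖((scalMod η)^[μ] ((pd 0)^[j] (pert γ u)) - pert γ ((scalMod η)^[μ] ((pd 0)^[j] u))) p‖
      ≤ ‖commSum (fun h => (scalMod η)^[μ] ((pd 0)^[j] h)) γ u p‖ := by
  have s1 : ∀ I J i k, Smooth (γ I J i k * pd i.succ (pd k.succ (comp u J))) := fun I J i k =>
    (hγ _ _ _ _).times (((hu.comp J).pd _).pd _)
  have s2 : ∀ I J i, Smooth (∑ k : Fin 3, γ I J i k * pd i.succ (pd k.succ (comp u J))) :=
    fun I J i => Smooth.sum fun k _ => s1 I J i k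
  have s3 : ∀ I J, Smooth (∑ i : Fin 3, ∑ k : Fin 3,
      γ I J i k * pd i.succ (pd k.succ (comp u J))) := fun I J => Smooth.sum fun i _ => s2 I J i
  have s4 : ∀ I, Smooth (∑ J : Fin 3, ∑ i : Fin 3, ∑ k : Fin 3,
      γ I J i k * pd i.succ (pd k.succ (comp u J))) := fun I => Smooth.sum fun J _ => s3 I J
  have e1 : (scalMod η)^[μ] ((pd 0)^[j] (pert γ u)) = ∑ I : Fin 3, fun p => vecSingle I
      ((∑ J : Fin 3, ∑ i : Fin 3, ∑ k : Fin 3, (scalMod η)^[μ] ((pd 0)^[j]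
        (γ I J i k * pd i.succ (pd k.succ (comp u J))))) p) := by
    rw [pert, iterate_scalMod_pd_sum hη fun I _ => (s4 I).clm _]
    refine Finset.sum_congr rfl fun I _ => ?_
    rw [iterate_scalMod_pd_clm hη (s4 I), iterate_scalMod_pd_sum hη fun J _ => s3 I J]
    simp only [iterate_scalMod_pd_sum hη fun i (_ : i ∈ Finset.univ) => s2 I _ i,
      iterate_scalMod_pd_sum hη fun k (_ : k ∈ Finset.univ) => s1 I _ _ k]
  have e2 : ∀ J, comp ((scalMod η)^[μ] ((pd 0)^[j] u)) J
      = (scalMod η)^[μ] ((pd 0)^[j] (comp u J)) := fun J =>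
    (iterate_scalMod_pd_clm hη hu (EuclideanSpace.proj J : E3 →L[ℝ] ℝ) μ j).symm
  have e3 : ((scalMod η)^[μ] ((pd 0)^[j] (pert γ u)) - pert γ ((scalMod η)^[μ] ((pd 0)^[j] u))) p
      = ∑ I : Fin 3, vecSingle I (∑ J : Fin 3, ∑ i : Fin 3, ∑ k : Fin 3,
        ((scalMod η)^[μ] ((pd 0)^[j] (γ I J i k * pd i.succ (pd k.succ (comp u J)))) p
        - γ I J i k p * pd i.succ (pd k.succ ((scalMod η)^[μ] ((pd 0)^[j] (comp u J)))) p)) := by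
    rw [e1, pert]
    simp only [Pi.sub_apply, Finset.sum_apply, Pi.mul_apply, e2, Finset.sum_sub_distrib, map_sub]
  rw [e3]
  refine (norm_sum_le _ _).trans ?_
  refine le_trans (Finset.sum_le_sum fun I _ => ?_) (le_abs_self _)
  rw [norm_vecSingle]
  refine (Finset.abs_sum_le_sum_abs _ _).trans (Finset.sum_le_sum fun J _ => ?_)
  refine (Finset.abs_sum_le_sum_abs _ _).trans (Finset.sum_le_sum fun i _ => ?_)
  exact Finset.abs_sum_le_sum_abs _ _

/-- With `P = S̃^μ ∂_t^j` this is the triangle inequality for `L_γ P u = P L_γ u - [P, γ∂∂]u + [L,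
P]u`. -/
theorem l2Norm_elasticPert_iterate_le (hK : IsSmoothObstacle K) (hη : IsCutoff K η)
    (hγ : ∀ I J j k, Smooth (γ I J j k)) (hu : Smooth u) (μ j : ℕ) (t : ℝ) :
    l2Norm Kᶜ (elasticPert c₁ c₂ γ ((scalMod η)^[μ] ((pd 0)^[j] u))) t
      ≤ l2Norm Kᶜ ((scalMod η)^[μ] ((pd 0)^[j] (elasticPert c₁ c₂ γ u))) t
        + l2Norm Kᶜ (commSum (fun h => (scalMod η)^[μ] ((pd 0)^[j] h)) γ u) t
        + l2Norm Kᶜ (elastic c₁ c₂ ((scalMod η)^[μ] ((pd 0)^[j] u))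
          - (scalMod η)^[μ] ((pd 0)^[j] (elastic c₁ c₂ u))) t := by
  have it := fun {f : SpaceTime → E3} (hf : Smooth f) => iterate_scalMod_pd_smooth hη hf μ j
  have sE := hu.elastic (c₁ := c₁) (c₂ := c₂)
  have sP := pert_smooth hγ hu
  have e : elasticPert c₁ c₂ γ ((scalMod η)^[μ] ((pd 0)^[j] u))
      = ((scalMod η)^[μ] ((pd 0)^[j] (elasticPert c₁ c₂ γ u))
        + -((scalMod η)^[μ] ((pd 0)^[j] (pert γ u)) - pert γ ((scalMod η)^[μ] ((pd 0)^[j] u))))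
        + (elastic c₁ c₂ ((scalMod η)^[μ] ((pd 0)^[j] u))
          - (scalMod η)^[μ] ((pd 0)^[j] (elastic c₁ c₂ u))) := by
    rw [elasticPert_eq, elasticPert_eq, iterate_scalMod_pd_add hη sE sP]
    abel
  have h1 : Smooth ((scalMod η)^[μ] ((pd 0)^[j] (elasticPert c₁ c₂ γ u))) := it (hu.elasticPert hγ)
  have h2 := (it sP).minus (pert_smooth hγ (it hu))
  have h3 := ((it hu).elastic (c₁ := c₁) (c₂ := c₂)).minus (it sE)
  rw [e]
  refine (l2Norm_add_le (h1.plus h2.neg) h3).trans (add_le_add ?_ le_rfl)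
  refine (l2Norm_add_le h1 h2.neg).trans (add_le_add le_rfl ?_)
  refine (le_of_eq (l2Norm_neg ((scalMod η)^[μ] ((pd 0)^[j] (pert γ u))
    - pert γ ((scalMod η)^[μ] ((pd 0)^[j] u))))).trans ?_
  exact l2Norm_mono hK.measurableSet_compl fun x _ => norm_comm_pert_le hη hγ hu μ j (t, x)

/-- The sum of the energies of the functions `S̃^μ ∂_t^j u`. -/
def totalEnergy (c₁ c₂ : ℝ) (K : Set E3) (η : E3 → ℝ) (γ : Coeff) (u : SpaceTime → E3) (a n : ℕ)
    (t : ℝ) : ℝ :=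
  ∑ q ∈ timeIdx a n, energyX c₁ c₂ K η γ u q.1 q.2 t

/-- The coercivity constant of the energy. -/
def coerc (c₂ : ℝ) : ℝ := min (1 / 2) (c₂ ^ 2 / 4)

theorem coerc_pos (hc₂ : 0 < c₂ ^ 2) : 0 < coerc c₂ := lt_min (by norm_num) (by linarith)

variable (hK : IsSmoothObstacle K) (hη : IsCutoff K η) (hc₂ : 0 < c₂ ^ 2) (h12 : c₂ ^ 2 ≤ c₁ ^ 2)
  (hγ : SmallCoeff K γ δ) (hδ : 0 ≤ δ) (hδ₂ : δ ≤ c₂ ^ 2 / 2) (hu : Adm K u)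

include hK hη in
theorem adm_iterate (hu : Adm K u) (μ j : ℕ) : Adm K ((scalMod η)^[μ] ((pd 0)^[j] u)) :=
  (hu.pd_zero_iterate hK j).scalMod_iterate hK hη μ

include hK hη h12 hγ hδ hδ₂ hu

theorem coerc_mul_le_energyX (μ j : ℕ) {t : ℝ} (ht : 0 ≤ t) :
    coerc c₂ * ∑ β : Fin 4, nrm K (pd β ((scalMod η)^[μ] ((pd 0)^[j] u))) t ^ 2
      ≤ energyX c₁ c₂ K η γ u μ j t :=
  energy_coercive hK h12 hγ hδ hδ₂ (adm_iterate hK hη hu μ j).toTame ht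

include hc₂

theorem energyX_nonneg (μ j : ℕ) {t : ℝ} (ht : 0 ≤ t) : 0 ≤ energyX c₁ c₂ K η γ u μ j t :=
  le_trans (mul_nonneg (coerc_pos hc₂).le (Finset.sum_nonneg fun _ _ => sq_nonneg _))
    (coerc_mul_le_energyX hK hη h12 hγ hδ hδ₂ hu μ j ht)

theorem energyX_le_totalEnergy {a n : ℕ} {q : ℕ × ℕ} (hq : q ∈ timeIdx a n) {t : ℝ} (ht : 0 ≤ t) :
    energyX c₁ c₂ K η γ u q.1 q.2 t ≤ totalEnergy c₁ c₂ K η γ u a n t :=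
  Finset.single_le_sum (f := fun q : ℕ × ℕ => energyX c₁ c₂ K η γ u q.1 q.2 t)
    (fun _ _ => energyX_nonneg hK hη hc₂ h12 hγ hδ hδ₂ hu _ _ ht) hq

theorem nrm_pd_le_sqrt_totalEnergy {a n : ℕ} {q : ℕ × ℕ} (hq : q ∈ timeIdx a n) {t : ℝ}
    (ht : 0 ≤ t) (β : Fin 4) : nrm K (pd β ((scalMod η)^[q.1] ((pd 0)^[q.2] u))) t
      ≤ (√(coerc c₂))⁻¹ * √(totalEnergy c₁ c₂ K η γ u a n t) := by
  have h1 := (coerc_mul_le_energyX hK hη h12 hγ hδ hδ₂ hu q.1 q.2 ht).trans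
    (energyX_le_totalEnergy hK hη hc₂ h12 hγ hδ hδ₂ hu hq ht)
  have h2 : nrm K (pd β ((scalMod η)^[q.1] ((pd 0)^[q.2] u))) t ^ 2
      ≤ ∑ β : Fin 4, nrm K (pd β ((scalMod η)^[q.1] ((pd 0)^[q.2] u))) t ^ 2 :=
    Finset.single_le_sum (f := fun β : Fin 4 => nrm K (pd β ((scalMod η)^[q.1] ((pd 0)^[q.2] u))) t ^ 2)
      (fun _ _ => sq_nonneg _) (Finset.mem_univ β)
  have hc := coerc_pos hc₂
  rw [le_inv_mul_iff₀ (Real.sqrt_pos.2 hc)]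
  refine Real.le_sqrt_of_sq_le ?_
  rw [mul_pow, Real.sq_sqrt hc.le]
  exact (mul_le_mul_of_nonneg_left h2 hc.le).trans h1

theorem tnorm_le_sqrt_totalEnergy (a n : ℕ) {t : ℝ} (ht : 0 ≤ t) : tnorm K η a n u t
    ≤ ENNReal.ofReal (4 * (timeIdx a n).card * (√(coerc c₂))⁻¹)
      * ENNReal.ofReal √(totalEnergy c₁ c₂ K η γ u a n t) := by
  rw [← ENNReal.ofReal_mul (by positivity)]
  have h1 : ∀ q ∈ timeIdx a n, ∑ β : Fin 4,
      l2Norm Kᶜ (pd β ((scalMod η)^[q.1] ((pd 0)^[q.2] u))) t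
        ≤ ENNReal.ofReal (4 * ((√(coerc c₂))⁻¹ * √(totalEnergy c₁ c₂ K η γ u a n t))) := by
    intro q hq
    have h2 : ∀ β : Fin 4, l2Norm Kᶜ (pd β ((scalMod η)^[q.1] ((pd 0)^[q.2] u))) t
        = ENNReal.ofReal (nrm K (pd β ((scalMod η)^[q.1] ((pd 0)^[q.2] u))) t) := fun β =>
      ((adm_iterate hK hη hu q.1 q.2).toTame.pd hK β).l2Norm_eq hK ht
    simp only [h2]
    rw [← ENNReal.ofReal_sum_of_nonneg fun _ _ => nrm_nonneg _]
    refine ENNReal.ofReal_le_ofReal ((Finset.sum_le_sum fun β _ =>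
      nrm_pd_le_sqrt_totalEnergy hK hη hc₂ h12 hγ hδ hδ₂ hu hq ht β).trans (le_of_eq ?_))
    simp
  refine (Finset.sum_le_card_nsmul _ _ _ h1).trans (le_of_eq ?_)
  rw [nsmul_eq_mul, ← ENNReal.ofReal_natCast, ← ENNReal.ofReal_mul (by positivity)]
  congr 1
  ring

/-- The sum of the `L²` norms of `L_γ` applied to the functions `S̃^μ ∂_t^j u`. -/
def sourceNrm (c₁ c₂ : ℝ) (K : Set E3) (η : E3 → ℝ) (γ : Coeff) (u : SpaceTime → E3) (a n : ℕ)
    (t : ℝ) : ℝ :=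
  ∑ q ∈ timeIdx a n, nrm K (elasticPert c₁ c₂ γ ((scalMod η)^[q.1] ((pd 0)^[q.2] u))) t

omit h12 hδ hδ₂ hc₂ in
theorem hasDerivWithinAt_totalEnergy (a n : ℕ) {t : ℝ} (ht : 0 ≤ t) :
    HasDerivWithinAt (totalEnergy c₁ c₂ K η γ u a n) (∑ q ∈ timeIdx a n, ∫ x in Kᶜ,
      pd 0 (energyDensity c₁ c₂ γ ((scalMod η)^[q.1] ((pd 0)^[q.2] u))) (t, x)) (Set.Ici 0) t := by
  have := HasDerivWithinAt.fun_sum (u := timeIdx a n) fun q _ => hasDerivWithinAt_integral_tame hK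
    (Tame.energyDensity (c₁ := c₁) (c₂ := c₂) hK hγ.smooth
      (adm_iterate hK hη hu q.1 q.2).toTame) ht
  exact this

theorem deriv_totalEnergy_le (a n : ℕ) {t : ℝ} (ht : 0 ≤ t) : ∑ q ∈ timeIdx a n, ∫ x in Kᶜ,
      pd 0 (energyDensity c₁ c₂ γ ((scalMod η)^[q.1] ((pd 0)^[q.2] u))) (t, x)
    ≤ (√(coerc c₂))⁻¹ * √(totalEnergy c₁ c₂ K η γ u a n t) * sourceNrm c₁ c₂ K η γ u a n t
      + δ / (1 + t) * (3 / 2 * (coerc c₂)⁻¹ * totalEnergy c₁ c₂ K η γ u a n t) := by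
  have hd : 0 ≤ δ / (1 + t) := div_nonneg hδ (by linarith)
  rw [sourceNrm, Finset.mul_sum, totalEnergy, Finset.mul_sum, Finset.mul_sum, ← totalEnergy,
    ← Finset.sum_add_distrib]
  refine Finset.sum_le_sum fun q hq => ?_
  refine (energy_deriv_le hK hγ (adm_iterate hK hη hu q.1 q.2) ht).trans (add_le_add ?_ ?_)
  · exact mul_le_mul_of_nonneg_right
      (nrm_pd_le_sqrt_totalEnergy hK hη hc₂ h12 hγ hδ hδ₂ hu hq ht 0) (nrm_nonneg _)
  · refine mul_le_mul_of_nonneg_left ?_ hd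
    rw [mul_assoc]
    refine mul_le_mul_of_nonneg_left ?_ (by norm_num)
    rw [le_inv_mul_iff₀ (coerc_pos hc₂)]
    exact coerc_mul_le_energyX hK hη h12 hγ hδ hδ₂ hu q.1 q.2 ht

end EnergyGrowth

/-! ### Gronwall's inequality for the total energy. -/

section Conclusion

variable {K : Set E3} {η : E3 → ℝ} {c₁ c₂ : ℝ}

theorem ofReal_sqrt_sum_le {ι : Type*} {s : Finset ι} {f : ι → ℝ} (hf : ∀ i ∈ s, 0 ≤ f i) :
    ENNReal.ofReal √(∑ i ∈ s, f i) ≤ ∑ i ∈ s, ENNReal.ofReal √(f i) := by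
  rw [← ENNReal.ofReal_sum_of_nonneg fun _ _ => Real.sqrt_nonneg _]
  refine ENNReal.ofReal_le_ofReal (Real.sqrt_le_iff.2
    ⟨Finset.sum_nonneg fun _ _ => Real.sqrt_nonneg _, ?_⟩)
  refine le_trans (le_of_eq (Finset.sum_congr rfl fun i hi => (Real.sq_sqrt (hf i hi)).symm)) ?_
  rw [sq, Finset.sum_mul]
  refine Finset.sum_le_sum fun i hi => ?_
  rw [sq]
  exact mul_le_mul_of_nonneg_left (Finset.single_le_sum (f := fun i => √(f i))
    (fun _ _ => Real.sqrt_nonneg _) hi) (Real.sqrt_nonneg _)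

/-- The growth of the energies of `S̃^μ ∂_t^j u`. -/
theorem exists_totalEnergy_le (hK : IsSmoothObstacle K) (hη : IsCutoff K η) (hc₂ : 0 < c₂ ^ 2)
    (h12 : c₂ ^ 2 ≤ c₁ ^ 2) (ν n : ℕ) : ∃ A : ℝ, 0 < A ∧ ∃ C : ℝ≥0, ∀ δ : ℝ, 0 < δ →
      δ ≤ c₂ ^ 2 / 2 → ∀ γ : Coeff, SmallCoeff K γ δ → ∀ u : SpaceTime → E3, Adm K u →
      ∀ H : ℝ → ℝ≥0∞, (∀ t : ℝ, 0 ≤ t → ∑ q ∈ timeIdx (ν + 1) (n + 1),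
          (l2Norm Kᶜ ((scalMod η)^[q.1] ((pd 0)^[q.2] (elasticPert c₁ c₂ γ u))) t
            + l2Norm Kᶜ (commSum (fun h => (scalMod η)^[q.1] ((pd 0)^[q.2] h)) γ u) t)
        ≤ ENNReal.ofReal (δ / (1 + t)) * ∑ q ∈ timeIdx (ν + 1) (n + 1),
            l2Norm Kᶜ ((scalMod η)^[q.1] ((pd 0)^[q.2] (grad u))) t + H t) →
      ∀ t : ℝ, 0 ≤ t → ENNReal.ofReal √(totalEnergy c₁ c₂ K η γ u (ν + 1) (n + 1) t)
        ≤ ENNReal.ofReal ((1 + t) ^ (A * δ)) * (∑ q ∈ timeIdx (ν + 1) (n + 1),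
            ENNReal.ofReal √(energyX c₁ c₂ K η γ u q.1 q.2 0)
          + C * ((∫⁻ s in Set.Icc 0 t, fnorm Kᶜ ν n (elastic c₁ c₂ u) s)
            + (∫⁻ s in Set.Icc 0 t, fnorm (Kᶜ ∩ Metric.ball 0 1) ν (n + 1) (grad u) s)
            + ∫⁻ s in Set.Icc 0 t, H s)) := by
  have hD := hK.measurableSet_compl
  have hB : MeasurableSet (Kᶜ ∩ Metric.ball (0 : E3) 1) :=
    hD.inter Metric.isOpen_ball.measurableSet
  have hκ := coerc_pos hc₂
  have hκ' := Real.sqrt_pos.2 hκ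
  obtain ⟨CD, hCD⟩ : Dom (fun u : SpaceTime → E3 => Smooth u)
      (fun u t => ∑ q ∈ timeIdx (ν + 1) (n + 1),
        l2Norm Kᶜ ((scalMod η)^[q.1] ((pd 0)^[q.2] (grad u))) t) (tnorm K η (ν + 1) (n + 1)) :=
    Dom.sum fun q hq => l2Norm_iterate_grad_le hK hη hq
  obtain ⟨CE, hCE⟩ : Dom (fun u : SpaceTime → E3 => Smooth u)
      (fun u t => ∑ q ∈ timeIdx (ν + 1) (n + 1),
        l2Norm Kᶜ (elastic c₁ c₂ ((scalMod η)^[q.1] ((pd 0)^[q.2] u))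
          - (scalMod η)^[q.1] ((pd 0)^[q.2] (elastic c₁ c₂ u))) t)
      (fun u t => fnorm Kᶜ ν n (elastic c₁ c₂ u) t
        + fnorm (Kᶜ ∩ Metric.ball 0 1) ν (n + 1) (grad u) t) :=
    Dom.sum fun q hq => (l2Norm_comm_le hK hη hq).trans (Dom.add_add
      ((wnorm_le_fnorm hD ν n).comp (elastic c₁ c₂) fun u hu => hu.elastic)
      (gnorm_le_fnorm_grad hB ν (n + 1)))
  -- `M √Y` bounds the norms of `S̃^μ ∂_t^j u'` in the hypothesis on the source: the gradient is
  -- moved outside at the cost `CD`, and the other factor comes from coercivity.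
  set M : ℝ := CD * (4 * (timeIdx (ν + 1) (n + 1)).card * (√(coerc c₂))⁻¹) with hM
  have hM0 : 0 ≤ M := by positivity
  -- `Y'` has the terms `δ/(1+t) · M κ^{-1/2} Y` from the source and `δ/(1+t) · (3/2) κ^{-1} Y` from
  -- the error term, with `κ = coerc c₂`. Passing to `√Y` halves them, and `A` is their sum divided
  -- by `δ/(1+t) · Y`.
  refine ⟨1 / 2 * (M * (√(coerc c₂))⁻¹ + 3 / 2 * (coerc c₂)⁻¹), by positivity,
    (Real.toNNReal (1 / 2 * (√(coerc c₂))⁻¹)) * (1 + CE), ?_⟩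
  intro δ hδ hδ₂ γ hγ u hu H hH t ht
  have hs : Smooth u := hu.toTame.smooth
  set Y := totalEnergy c₁ c₂ K η γ u (ν + 1) (n + 1) with hYdef
  set r := sourceNrm c₁ c₂ K η γ u (ν + 1) (n + 1) with hr
  have hY0 : ∀ s, 0 ≤ s → 0 ≤ Y s := fun s hs =>
    Finset.sum_nonneg fun q _ => energyX_nonneg hK hη hc₂ h12 hγ hδ.le hδ₂ hu _ _ hs
  have hYd := fun s (hs : 0 ≤ s) => hasDerivWithinAt_totalEnergy (c₁ := c₁) (c₂ := c₂) hK hη hγ hu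
    (ν + 1) (n + 1) hs
  have hYc : ContinuousOn Y (Set.Ici 0) := fun s hs => (hYd s hs).continuousWithinAt
  have hrc : ContinuousOn r (Set.Ici 0) := continuousOn_finsetSum _ fun q _ =>
    continuousOn_nrm hK (Tame.elasticPert hK hγ.smooth (adm_iterate hK hη hu q.1 q.2).toTame)
  -- `G` is the part of the source not absorbed by the growth factor. Unlike `H` it is continuous,
  -- so Gronwall's inequality can be run with `G`; the comparison with `H` is made only afterwards,
  -- pointwise.
  set G : ℝ → ℝ := fun s => max 0 (r s - M * (δ / (1 + s)) * √(Y s)) with hG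
  have hGc : ContinuousOn G (Set.Ici 0) := by
    refine ContinuousOn.sup continuousOn_const (hrc.sub ((continuousOn_const.mul
      (continuousOn_const.div (by fun_prop) fun s hs => ?_)).mul hYc.sqrt))
    exact (add_pos_of_pos_of_nonneg one_pos hs).ne'
  have hrle : ∀ s, 0 ≤ s → ENNReal.ofReal (r s) ≤ ENNReal.ofReal (M * (δ / (1 + s)) * √(Y s))
      + (H s + CE * (fnorm Kᶜ ν n (elastic c₁ c₂ u) s
        + fnorm (Kᶜ ∩ Metric.ball 0 1) ν (n + 1) (grad u) s)) := by
    intro s hs'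
    have hd : 0 ≤ δ / (1 + s) := div_nonneg hδ.le (by linarith)
    have h1 : ENNReal.ofReal (r s) = ∑ q ∈ timeIdx (ν + 1) (n + 1),
        l2Norm Kᶜ (elasticPert c₁ c₂ γ ((scalMod η)^[q.1] ((pd 0)^[q.2] u))) s := by
      rw [hr, sourceNrm, ENNReal.ofReal_sum_of_nonneg fun _ _ => nrm_nonneg _]
      exact Finset.sum_congr rfl fun q _ => ((Tame.elasticPert hK hγ.smooth
        (adm_iterate hK hη hu q.1 q.2).toTame).l2Norm_eq hK hs').symm
    have h2 : ENNReal.ofReal (δ / (1 + s)) * ∑ q ∈ timeIdx (ν + 1) (n + 1),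
        l2Norm Kᶜ ((scalMod η)^[q.1] ((pd 0)^[q.2] (grad u))) s
        ≤ ENNReal.ofReal (M * (δ / (1 + s)) * √(Y s)) := by
      have h3 := (hCD u hs s hs').trans (mul_le_mul_right (tnorm_le_sqrt_totalEnergy hK hη hc₂ h12 hγ hδ.le
        hδ₂ hu (ν + 1) (n + 1) hs') _)
      refine (mul_le_mul_right h3 _).trans (le_of_eq ?_)
      rw [← ENNReal.ofReal_coe_nnreal, ← ENNReal.ofReal_mul (by positivity),
        ← ENNReal.ofReal_mul (by positivity), ← ENNReal.ofReal_mul hd]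
      congr 1
      rw [hM]
      ring
    rw [h1]
    refine (Finset.sum_le_sum fun q _ => l2Norm_elasticPert_iterate_le hK hη hγ.smooth hs q.1 q.2
      s).trans ?_
    rw [Finset.sum_add_distrib]
    refine (add_le_add ((hH s hs').trans (add_le_add h2 le_rfl)) (hCE u hs s hs')).trans ?_
    rw [add_assoc]
  set k : ℝ := (√(coerc c₂))⁻¹ with hk
  have hk0 : 0 < k := inv_pos.2 hκ'
  have hGpos : ∀ s, 0 ≤ G s := fun s => le_max_left _ _
  -- Composition with `max s 0` extends the forcing continuously to negative times.
  have hgc : Continuous fun s : ℝ => 1 / 2 * k * G (max s 0) :=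
    continuous_const.mul (hGc.comp_continuous (by fun_prop) fun s => le_max_right s 0)
  have hg0 : ∀ s : ℝ, 0 ≤ 1 / 2 * k * G (max s 0) := fun s =>
    mul_nonneg (by positivity) (hGpos _)
  have hgron := sqrt_le_of_deriv_le (a := 1 / 2 * (M * k + 3 / 2 * (coerc c₂)⁻¹) * δ) hY0 hYd hgc
    hg0 (by positivity) (fun s hs' => ?_) ht
  · have hint : ENNReal.ofReal (∫ s in (0 : ℝ)..t, 1 / 2 * k * G (max s 0))
        ≤ (Real.toNNReal (1 / 2 * k)) * (1 + CE)
          * ((∫⁻ s in Set.Icc 0 t, fnorm Kᶜ ν n (elastic c₁ c₂ u) s)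
            + (∫⁻ s in Set.Icc 0 t, fnorm (Kᶜ ∩ Metric.ball 0 1) ν (n + 1) (grad u) s)
            + ∫⁻ s in Set.Icc 0 t, H s) := by
      rw [intervalIntegral.integral_of_le ht, MeasureTheory.ofReal_integral_eq_lintegral_ofReal
        ((hgc.integrableOn_Icc (a := 0) (b := t)).mono_set Set.Ioc_subset_Icc_self)
        (Filter.Eventually.of_forall hg0)]
      refine (MeasureTheory.lintegral_mono_set Set.Ioc_subset_Icc_self).trans ?_
      have h1 : ∀ s ∈ Set.Icc 0 t, ENNReal.ofReal (1 / 2 * k * G (max s 0))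
          ≤ (Real.toNNReal (1 / 2 * k)) * (1 + CE) * ((fnorm Kᶜ ν n (elastic c₁ c₂ u) s
            + fnorm (Kᶜ ∩ Metric.ball 0 1) ν (n + 1) (grad u) s) + H s) := by
        intro s hs'
        rw [max_eq_left hs'.1, ENNReal.ofReal_mul (by positivity), mul_assoc]
        refine mul_le_mul_right ?_ _
        have h2 : ENNReal.ofReal (G s) ≤ H s + CE * (fnorm Kᶜ ν n (elastic c₁ c₂ u) s
            + fnorm (Kᶜ ∩ Metric.ball 0 1) ν (n + 1) (grad u) s) := by
          rw [hG]
          beta_reduce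
          have hd : 0 ≤ δ / (1 + s) := div_nonneg hδ.le (by linarith [hs'.1])
          rw [ENNReal.ofReal_max, ENNReal.ofReal_zero, max_eq_right zero_le,
            ENNReal.ofReal_sub _ (by positivity), tsub_le_iff_left]
          exact hrle s hs'.1
        refine h2.trans ?_
        rw [add_mul, one_mul]
        exact add_le_add le_add_self (mul_le_mul_right le_self_add _)
      -- `H` may be nonmeasurable: monotonicity holds for lower integrals, a finite constant can be
      -- pulled out, and additivity needs only the other summands to be measurable.
      refine (MeasureTheory.setLIntegral_mono' measurableSet_Icc h1).trans (le_of_eq ?_)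
      have m1 := measurable_fnorm Kᶜ ν n (hs.elastic (c₁ := c₁) (c₂ := c₂))
      have m2 := measurable_fnorm (Kᶜ ∩ Metric.ball (0 : E3) 1) ν (n + 1) (grad_smooth hs)
      have m12 : Measurable fun s => fnorm Kᶜ ν n (elastic c₁ c₂ u) s
        + fnorm (Kᶜ ∩ Metric.ball 0 1) ν (n + 1) (grad u) s := m1.add m2
      rw [MeasureTheory.lintegral_const_mul' _ _ (by finiteness),
        MeasureTheory.lintegral_add_left m12, MeasureTheory.lintegral_add_left m1]
    refine (ENNReal.ofReal_le_ofReal hgron).trans ?_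
    rw [ENNReal.ofReal_mul (by positivity), ENNReal.ofReal_add (Real.sqrt_nonneg _)
      (intervalIntegral.integral_nonneg ht fun s _ => hg0 s)]
    refine mul_le_mul_right (add_le_add ?_ ?_) _
    · exact ofReal_sqrt_sum_le fun q _ => energyX_nonneg hK hη hc₂ h12 hγ hδ.le hδ₂ hu _ _ le_rfl
    · push_cast
      exact hint
  · have h1 := deriv_totalEnergy_le hK hη hc₂ h12 hγ hδ.le hδ₂ hu (ν + 1) (n + 1) hs'
    refine h1.trans ?_
    rw [← hYdef, ← hr, ← hk, max_eq_left hs']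
    have h2 : r s ≤ M * (δ / (1 + s)) * √(Y s) + G s := by
      have := le_max_right 0 (r s - M * (δ / (1 + s)) * √(Y s))
      rw [hG]
      linarith
    have h3 : k * √(Y s) * r s ≤ k * √(Y s) * (M * (δ / (1 + s)) * √(Y s) + G s) :=
      mul_le_mul_of_nonneg_left h2 (by positivity)
    have h4 : k * √(Y s) * (M * (δ / (1 + s)) * √(Y s)) = k * M * (δ / (1 + s)) * Y s := by
      calc k * √(Y s) * (M * (δ / (1 + s)) * √(Y s))
          = k * M * (δ / (1 + s)) * (√(Y s) * √(Y s)) := by ring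
        _ = _ := by rw [Real.mul_self_sqrt (hY0 s hs')]
    rw [mul_add, h4] at h3
    refine (add_le_add h3 le_rfl).trans (le_of_eq ?_)
    ring

end Conclusion

end

end ExteriorElastic

namespace ExteriorElastic

noncomputable section

variable {c₁ c₂ : ℝ} {K : Set E3} {η : E3 → ℝ}

/-- The elliptic part of the estimate: all derivatives are controlled by the tangential norm and
`Lu`. -/
theorem fnorm_grad_le (hK : IsSmoothObstacle K) (hη : IsCutoff K η) (hc₂ : 0 < c₂ ^ 2)
    (h12 : c₂ ^ 2 ≤ c₁ ^ 2) (a n : ℕ) :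
    Dom (fun v : SpaceTime → E3 => Adm K v) (fun v => fnorm Kᶜ a n (grad v))
      (fun v t => tnorm K η a n v t + fnorm Kᶜ a (n - 1) (elastic c₁ c₂ v) t) := by
  have hD := hK.measurableSet_compl
  have h₁ := (fnorm_le_wnorm (F := PiLp 2 fun _ : Fin 4 => E3) (D := Kᶜ) a n).comp
    (Q := fun v : SpaceTime → E3 => Adm K v) grad fun _ _ => trivial
  have h₂ := (wnorm_grad_le (F := E3) hD a n).mono fun v (hv : Adm K v) => hv.toTame.smooth
  have h₃ := (wnorm_le_fnorm (F := E3) hD a (n - 1)).comp (Q := fun v : SpaceTime → E3 => Adm K v)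
    (elastic c₁ c₂) fun v hv => hv.toTame.smooth.elastic
  exact h₁.trans (h₂.trans ((gnorm_le_main hK hη hc₂ h12 a n).trans (Dom.refl.add_add h₃)))

end

end ExteriorElastic

theorem mainTheorem5 (c₁ c₂ : ℝ) (hc₂ : 0 < c₂ ^ 2) (hc₁ : 0 < c₁ ^ 2 - 4 / 3 * c₂ ^ 2) :
    -- the smallness threshold depends only on the two speeds
    ∃ δ₀ : ℝ, 0 < δ₀ ∧
    ∀ K : Set E3, IsSmoothObstacle K →
    ∀ η : E3 → ℝ, ContDiff ℝ ∞ η → (∀ x ∈ K, η x = 0) → (∀ x : E3, 1 < ‖x‖ → η x = 1) →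
    ∀ N ν : ℕ, ∃ A : ℝ, 0 < A ∧ ∃ C : ℝ≥0,
    ∀ δ : ℝ, 0 < δ → δ ≤ δ₀ →
    ∀ γ : Coeff, (∀ I J j k, ContDiff ℝ ∞ (γ I J j k)) →
      -- symmetry
      (∀ I J j k, ∀ t : ℝ, 0 ≤ t → ∀ x ∈ Kᶜ, γ I J j k (t, x) = γ J I k j (t, x)) →
      -- smallness of the coefficients and of their first derivatives
      (∀ t : ℝ, 0 ≤ t → ∑ I, ∑ J, ∑ j, ∑ k, supNorm Kᶜ (γ I J j k) t
        ≤ ENNReal.ofReal (δ / (1 + t))) →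
      (∀ t : ℝ, 0 ≤ t → ∑ I, ∑ J, ∑ j, ∑ k, ∑ β, supNorm Kᶜ (pd β (γ I J j k)) t
        ≤ ENNReal.ofReal (δ / (1 + t))) →
    ∀ (F : SpaceTime → E3) (f g : E3 → E3) (u : SpaceTime → E3),
      IsSmoothSolution c₁ c₂ K γ F f g u →
      -- `u` vanishes for large `|x|` on every time strip
      (∀ T : ℝ, 0 ≤ T → ∃ R : ℝ, ∀ t ∈ Set.Icc 0 T, ∀ x ∈ Kᶜ, R ≤ ‖x‖ → u (t, x) = 0) →
    ∀ H : ℝ → ℝ≥0∞,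
      (∀ t : ℝ, 0 ≤ t →
        ∑ q ∈ timeIdx (ν + 1) (N + ν + 1),
          (l2Norm Kᶜ ((scalMod η)^[q.1] ((pd 0)^[q.2] (elasticPert c₁ c₂ γ u))) t
            + l2Norm Kᶜ (commSum (fun h => (scalMod η)^[q.1] ((pd 0)^[q.2] h)) γ u) t)
        ≤ ENNReal.ofReal (δ / (1 + t))
            * ∑ q ∈ timeIdx (ν + 1) (N + ν + 1),
                l2Norm Kᶜ ((scalMod η)^[q.1] ((pd 0)^[q.2] (grad u))) t
          + H t) →
    ∀ t : ℝ, 0 ≤ t →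
      ∑ q ∈ fullIdx (ν + 1) (N + ν + 1), l2Norm Kᶜ (scal^[q.1] (pdMulti q.2 (grad u))) t
      ≤ C * (∑ q ∈ fullIdx (ν + 1) (N + ν),
              l2Norm Kᶜ (scal^[q.1] (pdMulti q.2 (elastic c₁ c₂ u))) t
          + ENNReal.ofReal ((1 + t) ^ (A * δ))
            * ∑ q ∈ timeIdx (ν + 1) (N + ν + 1),
                ENNReal.ofReal (Real.sqrt (energyX c₁ c₂ K η γ u q.1 q.2 0))
          + ENNReal.ofReal ((1 + t) ^ (A * δ))
            * ((∫⁻ s in Set.Icc 0 t, ∑ q ∈ fullIdx ν (N + ν),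
                  l2Norm Kᶜ (scal^[q.1] (pdMulti q.2 (elastic c₁ c₂ u))) s)
              + ∫⁻ s in Set.Icc 0 t, H s)
          + ENNReal.ofReal ((1 + t) ^ (A * δ))
            * ∫⁻ s in Set.Icc 0 t, ∑ q ∈ fullIdx ν (N + ν + 1),
                l2Norm (Kᶜ ∩ Metric.ball 0 1) (scal^[q.1] (pdMulti q.2 (grad u))) s) := by
  have h12 : c₂ ^ 2 ≤ c₁ ^ 2 := by linarith
  -- This threshold keeps the energy density coercive and involves only the speeds.
  refine ⟨c₂ ^ 2 / 2, by positivity, fun K hK η hη₀ hη₁ hη₂ N ν => ?_⟩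
  have hη : IsCutoff K η := ⟨hη₀, hη₁, hη₂⟩
  obtain ⟨A, hA, C₁, h₁⟩ := exists_totalEnergy_le hK hη hc₂ h12 ν (N + ν)
  obtain ⟨C₂, h₂⟩ := fnorm_grad_le hK hη hc₂ h12 (ν + 1) (N + ν + 1)
  set B : ℝ≥0 := Real.toNNReal (4 * (timeIdx (ν + 1) (N + ν + 1)).card * (√(coerc c₂))⁻¹) with hB
  -- `C₂` is the elliptic constant, `B` compares the tangential norm with the root of the energy,
  -- and `C₁` is the Gronwall constant. The added ones let a single product also dominate the terms
  -- having coefficient `1`.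
  refine ⟨A, hA, C₂ * ((1 + B) * (1 + C₁)), fun δ hδ hδ₂ γ hγ hsymm hγ₀ hγ₁ F f g u hu hsupp H hH t
    ht => ?_⟩
  have hγ' : SmallCoeff K γ δ := smallCoeff_of_supNorm hK hδ hγ hsymm hγ₀ hγ₁
  have hu' : Adm K u := by
    refine ⟨⟨hu.smooth, fun T hT => ?_⟩, hu.boundary⟩
    obtain ⟨R, hR⟩ := hsupp T hT
    exact ⟨R, fun s hs x hx hxR => hR s hs x hx hxR.le⟩
  have h₀ : fnorm Kᶜ (ν + 1) (N + ν + 1) (grad u) t ≤ C₂ * (tnorm K η (ν + 1) (N + ν + 1) u t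
    + fnorm Kᶜ (ν + 1) (N + ν) (elastic c₁ c₂ u) t) := h₂ u hu' t ht
  refine h₀.trans ?_
  have h₃ := tnorm_le_sqrt_totalEnergy hK hη hc₂ h12 hγ' hδ.le hδ₂ hu' (ν + 1) (N + ν + 1) ht
  have h₄ := h₁ δ hδ hδ₂ γ hγ' u hu' H hH t ht
  -- Once the sums are read as `fnorm`s, only arithmetic in extended nonnegative reals is left.
  change _ ≤ _ * (fnorm Kᶜ (ν + 1) (N + ν) (elastic c₁ c₂ u) t + _ + _ * ((∫⁻ s in Set.Icc 0 t,
    fnorm Kᶜ ν (N + ν) (elastic c₁ c₂ u) s) + _) + _ * ∫⁻ s in Set.Icc 0 t,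
    fnorm (Kᶜ ∩ Metric.ball 0 1) ν (N + ν + 1) (grad u) s)
  generalize (∫⁻ s in Set.Icc 0 t, fnorm Kᶜ ν (N + ν) (elastic c₁ c₂ u) s) = I₁ at h₄ ⊢
  generalize (∫⁻ s in Set.Icc 0 t, fnorm (Kᶜ ∩ Metric.ball 0 1) ν (N + ν + 1) (grad u) s) = I₂
    at h₄ ⊢
  generalize (∫⁻ s in Set.Icc 0 t, H s) = I₃ at h₄ ⊢
  generalize ENNReal.ofReal ((1 + t) ^ (A * δ)) = W at h₄ ⊢
  generalize ∑ q ∈ timeIdx (ν + 1) (N + ν + 1),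
    ENNReal.ofReal √(energyX c₁ c₂ K η γ u q.1 q.2 0) = X at h₄ ⊢
  generalize fnorm Kᶜ (ν + 1) (N + ν) (elastic c₁ c₂ u) t = Q
  have h₅ : X + C₁ * (I₁ + I₂ + I₃) ≤ (1 + C₁) * (X + (I₁ + I₂ + I₃)) := by
    rw [add_mul, one_mul]
    exact add_le_add le_self_add (mul_le_mul_right le_add_self _)
  have h₆ : tnorm K η (ν + 1) (N + ν + 1) u t
      ≤ B * ((1 + C₁) * (W * (X + (I₁ + I₂ + I₃)))) := by
    refine h₃.trans (mul_le_mul_right (h₄.trans ((mul_le_mul_right h₅ _).trans (le_of_eq ?_))) _)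
    ring
  push_cast
  rw [mul_assoc]
  refine mul_le_mul_right ?_ _
  calc tnorm K η (ν + 1) (N + ν + 1) u t + Q
      ≤ B * ((1 + C₁) * (W * (X + (I₁ + I₂ + I₃)))) + 1 * (1 * Q) := by
        rw [one_mul, one_mul]
        exact add_le_add h₆ le_rfl
    _ ≤ (1 + B) * ((1 + C₁) * (W * (X + (I₁ + I₂ + I₃))))
        + (1 + B) * ((1 + C₁) * Q) := by
        refine add_le_add (mul_le_mul_left le_add_self _) (mul_le_mul' le_self_add
          (mul_le_mul_left le_self_add _))
    _ = _ := by ring
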